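/- Let $X,Y,A,B$ be finite sets with $X,Y$ non-empty. A POVM on a Hilbert space $H$ indexed by $A$ is a family of positive operators $\{M_a\}_{a\in A}$ with $\sum_a M_a=1$; it is a PVM if all $M_a$ are self-adjoint projections. A *quantum model* is a tuple $S=(H_A,H_B,\{M^x_a\},\{N^y_b\},\psi)$ where $H_A,H_B$ are finite-dimensional complex Hilbert spaces, $\{M^x_a\}_{a\in A}$ is a POVM on $H_A$ for each $x\in X$, $\{N^y_b\}_{b\in B}$ is a POVM on $H_B$ for each $y\in Y$, and $\psi\in H_A\otimes H_B$ is a unit vector. It is *projective* if all these POVMs are PVMs. It is a model for the correlation $p=(p(a,b|x,y))$, $p(a,b|x,y)=\langle\psi, (M^x_a\otimes N^y_b)\psi\rangle$. Let $C_q=C_q(X,Y,A,B)\subseteq\mathbb R^{A\times B\times X\times Y}$ be the set of correlations that have a quantum model. A model $\tilde S=(\tilde H_A,\tilde H_B,\{\tilde M^x_a\},\{\tilde N^y_b\},\tilde\psi)$ is a *local dilation* of $S$ if there are finite-dimensional Hilbert spaces $K_A,K_B$, a unit vector $\mathrm{aux}\in K_A\otimes K_B$ and isometries $I_A:H_A\to\tilde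 H_A\otimes K_A$, $I_B:H_B\to\tilde H_B\otimes K_B$ such that, for all $a,b,x,y$ and up to reordering tensor factors, $$(I_A\otimes I_B)(M^x_a\otimes N^y_b)\psi=\big((\tilde M^x_a\otimes\tilde N^y_b)\tilde\psi\big)\otimes \mathrm{aux}.$$ For a class $\mathcal C$ of quantum models, $p$ is a *self-test for $\mathcal C$* if there is a model $\tilde S\in\mathcal C$ for $p$ that is a local dilation of every model $S\in\mathcal C$ for $p$. Let $\mathrm{POVM}^{X,A}$ be the universal $C^*$-algebra generated by positive contractions $e^x_a$ ($x\in X$, $a\in A$) with $\sum_a e^x_a=1$ for all $x$, and let $\mathrm{PVM}^{X,A}$ be its quotient by the relations $(e^x_a)^2=e^x_a$. Write $m^x_a$ and $n^y_b$ for the generators of $\mathrm{POVM}^{X,A}$ and $\mathrm{POVM}^{Y,B}$. A state $f$ (a positive linear functional with $f(1)=1$) on $\mathrm{POVM}^{X,A}\otimes_{\min}\mathrm{POVM}^{Y,B}$ is *finite-dimensional* if its GNS Hilbert space is finite-dimensional; it is *projective* if it is the pullback of a state on $\mathrm{PVM}^{X,A}\otimes_{\min}\mathrm{PVM}^{Y,B}$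 along the quotient homomorphism; it has correlation $p$ if $f(m^x_a\otimes n^y_b)=p(a,b|x,y)$ for all $a,b,x,y$. For a set $\mathcal S$ of such states, $p$ is an *abstract state self-test for $\mathcal S$* if there is exactly one $f\in\mathcal S$ with correlation $p$. **Theorem.** Let $p$ be an extreme point of $C_q(X,Y,A,B)$ which is synchronous (that is, after identifying $X$ with $Y$ and $A$ with $B$ by some bijections, $p(a,b|x,x)=0$ for all $x$ and all $a\ne b$) or binary (that is, $|A|=|B|=2$). Then the following are equivalent: 1. $p$ is a self-test for the class of all quantum models; 2. $p$ is a self-test for the class of projective quantum models; 3. $p$ is an abstract state self-test for finite-dimensional states; 4. $p$ is an abstract state self-test for projective finite-dimensional states. -/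

import Mathlib

open scoped TensorProduct ComplexOrder ENNReal InnerProductSpace

noncomputable section

namespace SelfTest

/-- A non-zero complex Hilbert space. -/
structure Hilb where
  carrier : Type
  [normed : NormedAddCommGroup carrier]
  [inner : InnerProductSpace ℂ carrier]
  [complete : CompleteSpace carrier]
  [nontrivial : Nontrivial carrier]

instance : CoeSort Hilb Type := ⟨Hilb.carrier⟩

attribute [instance] Hilb.normed Hilb.inner Hilb.complete Hilb.nontrivial

/-! ### Families of POVMs on a Hilbert space -/

/-- A family of POVMs `{M^x_a : a ∈ A}`, `x ∈ X`, on a non-zero Hilbert space. -/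
structure POVMFamily (X A : Type*) [Fintype A] where
  /-- the Hilbert space -/
  H : Hilb
  /-- the measurement operators -/
  op : X → A → H →L[ℂ] H
  isPositive : ∀ x a, (op x a).IsPositive
  sum_eq_one : ∀ x, ∑ a, op x a = 1

/-- All measurement operators are self-adjoint projections, i.e. every POVM is a PVM. -/
def POVMFamily.IsProjective {X A : Type*} [Fintype A] (M : POVMFamily X A) : Prop :=
  ∀ x a, IsStarProjection (M.op x a)

/-- The families of PVMs. -/
abbrev PVMFamily (X A : Type*) [Fintype A] := {M : POVMFamily X A // M.IsProjective}

theorem POVMFamily.norm_op_le_one {X A : Type*} [Fintype A] (M : POVMFamily X A)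
    (x : X) (a : A) : ‖M.op x a‖ ≤ 1 := by
  have h0 : ∀ b, 0 ≤ M.op x b := fun b =>
    (ContinuousLinearMap.nonneg_iff_isPositive _).2 (M.isPositive x b)
  have h1 : M.op x a ≤ 1 := by
    rw [← M.sum_eq_one x]
    exact Finset.single_le_sum (f := fun b => M.op x b) (fun b _ => h0 b) (Finset.mem_univ a)
  exact (CStarAlgebra.norm_le_one_iff_of_nonneg _ (h0 a)).2 h1

/-! ### Bounded direct products of operator algebras -/

/-- The C⋆-algebra `∏ᵢ B(Hᵢ)` of norm-bounded families of bounded operators (operations are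
componentwise, and the norm is the supremum norm). -/
def OpProd {ι : Type*} (H : ι → Hilb) : Type _ :=
  lp (fun i => H i →L[ℂ] H i) ∞

section OpProd

variable {ι κ : Type*} (H : ι → Hilb)

instance : CStarAlgebra (lp (fun i => H i →L[ℂ] H i) ∞) where

instance : CStarAlgebra (OpProd H) :=
  inferInstanceAs (CStarAlgebra (lp (fun i => H i →L[ℂ] H i) ∞))

variable {H}

/-- The family `(Tᵢ)ᵢ` of operators with `‖Tᵢ‖ ≤ C`, as an element of `∏ᵢ B(Hᵢ)`. -/
def OpProd.mk (T : ∀ i, H i →L[ℂ] H i) (C : ℝ) (hT : ∀ i, ‖T i‖ ≤ C) : OpProd H :=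
  (⟨T, memℓp_infty ⟨C, by rintro _ ⟨i, rfl⟩; exact hT i⟩⟩ : lp (fun i => H i →L[ℂ] H i) ∞)

/-- The component of index `i`. -/
def OpProd.component (T : OpProd H) (i : ι) : H i →L[ℂ] H i :=
  (show lp (fun i => H i →L[ℂ] H i) ∞ from T) i

theorem OpProd.norm_component_le (T : OpProd H) (i : ι) : ‖T.component i‖ ≤ ‖T‖ :=
  lp.norm_apply_le_norm (E := fun i => H i →L[ℂ] H i) ENNReal.top_ne_zero T i

theorem OpProd.norm_le {T : OpProd H} {C : ℝ} (hC : 0 ≤ C) (hT : ∀ i, ‖T.component i‖ ≤ C) :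
    ‖T‖ ≤ C :=
  lp.norm_le_of_forall_le (E := fun i => H i →L[ℂ] H i) hC hT

variable (H)

/-- Restriction of a family of operators along a map of index types, a `*`-homomorphism. -/
def reindex (φ : κ → ι) : OpProd H →⋆ₐ[ℂ] OpProd (fun k => H (φ k)) where
  toFun T := OpProd.mk (fun k => T.component (φ k)) ‖T‖ fun k => T.norm_component_le (φ k)
  map_one' := rfl
  map_mul' _ _ := rfl
  map_zero' := rfl
  map_add' _ _ := rfl
  commutes' _ := rfl
  map_star' _ := rfl

theorem continuous_reindex (φ : κ → ι) : Continuous (reindex H φ) :=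
  AddMonoidHomClass.continuous_of_bound (reindex H φ) 1 fun T => by
    rw [one_mul]
    exact OpProd.norm_le (norm_nonneg _) fun k => T.norm_component_le (φ k)

end OpProd

/-! ### The algebras `POVM^{X,A}` and `PVM^{X,A}` -/

section Universal

variable {ι κ X A : Type*} [Fintype A]

/-- The family of operators `(M_i{}^x_a)_i`, for a family `F = (M_i)_i` of POVM families. -/
def gen (F : ι → POVMFamily X A) (x : X) (a : A) : OpProd (fun i => (F i).H) :=
  OpProd.mk (fun i => (F i).op x a) 1 fun i => (F i).norm_op_le_one x a

/-- The C⋆-algebra generated by the elements `e^x_a := (M_i{}^x_a)_i` of `∏ᵢ B(Hᵢ)`. -/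
def genAlgebra (F : ι → POVMFamily X A) : StarSubalgebra ℂ (OpProd (fun i => (F i).H)) :=
  (StarAlgebra.adjoin ℂ {e | ∃ x a, e = gen F x a}).topologicalClosure

theorem gen_mem (F : ι → POVMFamily X A) (x : X) (a : A) : gen F x a ∈ genAlgebra F :=
  StarSubalgebra.le_topologicalClosure _ (StarAlgebra.subset_adjoin ℂ _ ⟨x, a, rfl⟩)

theorem reindex_mem_genAlgebra (F : ι → POVMFamily X A) (φ : κ → ι)
    {T : OpProd (fun i => (F i).H)} (hT : T ∈ genAlgebra F) :
    reindex (fun i => (F i).H) φ T ∈ genAlgebra (fun k => F (φ k)) := by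
  have h : genAlgebra F ≤
      (genAlgebra (fun k => F (φ k))).comap (reindex (fun i => (F i).H) φ) := by
    refine StarSubalgebra.topologicalClosure_minimal (StarAlgebra.adjoin_le ?_)
      ((StarSubalgebra.isClosed_topologicalClosure _).preimage (continuous_reindex _ φ))
    rintro _ ⟨x, a, rfl⟩
    exact gen_mem (fun k => F (φ k)) x a
  exact h hT

variable (X A)

/-- The universal C⋆-algebra generated by positive contractions `e^x_a` with `∑ₐ e^x_a = 1`:
the C⋆-algebra generated by the `e^x_a` in the direct product over all representations (that is,
over all families of POVMs on Hilbert spaces). Hilbert spaces in `Type` suffice: the algebra has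
finitely many generators, so its cyclic representations are separable. -/
def povmAlgebra : StarSubalgebra ℂ (OpProd (fun M : POVMFamily X A => M.H)) :=
  genAlgebra (fun M : POVMFamily X A => M)

/-- The quotient of the POVM algebra by the relations `(e^x_a)² = e^x_a`, that is the universal
C⋆-algebra generated by projections `e^x_a` with `∑ₐ e^x_a = 1`. -/
def pvmAlgebra : StarSubalgebra ℂ (OpProd (fun M : PVMFamily X A => M.1.H)) :=
  genAlgebra (fun M : PVMFamily X A => M.1)

end Universal

/-! ### The minimal tensor product -/

/-- The completion of the algebraic tensor product of two Hilbert spaces. -/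
abbrev CompletedTensor (H K : Hilb) : Type := UniformSpace.Completion (H ⊗[ℂ] K)

instance (H K : Hilb) : Nontrivial (CompletedTensor H K) := by
  obtain ⟨h, hh⟩ := exists_ne (0 : H)
  obtain ⟨k, hk⟩ := exists_ne (0 : K)
  refine ⟨((h ⊗ₜ[ℂ] k : H ⊗[ℂ] K) : CompletedTensor H K), 0, fun h0 => ?_⟩
  have h1 := congrArg norm h0
  rw [UniformSpace.Completion.norm_coe, TensorProduct.norm_tmul, norm_zero] at h1
  exact mul_ne_zero (norm_ne_zero_iff.2 hh) (norm_ne_zero_iff.2 hk) h1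

/-- The Hilbert space tensor product. -/
def HTensor (H K : Hilb) : Hilb := ⟨CompletedTensor H K⟩

/-- The operator `S ⊗ T` on the Hilbert space tensor product. -/
def opTensor {H K : Hilb} (S : H →L[ℂ] H) (T : K →L[ℂ] K) : HTensor H K →L[ℂ] HTensor H K :=
  ((TensorProduct.mapL S T).completion : CompletedTensor H K →L[ℂ] CompletedTensor H K)

theorem norm_opTensor_le {H K : Hilb} (S : H →L[ℂ] H) (T : K →L[ℂ] K) :
    ‖opTensor S T‖ ≤ ‖S‖ * ‖T‖ := by
  change ‖((TensorProduct.mapL S T).completion :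
    CompletedTensor H K →L[ℂ] CompletedTensor H K)‖ ≤ ‖S‖ * ‖T‖
  refine ContinuousLinearMap.opNorm_le_bound _ (by positivity) fun v => ?_
  induction v using UniformSpace.Completion.induction_on with
  | hp => exact isClosed_le (by fun_prop) (by fun_prop)
  | ih v =>
    rw [ContinuousLinearMap.completion_apply_coe, UniformSpace.Completion.norm_coe,
      UniformSpace.Completion.norm_coe]
    exact ContinuousLinearMap.le_of_opNorm_le _ (TensorProduct.norm_mapL_le S T) v

section MinTensor

variable {ι κ ι' κ' : Type*} {H : ι → Hilb} {K : κ → Hilb}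

/-- The elementary tensor `(S_i)_i ⊗ (T_k)_k := (S_i ⊗ T_k)_{(i,k)}`. -/
def tens (S : OpProd H) (T : OpProd K) : OpProd (fun j : ι × κ => HTensor (H j.1) (K j.2)) :=
  OpProd.mk (fun j => opTensor (S.component j.1) (T.component j.2)) (‖S‖ * ‖T‖) fun j =>
    (norm_opTensor_le _ _).trans (mul_le_mul (S.norm_component_le j.1) (T.norm_component_le j.2)
      (norm_nonneg _) (norm_nonneg _))

/-- The minimal tensor product of two C⋆-algebras `𝒜 ⊆ ∏ᵢ B(Hᵢ)` and `ℬ ⊆ ∏ₖ B(Kₖ)`: the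
C⋆-algebra generated by the elementary tensors `S ⊗ T` (`S ∈ 𝒜`, `T ∈ ℬ`) in
`∏_{(i,k)} B(Hᵢ ⊗ Kₖ)`. -/
def minTensor (𝒜 : StarSubalgebra ℂ (OpProd H)) (ℬ : StarSubalgebra ℂ (OpProd K)) :
    StarSubalgebra ℂ (OpProd (fun j : ι × κ => HTensor (H j.1) (K j.2))) :=
  (StarAlgebra.adjoin ℂ {t | ∃ S ∈ 𝒜, ∃ T ∈ ℬ, t = tens S T}).topologicalClosure

theorem tens_mem {𝒜 : StarSubalgebra ℂ (OpProd H)} {ℬ : StarSubalgebra ℂ (OpProd K)}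
    {S : OpProd H} {T : OpProd K} (hS : S ∈ 𝒜) (hT : T ∈ ℬ) : tens S T ∈ minTensor 𝒜 ℬ :=
  StarSubalgebra.le_topologicalClosure _ (StarAlgebra.subset_adjoin ℂ _ ⟨S, hS, T, hT, rfl⟩)

theorem reindex_mem_minTensor {𝒜 : StarSubalgebra ℂ (OpProd H)}
    {ℬ : StarSubalgebra ℂ (OpProd K)} (φ : ι' → ι) (θ : κ' → κ)
    {𝒜' : StarSubalgebra ℂ (OpProd (fun i => H (φ i)))}
    {ℬ' : StarSubalgebra ℂ (OpProd (fun k => K (θ k)))}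
    (hφ : ∀ S ∈ 𝒜, reindex H φ S ∈ 𝒜') (hθ : ∀ T ∈ ℬ, reindex K θ T ∈ ℬ')
    {t : OpProd (fun j : ι × κ => HTensor (H j.1) (K j.2))} (ht : t ∈ minTensor 𝒜 ℬ) :
    reindex (fun j : ι × κ => HTensor (H j.1) (K j.2)) (fun j : ι' × κ' => (φ j.1, θ j.2)) t ∈
      minTensor 𝒜' ℬ' := by
  have h : minTensor 𝒜 ℬ ≤ (minTensor 𝒜' ℬ').comap
      (reindex (fun j : ι × κ => HTensor (H j.1) (K j.2)) (fun j : ι' × κ' => (φ j.1, θ j.2))) := by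
    refine StarSubalgebra.topologicalClosure_minimal (StarAlgebra.adjoin_le ?_)
      ((StarSubalgebra.isClosed_topologicalClosure _).preimage (continuous_reindex
        (fun j : ι × κ => HTensor (H j.1) (K j.2)) (fun j : ι' × κ' => (φ j.1, θ j.2))))
    rintro _ ⟨S, hS, T, hT, rfl⟩
    exact tens_mem (hφ S hS) (hθ T hT)
  exact h ht

theorem isClosed_minTensor (𝒜 : StarSubalgebra ℂ (OpProd H)) (ℬ : StarSubalgebra ℂ (OpProd K)) :
    IsClosed (minTensor 𝒜 ℬ : Set (OpProd (fun j : ι × κ => HTensor (H j.1) (K j.2)))) :=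
  StarSubalgebra.isClosed_topologicalClosure _

instance minTensorCStarAlgebra (𝒜 : StarSubalgebra ℂ (OpProd H)) (ℬ : StarSubalgebra ℂ (OpProd K)) :
    CStarAlgebra (minTensor 𝒜 ℬ) :=
  StarSubalgebra.cstarAlgebra (minTensor 𝒜 ℬ) (h_closed := isClosed_minTensor 𝒜 ℬ)

/-- The homomorphism of minimal tensor products given by restriction of families of operators
along maps of index types. -/
def minTensorRestrict {𝒜 : StarSubalgebra ℂ (OpProd H)}
    {ℬ : StarSubalgebra ℂ (OpProd K)} (φ : ι' → ι) (θ : κ' → κ)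
    {𝒜' : StarSubalgebra ℂ (OpProd (fun i => H (φ i)))}
    {ℬ' : StarSubalgebra ℂ (OpProd (fun k => K (θ k)))}
    (hφ : ∀ S ∈ 𝒜, reindex H φ S ∈ 𝒜') (hθ : ∀ T ∈ ℬ, reindex K θ T ∈ ℬ') :
    minTensor 𝒜 ℬ →⋆ₐ[ℂ] minTensor 𝒜' ℬ' :=
  StarAlgHom.codRestrict
    ((reindex (fun j : ι × κ => HTensor (H j.1) (K j.2)) (fun j : ι' × κ' => (φ j.1, θ j.2))).comp
      (minTensor 𝒜 ℬ).subtype) (minTensor 𝒜' ℬ')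
    (fun t => reindex_mem_minTensor φ θ hφ hθ t.2)

end MinTensor

section Algebras

variable (X Y A B : Type*) [Fintype A] [Fintype B]

/-- The C⋆-algebra `POVM^{X,A} ⊗_min POVM^{Y,B}`. -/
abbrev POVMTensor : Type _ := ↥(minTensor (povmAlgebra X A) (povmAlgebra Y B))

/-- The C⋆-algebra `PVM^{X,A} ⊗_min PVM^{Y,B}`. -/
abbrev PVMTensor : Type _ := ↥(minTensor (pvmAlgebra X A) (pvmAlgebra Y B))

instance : CStarAlgebra (POVMTensor X Y A B) :=
  minTensorCStarAlgebra (povmAlgebra X A) (povmAlgebra Y B)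

instance : CStarAlgebra (PVMTensor X Y A B) :=
  minTensorCStarAlgebra (pvmAlgebra X A) (pvmAlgebra Y B)

instance : PartialOrder (POVMTensor X Y A B) := CStarAlgebra.spectralOrder _
instance : StarOrderedRing (POVMTensor X Y A B) := CStarAlgebra.spectralOrderedRing _
instance : PartialOrder (PVMTensor X Y A B) := CStarAlgebra.spectralOrder _
instance : StarOrderedRing (PVMTensor X Y A B) := CStarAlgebra.spectralOrderedRing _

variable {X Y A B}

/-- The element `m^x_a ⊗ n^y_b` of `POVM^{X,A} ⊗_min POVM^{Y,B}`. -/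
def POVMTensor.gen (x : X) (y : Y) (a : A) (b : B) : POVMTensor X Y A B :=
  ⟨tens (SelfTest.gen (fun M : POVMFamily X A => M) x a)
    (SelfTest.gen (fun N : POVMFamily Y B => N) y b), tens_mem (gen_mem _ x a) (gen_mem _ y b)⟩

variable (X Y A B)

/-- The quotient homomorphism
`q : POVM^{X,A} ⊗_min POVM^{Y,B} → PVM^{X,A} ⊗_min PVM^{Y,B}`; it restricts a family of operators
indexed by pairs of POVM families to the pairs of PVM families. -/
def quotientHom : POVMTensor X Y A B →⋆ₐ[ℂ] PVMTensor X Y A B :=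
  minTensorRestrict (𝒜 := povmAlgebra X A) (ℬ := povmAlgebra Y B)
    (𝒜' := pvmAlgebra X A) (ℬ' := pvmAlgebra Y B) Subtype.val Subtype.val
    (fun _ hS => reindex_mem_genAlgebra (fun M : POVMFamily X A => M) Subtype.val hS)
    (fun _ hT => reindex_mem_genAlgebra (fun N : POVMFamily Y B => N) Subtype.val hT)

end Algebras

/-! ### Abstract states -/

/-- An abstract state on a unital C⋆-algebra: a positive linear functional `f` with `f 1 = 1`. -/
structure AbstractState (𝒜 : Type*) [CStarAlgebra 𝒜] [PartialOrder 𝒜] [StarOrderedRing 𝒜] where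
  toPos : 𝒜 →ₚ[ℂ] ℂ
  map_one : toPos 1 = 1

namespace AbstractState

/-- A state is finite-dimensional if its GNS Hilbert space is finite-dimensional. -/
def IsFiniteDimensional {𝒜 : Type*} [CStarAlgebra 𝒜] [PartialOrder 𝒜] [StarOrderedRing 𝒜]
    (f : AbstractState 𝒜) : Prop :=
  FiniteDimensional ℂ f.toPos.GNS

variable {X Y A B : Type*} [Fintype A] [Fintype B]

/-- A state on `POVM^{X,A} ⊗_min POVM^{Y,B}` is projective if it is the pullback along `q` of a
state on `PVM^{X,A} ⊗_min PVM^{Y,B}`. -/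
def IsProjective (f : AbstractState (POVMTensor X Y A B)) : Prop :=
  ∃ g : AbstractState (PVMTensor X Y A B), ∀ t, f.toPos t = g.toPos (quotientHom X Y A B t)

/-- `f(m^x_a ⊗ n^y_b) = p(a,b|x,y)` for all `x, y, a, b`. -/
def HasCorrelation (f : AbstractState (POVMTensor X Y A B)) (p : X → Y → A → B → ℝ) : Prop :=
  ∀ x y a b, f.toPos (POVMTensor.gen x y a b) = (p x y a b : ℂ)

end AbstractState

/-! ### Quantum models and correlations -/

/-- A (finite-dimensional, POVM) quantum model: POVMs `M^x` on `H_A`, POVMs `N^y` on `H_B`, and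
a unit vector `ψ ∈ H_A ⊗ H_B`, where `H_A` and `H_B` are finite-dimensional Hilbert spaces. -/
structure QuantumModel (X Y A B : Type*) [Fintype A] [Fintype B] where
  /-- Alice's Hilbert space and measurements -/
  M : POVMFamily X A
  /-- Bob's Hilbert space and measurements -/
  N : POVMFamily Y B
  finite_left : FiniteDimensional ℂ M.H
  finite_right : FiniteDimensional ℂ N.H
  /-- the vector state -/
  ψ : M.H ⊗[ℂ] N.H
  norm_ψ : ‖ψ‖ = 1

attribute [instance] QuantumModel.finite_left QuantumModel.finite_right

namespace QuantumModel

variable {X Y A B : Type*} [Fintype A] [Fintype B]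

/-- The vector `(M^x_a ⊗ N^y_b) ψ`. -/
def vec (S : QuantumModel X Y A B) (x : X) (y : Y) (a : A) (b : B) : S.M.H ⊗[ℂ] S.N.H :=
  TensorProduct.mapL (S.M.op x a) (S.N.op y b) S.ψ

/-- `S` is a model for `p`: `p(a,b|x,y) = ⟨ψ| M^x_a ⊗ N^y_b |ψ⟩` for all `x, y, a, b`. -/
def IsModelFor (S : QuantumModel X Y A B) (p : X → Y → A → B → ℝ) : Prop :=
  ∀ x y a b, ⟪S.ψ, S.vec x y a b⟫_ℂ = (p x y a b : ℂ)

/-- All measurements of the model are projective. -/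
def IsProjective (S : QuantumModel X Y A B) : Prop :=
  S.M.IsProjective ∧ S.N.IsProjective

/-- `S ⪰ S'`: the model `S'` is a local dilation of `S`. The tensor factors of
`(H'_A ⊗ H'_B) ⊗ (H_A^aux ⊗ H_B^aux)` are reordered to
`(H'_A ⊗ H_A^aux) ⊗ (H'_B ⊗ H_B^aux)`. -/
def LocallyDilatesTo (S S' : QuantumModel X Y A B) : Prop :=
  ∃ (KA KB : Type) (_ : NormedAddCommGroup KA) (_ : NormedAddCommGroup KB)
    (_ : InnerProductSpace ℂ KA) (_ : InnerProductSpace ℂ KB)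
    (_ : FiniteDimensional ℂ KA) (_ : FiniteDimensional ℂ KB)
    (aux : KA ⊗[ℂ] KB) (IA : S.M.H →ₗᵢ[ℂ] S'.M.H ⊗[ℂ] KA) (IB : S.N.H →ₗᵢ[ℂ] S'.N.H ⊗[ℂ] KB),
    ‖aux‖ = 1 ∧ ∀ x y a b,
      TensorProduct.map IA.toLinearMap IB.toLinearMap (S.vec x y a b) =
        TensorProduct.tensorTensorTensorComm ℂ S'.M.H S'.N.H KA KB (S'.vec x y a b ⊗ₜ[ℂ] aux)

end QuantumModel

/-- `p` is synchronous: the question sets are identified with each other, and so are the answer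
sets (in the usual formulation `X = Y`, `A = B`, and `eX`, `eA` are the identity maps), and
`p(a,b|x,x) = 0` whenever `a ≠ b`. -/
def IsSynchronous {X Y A B : Type*} (p : X → Y → A → B → ℝ) : Prop :=
  ∃ (eX : X ≃ Y) (eA : A ≃ B), ∀ x, ∀ a b, a ≠ b → p x (eX x) a (eA b) = 0

/-- The set `C_q(X,Y,A,B)` of correlations that have a (finite-dimensional) quantum model. -/
def Cq (X Y A B : Type*) [Fintype A] [Fintype B] : Set (X → Y → A → B → ℝ) :=
  {p | ∃ S : QuantumModel X Y A B, S.IsModelFor p}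

variable {X Y A B : Type*} [Fintype A] [Fintype B]

/-- `p` is a self-test for the class `𝒞` of quantum models. -/
def IsSelfTest (𝒞 : Set (QuantumModel X Y A B)) (p : X → Y → A → B → ℝ) : Prop :=
  ∃ S' ∈ 𝒞, S'.IsModelFor p ∧ ∀ S ∈ 𝒞, S.IsModelFor p → S.LocallyDilatesTo S'

/-- `p` is an abstract state self-test for the set `𝒮` of states on
`POVM^{X,A} ⊗_min POVM^{Y,B}`: there is a unique state in `𝒮` with correlation `p`. -/
def IsAbstractStateSelfTest (𝒮 : Set (AbstractState (POVMTensor X Y A B)))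
    (p : X → Y → A → B → ℝ) : Prop :=
  ∃! f : AbstractState (POVMTensor X Y A B), f ∈ 𝒮 ∧ f.HasCorrelation p

end SelfTest

end

open scoped TensorProduct ComplexOrder ENNReal InnerProductSpace

noncomputable section

namespace SelfTest

/-! ### Positive operators and tensor products -/

section Operators

variable {E F : Type*} [NormedAddCommGroup E] [InnerProductSpace ℂ E]
  [NormedAddCommGroup F] [InnerProductSpace ℂ F]

/-! The third condition is the hub: it is compared with self-tests through models that are full
rank, meaning that no non-zero local operator annihilates `ψ`, and through models whose measurements
are irreducible.

Any model compresses to a full-rank one, because a local operator killing `ψ` confines `ψ` to its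
kernel. If `p` is synchronous, or binary and extreme, a full-rank model of `p` is projective: in the
synchronous case `(M_a ⊗ 1)ψ = (1 ⊗ N_a)ψ` for matching questions and answers, which makes distinct
outcomes orthogonal; in the binary case the POVM is an average of two others, and extremality forces
`M` and `M²` to have the same statistics (`FullRank.isProjective`). When the compressed operators
are projections, the isometries intertwine them with the original ones, so the compression does not
change the state (`IsCompression.state_eq`).

From self-tests to states: a finite-dimensional state comes from a model. GNS gives commuting
measurements on one space, and a Hilbert–Schmidt orthonormal basis of the commutant of Bob's
operators separates them into two tensor factors (`exists_isometric_intertwiner`). Shrink this model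
to full rank. A local dilation is a set of identities on `ψ`; full rank turns them into operator
identities, so the model and its dilation define the same state
(`FullRank.state_eq_of_locallyDilatesTo`). Hence the state is that of the ideal model.

From states to self-tests: a model of `p` of minimal dimension is full rank, and extremality makes
both of its measurement families irreducible (`exists_irreducible_model`). Any other model with the
same state receives an intertwiner from it carrying `ψ'` to `ψ`. That intertwiner is a sum of
products of local intertwiners, and by Schur's lemma these are described by multiplicity spaces,
which serve as the auxiliary spaces of a local dilation (`locallyDilatesTo_of_state_eq`). -/

instance [FiniteDimensional ℂ E] [FiniteDimensional ℂ F] : CompleteSpace (E ⊗[ℂ] F) :=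
  FiniteDimensional.complete ℂ _

theorem exists_adjoint_comp_self [CompleteSpace E] {T : E →L[ℂ] E} (hT : T.IsPositive) :
    ∃ R : E →L[ℂ] E, T = R.adjoint ∘L R := by
  obtain ⟨R, hR⟩ := CStarAlgebra.nonneg_iff_eq_star_mul_self.1
    ((ContinuousLinearMap.nonneg_iff_isPositive T).2 hT)
  exact ⟨R, hR⟩

theorem isPositive_mapL [CompleteSpace E] [CompleteSpace F] [CompleteSpace (E ⊗[ℂ] F)]
    {S : E →L[ℂ] E} {T : F →L[ℂ] F} (hS : S.IsPositive) (hT : T.IsPositive) :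
    (TensorProduct.mapL S T).IsPositive := by
  obtain ⟨P, rfl⟩ := exists_adjoint_comp_self hS
  obtain ⟨Q, rfl⟩ := exists_adjoint_comp_self hT
  rw [TensorProduct.mapL_comp, ← TensorProduct.adjoint_mapL]
  exact ContinuousLinearMap.isPositive_adjoint_comp_self _

/-- With `T = R†R` the inner product is `‖Rv‖²`. This turns vanishing probabilities into vanishing
vectors throughout. -/
theorem apply_eq_zero_of_inner_eq_zero [CompleteSpace E] {T : E →L[ℂ] E} (hT : T.IsPositive)
    {v : E} (hv : ⟪v, T v⟫_ℂ = 0) : T v = 0 := by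
  obtain ⟨R, rfl⟩ := exists_adjoint_comp_self hT
  rw [ContinuousLinearMap.comp_apply, ContinuousLinearMap.adjoint_inner_right,
    inner_self_eq_zero] at hv
  simp [hv]

theorem eq_zero_of_adjoint_comp_self [CompleteSpace E] [CompleteSpace F] {T : E →L[ℂ] F}
    (hT : T.adjoint ∘L T = 0) : T = 0 := by
  ext v
  have := congrArg (fun R : E →L[ℂ] E => ⟪v, R v⟫_ℂ) hT
  simpa [ContinuousLinearMap.adjoint_inner_right] using this

theorem isometry_adjoint_comp_self [CompleteSpace E] [CompleteSpace F] (V : E →ₗᵢ[ℂ] F) :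
    V.toContinuousLinearMap.adjoint ∘L V.toContinuousLinearMap = 1 := by
  ext v
  refine ext_inner_left ℂ fun w => ?_
  simp

end Operators

/-! ### Homomorphisms of operator algebras -/

section OpTensor

variable {H K : Hilb}

theorem opTensor_coe (S : H →L[ℂ] H) (T : K →L[ℂ] K) (v : H ⊗[ℂ] K) :
    opTensor S T (show HTensor H K from ((v : H ⊗[ℂ] K) : CompletedTensor H K)) =
      ((TensorProduct.mapL S T v : H ⊗[ℂ] K) : CompletedTensor H K) :=
  ContinuousLinearMap.completion_apply_coe _ _

theorem htensor_ext {P Q : HTensor H K →L[ℂ] HTensor H K}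
    (h : ∀ v : H ⊗[ℂ] K, P (show HTensor H K from (v : CompletedTensor H K)) =
      Q (show HTensor H K from (v : CompletedTensor H K))) : P = Q := by
  ext v
  exact UniformSpace.Completion.induction_on (p := fun v : CompletedTensor H K => P v = Q v) v
    (isClosed_eq P.continuous Q.continuous) h

theorem opTensor_one : opTensor (1 : H →L[ℂ] H) (1 : K →L[ℂ] K) = 1 :=
  htensor_ext fun v => by
    rw [opTensor_coe]
    change ((TensorProduct.mapL (.id ℂ _) (.id ℂ _) v : H ⊗[ℂ] K) : CompletedTensor H K) = _
    rw [TensorProduct.mapL_id_id]; rfl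

theorem opTensor_mul (S S' : H →L[ℂ] H) (T T' : K →L[ℂ] K) :
    opTensor (S * S') (T * T') = opTensor S T * opTensor S' T' :=
  htensor_ext fun v => by
    rw [opTensor_coe, mul_apply_eq_comp, opTensor_coe]
    erw [opTensor_coe]
    rw [TensorProduct.mapL_mul]; rfl

theorem opTensor_add_left (S S' : H →L[ℂ] H) (T : K →L[ℂ] K) :
    opTensor (S + S') T = opTensor S T + opTensor S' T :=
  htensor_ext fun v => by
    rw [add_apply, opTensor_coe, opTensor_coe, opTensor_coe,
      TensorProduct.mapL_add_left]
    exact UniformSpace.Completion.coe_add _ _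

theorem opTensor_add_right (S : H →L[ℂ] H) (T T' : K →L[ℂ] K) :
    opTensor S (T + T') = opTensor S T + opTensor S T' :=
  htensor_ext fun v => by
    rw [add_apply, opTensor_coe, opTensor_coe, opTensor_coe,
      TensorProduct.mapL_add_right]
    exact UniformSpace.Completion.coe_add _ _

theorem opTensor_smul_left (c : ℂ) (S : H →L[ℂ] H) (T : K →L[ℂ] K) :
    opTensor (c • S) T = c • opTensor S T :=
  htensor_ext fun v => by
    rw [smul_apply, opTensor_coe, opTensor_coe,
      TensorProduct.mapL_smul_left]
    exact UniformSpace.Completion.coe_smul c (TensorProduct.mapL S T v)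

theorem opTensor_smul_right (c : ℂ) (S : H →L[ℂ] H) (T : K →L[ℂ] K) :
    opTensor S (c • T) = c • opTensor S T :=
  htensor_ext fun v => by
    rw [smul_apply, opTensor_coe, opTensor_coe,
      TensorProduct.mapL_smul_right]
    exact UniformSpace.Completion.coe_smul c (TensorProduct.mapL S T v)

/-- The algebraic tensor product need not be complete, so the adjoint relation is checked on pure
tensors; `opTensor_star` extends it to the completion by density. -/
theorem inner_mapL_left (S : H →L[ℂ] H) (T : K →L[ℂ] K) (v w : H ⊗[ℂ] K) :
    ⟪TensorProduct.mapL (star S) (star T) v, w⟫_ℂ = ⟪v, TensorProduct.mapL S T w⟫_ℂ := by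
  induction v with
  | zero => simp
  | add a b ha hb => rw [map_add, inner_add_left, inner_add_left, ha, hb]
  | tmul x y =>
    induction w with
    | zero => simp
    | add a b ha hb => rw [map_add, inner_add_right, inner_add_right, ha, hb]
    | tmul z u =>
      simp [ContinuousLinearMap.star_eq_adjoint, ContinuousLinearMap.adjoint_inner_left]

theorem opTensor_star (S : H →L[ℂ] H) (T : K →L[ℂ] K) :
    opTensor (star S) (star T) = star (opTensor S T) := by
  refine (ContinuousLinearMap.eq_adjoint_iff _ _).2 fun x y => ?_
  refine UniformSpace.Completion.induction_on₂ (p := fun x y : CompletedTensor H K =>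
    (⟪opTensor (star S) (star T) (show HTensor H K from x), (show HTensor H K from y)⟫_ℂ) =
      ⟪(show HTensor H K from x), opTensor S T (show HTensor H K from y)⟫_ℂ) x y
      (isClosed_eq ?_ ?_) fun v w => ?_
  · exact Continuous.inner ((opTensor (star S) (star T)).continuous.comp continuous_fst)
      continuous_snd
  · exact Continuous.inner (𝕜 := ℂ) (E := HTensor H K) continuous_fst
      ((opTensor S T).continuous.comp continuous_snd)
  · rw [opTensor_coe, opTensor_coe]
    erw [UniformSpace.Completion.inner_coe, UniformSpace.Completion.inner_coe]
    exact inner_mapL_left S T v w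

end OpTensor

section Homs

variable {ι κ : Type*} {H : ι → Hilb} {K : κ → Hilb}

theorem OpProd.ext {S T : OpProd H} (h : ∀ i, S.component i = T.component i) : S = T :=
  Subtype.ext (funext h)

variable (H) in
/-- The projection of `∏ᵢ B(Hᵢ)` onto `B(Hᵢ)`. -/
def componentHom (i : ι) : OpProd H →⋆ₐ[ℂ] (H i →L[ℂ] H i) where
  toFun T := T.component i
  map_one' := rfl
  map_mul' _ _ := rfl
  map_zero' := rfl
  map_add' _ _ := rfl
  commutes' _ := rfl
  map_star' _ := rfl

variable (H K) in
/-- The homomorphism `S ↦ S ⊗ 1`. -/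
def tensLeft : OpProd H →⋆ₐ[ℂ] OpProd (fun j : ι × κ => HTensor (H j.1) (K j.2)) where
  toFun S := tens S 1
  map_one' := OpProd.ext fun _ => opTensor_one
  map_mul' S S' := OpProd.ext fun j => by
    change opTensor (S.component j.1 * S'.component j.1) (1 : K j.2 →L[ℂ] K j.2) = _
    rw [← mul_one (1 : K j.2 →L[ℂ] K j.2), opTensor_mul]; rfl
  map_zero' := OpProd.ext fun j => by
    have := opTensor_smul_left 0 (0 : H j.1 →L[ℂ] H j.1) (1 : K j.2 →L[ℂ] K j.2)
    rw [zero_smul, zero_smul] at this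
    exact this
  map_add' S S' := OpProd.ext fun j => opTensor_add_left _ _ _
  commutes' c := OpProd.ext fun j => by
    change opTensor (c • (1 : H j.1 →L[ℂ] H j.1)) (1 : K j.2 →L[ℂ] K j.2) = _
    rw [opTensor_smul_left, opTensor_one]; rfl
  map_star' S := OpProd.ext fun j => by
    change opTensor (star (S.component j.1)) (1 : K j.2 →L[ℂ] K j.2) = _
    rw [← star_one, opTensor_star]; rfl

variable (H K) in
/-- The homomorphism `T ↦ 1 ⊗ T`. -/
def tensRight : OpProd K →⋆ₐ[ℂ] OpProd (fun j : ι × κ => HTensor (H j.1) (K j.2)) where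
  toFun T := tens 1 T
  map_one' := OpProd.ext fun _ => opTensor_one
  map_mul' S S' := OpProd.ext fun j => by
    change opTensor (1 : H j.1 →L[ℂ] H j.1) (S.component j.2 * S'.component j.2) = _
    rw [← mul_one (1 : H j.1 →L[ℂ] H j.1), opTensor_mul]; rfl
  map_zero' := OpProd.ext fun j => by
    have := opTensor_smul_right 0 (1 : H j.1 →L[ℂ] H j.1) (0 : K j.2 →L[ℂ] K j.2)
    rw [zero_smul, zero_smul] at this
    exact this
  map_add' S S' := OpProd.ext fun j => opTensor_add_right _ _ _
  commutes' c := OpProd.ext fun j => by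
    change opTensor (1 : H j.1 →L[ℂ] H j.1) (c • (1 : K j.2 →L[ℂ] K j.2)) = _
    rw [opTensor_smul_right, opTensor_one]; rfl
  map_star' S := OpProd.ext fun j => by
    change opTensor (1 : H j.1 →L[ℂ] H j.1) (star (S.component j.2)) = _
    rw [← star_one, opTensor_star]; rfl

theorem norm_tens_le (S : OpProd H) (T : OpProd K) : ‖tens S T‖ ≤ ‖S‖ * ‖T‖ :=
  OpProd.norm_le (by positivity) fun j => (norm_opTensor_le _ _).trans
    (mul_le_mul (S.norm_component_le j.1) (T.norm_component_le j.2) (norm_nonneg _)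
      (norm_nonneg _))

variable (H K) in
theorem continuous_tensLeft : Continuous (tensLeft H K) :=
  AddMonoidHomClass.continuous_of_bound (tensLeft H K) ‖(1 : OpProd K)‖ fun S => by
    rw [mul_comm]
    exact norm_tens_le S 1

variable (H K) in
theorem continuous_tensRight : Continuous (tensRight H K) :=
  AddMonoidHomClass.continuous_of_bound (tensRight H K) ‖(1 : OpProd H)‖ fun T =>
    norm_tens_le 1 T

theorem tens_eq_left_mul_right (S : OpProd H) (T : OpProd K) :
    tens S T = tensLeft H K S * tensRight H K T :=
  OpProd.ext fun j => by
    change opTensor _ _ = opTensor (S.component j.1) 1 * opTensor 1 (T.component j.2)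
    rw [← opTensor_mul, mul_one, one_mul]

theorem tens_eq_right_mul_left (S : OpProd H) (T : OpProd K) :
    tens S T = tensRight H K T * tensLeft H K S :=
  OpProd.ext fun j => by
    change opTensor _ _ = opTensor 1 (T.component j.2) * opTensor (S.component j.1) 1
    rw [← opTensor_mul, mul_one, one_mul]

theorem sum_gen {X A : Type*} [Fintype A] {ι : Type*} (F : ι → POVMFamily X A) (x : X) :
    ∑ a, gen F x a = 1 :=
  OpProd.ext fun i => by
    change componentHom (fun i => (F i).H) i (∑ a, gen F x a) = 1
    rw [map_sum]
    exact (F i).sum_eq_one x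

theorem star_gen {X A : Type*} [Fintype A] {ι : Type*} (F : ι → POVMFamily X A) (x : X) (a : A) :
    star (gen F x a) = gen F x a :=
  OpProd.ext fun i => ((F i).isPositive x a).isSelfAdjoint

end Homs

/-! ### Generation of the minimal tensor product by the elements `m^x_a ⊗ n^y_b` -/

section Generators

variable {X Y A B : Type*} [Fintype A] [Fintype B]

theorem POVMTensor.star_gen (x : X) (y : Y) (a : A) (b : B) :
    star (POVMTensor.gen x y a b) = POVMTensor.gen x y a b :=
  Subtype.ext <| OpProd.ext fun j => by
    change star (opTensor (j.1.op x a) (j.2.op y b)) = opTensor (j.1.op x a) (j.2.op y b)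
    rw [← opTensor_star, (j.1.isPositive x a).isSelfAdjoint.star_eq,
      (j.2.isPositive y b).isSelfAdjoint.star_eq]

/-- The one-sided generators are recovered by completeness of the other side: `m ⊗ 1 = ∑_b m ⊗
n^y_b` for any one question `y`, and symmetrically. This is where non-empty question sets matter. -/
theorem minTensor_povm_le [Nonempty X] [Nonempty Y]
    (G : StarSubalgebra ℂ (OpProd (fun j : POVMFamily X A × POVMFamily Y B =>
      HTensor j.1.H j.2.H))) (hG : IsClosed (SetLike.coe G))
    (h : ∀ x y a b, tens (gen (fun M : POVMFamily X A => M) x a)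
      (gen (fun N : POVMFamily Y B => N) y b) ∈ G) :
    minTensor (povmAlgebra X A) (povmAlgebra Y B) ≤ G := by
  have hl : povmAlgebra X A ≤ G.comap (tensLeft (fun M : POVMFamily X A => M.H)
      (fun N : POVMFamily Y B => N.H)) := by
    refine StarSubalgebra.topologicalClosure_minimal (StarAlgebra.adjoin_le ?_)
      (hG.preimage (continuous_tensLeft _ _))
    rintro _ ⟨x, a, rfl⟩
    obtain ⟨y⟩ := ‹Nonempty Y›
    change tensLeft _ _ _ ∈ G
    rw [← mul_one (tensLeft _ _ _), ← map_one (tensRight (fun M : POVMFamily X A => M.H)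
      (fun N : POVMFamily Y B => N.H)), ← sum_gen (fun N : POVMFamily Y B => N) y,
      map_sum, Finset.mul_sum]
    refine sum_mem fun b _ => ?_
    rw [← tens_eq_left_mul_right]
    exact h x y a b
  have hr : povmAlgebra Y B ≤ G.comap (tensRight (fun M : POVMFamily X A => M.H)
      (fun N : POVMFamily Y B => N.H)) := by
    refine StarSubalgebra.topologicalClosure_minimal (StarAlgebra.adjoin_le ?_)
      (hG.preimage (continuous_tensRight _ _))
    rintro _ ⟨y, b, rfl⟩
    obtain ⟨x⟩ := ‹Nonempty X›
    change tensRight _ _ _ ∈ G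
    rw [← one_mul (tensRight _ _ _), ← map_one (tensLeft (fun M : POVMFamily X A => M.H)
      (fun N : POVMFamily Y B => N.H)), ← sum_gen (fun M : POVMFamily X A => M) x,
      map_sum, Finset.sum_mul]
    refine sum_mem fun a _ => ?_
    rw [← tens_eq_left_mul_right]
    exact h x y a b
  refine StarSubalgebra.topologicalClosure_minimal (StarAlgebra.adjoin_le ?_) hG
  rintro _ ⟨S, hS, T, hT, rfl⟩
  rw [tens_eq_left_mul_right]
  exact mul_mem (hl hS) (hr hT)

/-- A closed `*`-subalgebra containing all `m^x_a ⊗ n^y_b` is everything. -/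
theorem POVMTensor.mem_of_gen_mem [Nonempty X] [Nonempty Y]
    (G : StarSubalgebra ℂ (POVMTensor X Y A B)) (hG : IsClosed (G : Set (POVMTensor X Y A B)))
    (h : ∀ x y a b, POVMTensor.gen x y a b ∈ G) (t : POVMTensor X Y A B) : t ∈ G := by
  have hle : minTensor (povmAlgebra X A) (povmAlgebra Y B) ≤
      G.map (minTensor (povmAlgebra X A) (povmAlgebra Y B)).subtype := by
    refine minTensor_povm_le _ ?_ fun x y a b => ⟨_, h x y a b, rfl⟩
    exact (isClosed_minTensor _ _).isClosedEmbedding_subtypeVal.isClosedMap _ hG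
  obtain ⟨s, hs, hst⟩ := hle t.2
  rwa [← Subtype.ext hst]

theorem intertwines_of_gen [Nonempty X] [Nonempty Y] {E F : Type*} [NormedAddCommGroup E]
    [InnerProductSpace ℂ E] [CompleteSpace E] [NormedAddCommGroup F] [InnerProductSpace ℂ F]
    [CompleteSpace F] (ρ : POVMTensor X Y A B →⋆ₐ[ℂ] (E →L[ℂ] E))
    (σ : POVMTensor X Y A B →⋆ₐ[ℂ] (F →L[ℂ] F)) (W : E →L[ℂ] F)
    (h : ∀ x y a b, W ∘L ρ (POVMTensor.gen x y a b) = σ (POVMTensor.gen x y a b) ∘L W)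
    (t : POVMTensor X Y A B) : W ∘L ρ t = σ t ∘L W := by
  -- The condition is imposed on `t` and on `star t` together because `W` is not assumed to
  -- intertwine adjoints; this makes the set closed under star.
  let G : StarSubalgebra ℂ (POVMTensor X Y A B) :=
    { carrier := {t | W ∘L ρ t = σ t ∘L W ∧ W ∘L ρ (star t) = σ (star t) ∘L W}
      mul_mem' := by
        have key : ∀ s t, W ∘L ρ s = σ s ∘L W → W ∘L ρ t = σ t ∘L W →
            W ∘L ρ (s * t) = σ (s * t) ∘L W := fun s t hs ht => by
          rw [map_mul, map_mul, ContinuousLinearMap.mul_def, ContinuousLinearMap.mul_def,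
            ← ContinuousLinearMap.comp_assoc, hs, ContinuousLinearMap.comp_assoc, ht,
            ContinuousLinearMap.comp_assoc]
        rintro s t ⟨h1, h2⟩ ⟨h3, h4⟩
        exact ⟨key _ _ h1 h3, by rw [star_mul]; exact key _ _ h4 h2⟩
      add_mem' := by
        rintro s t ⟨h1, h2⟩ ⟨h3, h4⟩
        constructor
        · rw [map_add, map_add, ContinuousLinearMap.comp_add, ContinuousLinearMap.add_comp, h1, h3]
        · rw [star_add, map_add, map_add, ContinuousLinearMap.comp_add,
            ContinuousLinearMap.add_comp, h2, h4]
      algebraMap_mem' := by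
        have key : ∀ c : ℂ, W ∘L ρ (algebraMap ℂ _ c) = σ (algebraMap ℂ _ c) ∘L W := fun c => by
          rw [AlgHomClass.commutes, AlgHomClass.commutes, Algebra.algebraMap_eq_smul_one,
            Algebra.algebraMap_eq_smul_one]
          ext v
          simp
        exact fun c => ⟨key c, by rw [← algebraMap_star_comm]; exact key _⟩
      star_mem' := by
        rintro t ⟨h1, h2⟩
        exact ⟨h2, by rwa [star_star]⟩ }
  have hρ : Continuous ρ := map_continuous ρ
  have hσ : Continuous σ := map_continuous σ
  have hG : IsClosed (G : Set (POVMTensor X Y A B)) :=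
    (isClosed_eq (hρ.const_clm_comp W) (hσ.clm_comp_const W)).inter
      (isClosed_eq ((hρ.comp continuous_star).const_clm_comp W)
        ((hσ.comp continuous_star).clm_comp_const W))
  exact (POVMTensor.mem_of_gen_mem G hG
    (fun x y a b => ⟨h x y a b, by rw [POVMTensor.star_gen]; exact h x y a b⟩) t).1

end Generators

/-! ### Vector states -/

theorem completion_coe_surjective {E : Type*} [NormedAddCommGroup E] [CompleteSpace E] :
    Function.Surjective ((↑) : E → UniformSpace.Completion E) := by
  have h : IsClosed (Set.range ((↑) : E → UniformSpace.Completion E)) :=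
    (UniformSpace.Completion.isUniformEmbedding_coe E).isClosedEmbedding.isClosed_range
  exact Set.range_eq_univ.1
    (by rw [← h.closure_eq]; exact UniformSpace.Completion.denseRange_coe.closure_range)

namespace AbstractState

section

variable {𝒜 : Type*} [CStarAlgebra 𝒜] [PartialOrder 𝒜] [StarOrderedRing 𝒜]
  {E : Type*} [NormedAddCommGroup E] [InnerProductSpace ℂ E] [CompleteSpace E]

@[ext]
theorem ext {f g : AbstractState 𝒜} (h : ∀ t, f.toPos t = g.toPos t) : f = g := by
  cases f; cases g
  congr
  exact PositiveLinearMap.ext h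

/-- The vector state `t ↦ ⟨v, ρ(t) v⟩` of a representation `ρ` and a unit vector `v`. -/
def ofRep (ρ : 𝒜 →⋆ₐ[ℂ] (E →L[ℂ] E)) (v : E) (hv : ‖v‖ = 1) : AbstractState 𝒜 where
  toPos := PositiveLinearMap.mk₀
    { toFun := fun t => ⟪v, ρ t v⟫_ℂ
      map_add' := fun s t => by simp
      map_smul' := fun c t => by simp } fun t ht => by
    obtain ⟨s, rfl⟩ := CStarAlgebra.nonneg_iff_eq_star_mul_self.1 ht
    change 0 ≤ ⟪v, ρ (star s * s) v⟫_ℂ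
    rw [map_mul, map_star, mul_apply_eq_comp, ContinuousLinearMap.star_eq_adjoint,
      ContinuousLinearMap.adjoint_inner_right]
    rw [inner_self_eq_norm_sq_to_K]
    rw [← RCLike.ofReal_pow]
    exact RCLike.ofReal_nonneg.2 (sq_nonneg _)
  map_one := by
    change ⟪v, ρ 1 v⟫_ℂ = 1
    rw [_root_.map_one, one_apply_eq_self, inner_self_eq_norm_sq_to_K, hv]
    simp

theorem ofRep_apply (ρ : 𝒜 →⋆ₐ[ℂ] (E →L[ℂ] E)) (v : E) (hv : ‖v‖ = 1) (t : 𝒜) :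
    (ofRep ρ v hv).toPos t = ⟪v, ρ t v⟫_ℂ := rfl

/-- The map `s ↦ ρ(s)v` preserves the GNS seminorm, so it extends to an isometry of the GNS space
into the completion of `E`, which is finite-dimensional because `E` is already complete. -/
theorem isFiniteDimensional_ofRep [FiniteDimensional ℂ E] (ρ : 𝒜 →⋆ₐ[ℂ] (E →L[ℂ] E)) (v : E)
    (hv : ‖v‖ = 1) : (ofRep ρ v hv).IsFiniteDimensional := by
  set f := ofRep ρ v hv with hf
  let L : f.toPos.PreGNS →ₗᵢ[ℂ] E :=
    { toFun := fun s => ρ (f.toPos.ofPreGNS s) v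
      map_add' := fun s t => by simp
      map_smul' := fun c t => by simp
      norm_map' := fun s => by
        have h1 := f.toPos.preGNS_norm_sq s
        have h2 : ⟪v, ρ (star (f.toPos.ofPreGNS s) * f.toPos.ofPreGNS s) v⟫_ℂ =
            (‖ρ (f.toPos.ofPreGNS s) v‖ : ℂ) ^ 2 := by
          rw [map_mul, map_star, mul_apply_eq_comp, ContinuousLinearMap.star_eq_adjoint,
            ContinuousLinearMap.adjoint_inner_right, inner_self_eq_norm_sq_to_K]
          rfl
        have h3 : (‖s‖ : ℂ) ^ 2 = (‖ρ (f.toPos.ofPreGNS s) v‖ : ℂ) ^ 2 := h1.trans h2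
        have h4 : ‖s‖ ^ 2 = ‖ρ (f.toPos.ofPreGNS s) v‖ ^ 2 := by exact_mod_cast h3
        exact ((sq_eq_sq₀ (norm_nonneg _) (norm_nonneg _)).1 h4).symm }
  have hE : FiniteDimensional ℂ (UniformSpace.Completion E) :=
    Module.Finite.of_surjective (UniformSpace.Completion.toComplₗᵢ (𝕜 := ℂ) (E := E)).toLinearMap
      completion_coe_surjective
  have hnorm : ∀ s : f.toPos.GNS, ‖L.toContinuousLinearMap.completion s‖ = ‖s‖ := fun s => by
    induction s using UniformSpace.Completion.induction_on with
    | hp => exact isClosed_eq (by fun_prop) (by fun_prop)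
    | ih s => simp
  refine Module.Finite.of_injective (L.toContinuousLinearMap.completion).toLinearMap
    ((injective_iff_map_eq_zero _).2 fun s hs => ?_)
  rw [← norm_eq_zero, ← hnorm]
  exact norm_eq_zero.2 hs

end

end AbstractState

namespace QuantumModel

variable {X Y A B : Type*} [Fintype A] [Fintype B]

/-- The tensor product of finite-dimensional spaces is complete. -/
def htensorEquiv (H K : Hilb) [FiniteDimensional ℂ H] [FiniteDimensional ℂ K] :
    (H ⊗[ℂ] K) ≃ₗᵢ[ℂ] HTensor H K :=
  LinearIsometryEquiv.ofSurjective
    (UniformSpace.Completion.toComplₗᵢ (𝕜 := ℂ) (E := H ⊗[ℂ] K)) completion_coe_surjective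

theorem htensorEquiv_symm_opTensor (H K : Hilb) [FiniteDimensional ℂ H] [FiniteDimensional ℂ K]
    (S : H →L[ℂ] H) (T : K →L[ℂ] K) :
    (htensorEquiv H K).symm.conjStarAlgEquiv (opTensor S T) = TensorProduct.mapL S T := by
  refine ContinuousLinearMap.ext fun v => ?_
  rw [LinearIsometryEquiv.conjStarAlgEquiv_apply_apply, LinearIsometryEquiv.symm_symm,
    LinearIsometryEquiv.symm_apply_eq]
  exact opTensor_coe S T v

/-- The representation of `POVM^{X,A} ⊗_min POVM^{Y,B}` defined by a quantum model. -/
def rep (S : QuantumModel X Y A B) :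
    POVMTensor X Y A B →⋆ₐ[ℂ] ((S.M.H ⊗[ℂ] S.N.H) →L[ℂ] (S.M.H ⊗[ℂ] S.N.H)) :=
  ((htensorEquiv S.M.H S.N.H).symm.conjStarAlgEquiv : _ →⋆ₐ[ℂ] _).comp
    ((componentHom (fun j : POVMFamily X A × POVMFamily Y B => HTensor j.1.H j.2.H)
      (S.M, S.N)).comp (minTensor (povmAlgebra X A) (povmAlgebra Y B)).subtype)

theorem rep_gen (S : QuantumModel X Y A B) (x : X) (y : Y) (a : A) (b : B) :
    S.rep (POVMTensor.gen x y a b) = TensorProduct.mapL (S.M.op x a) (S.N.op y b) :=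
  htensorEquiv_symm_opTensor _ _ _ _

/-- The state on `POVM^{X,A} ⊗_min POVM^{Y,B}` defined by a quantum model. -/
def state (S : QuantumModel X Y A B) : AbstractState (POVMTensor X Y A B) :=
  .ofRep S.rep S.ψ S.norm_ψ

theorem state_apply (S : QuantumModel X Y A B) (t : POVMTensor X Y A B) :
    S.state.toPos t = ⟪S.ψ, S.rep t S.ψ⟫_ℂ := rfl

theorem state_isFiniteDimensional (S : QuantumModel X Y A B) : S.state.IsFiniteDimensional :=
  AbstractState.isFiniteDimensional_ofRep _ _ _

theorem hasCorrelation_state_iff (S : QuantumModel X Y A B) (p : X → Y → A → B → ℝ) :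
    S.state.HasCorrelation p ↔ S.IsModelFor p := by
  simp only [AbstractState.HasCorrelation, IsModelFor, state_apply, rep_gen, vec]

/-- A projective model is one of the indices of the PVM product, and `quotientHom` only restricts
the index set, so evaluation at this index factors through it definitionally. -/
theorem IsProjective.state {S : QuantumModel X Y A B} (hS : S.IsProjective) :
    S.state.IsProjective := by
  let σ : PVMTensor X Y A B →⋆ₐ[ℂ] ((S.M.H ⊗[ℂ] S.N.H) →L[ℂ] (S.M.H ⊗[ℂ] S.N.H)) :=
    ((htensorEquiv S.M.H S.N.H).symm.conjStarAlgEquiv : _ →⋆ₐ[ℂ] _).comp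
      ((componentHom (fun j : PVMFamily X A × PVMFamily Y B => HTensor j.1.1.H j.2.1.H)
        (⟨S.M, hS.1⟩, ⟨S.N, hS.2⟩)).comp (minTensor (pvmAlgebra X A) (pvmAlgebra Y B)).subtype)
  exact ⟨.ofRep σ S.ψ S.norm_ψ, fun t => rfl⟩

/-- Models whose representations are intertwined by an operator that is isometric and preserves
the vector states define the same state. -/
theorem state_eq_of_intertwines [Nonempty X] [Nonempty Y] {E : Type*} [NormedAddCommGroup E]
    [InnerProductSpace ℂ E] [CompleteSpace E] (S : QuantumModel X Y A B)
    (σ : POVMTensor X Y A B →⋆ₐ[ℂ] (E →L[ℂ] E)) (W : S.M.H ⊗[ℂ] S.N.H →L[ℂ] E)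
    (hW : ∀ v w, ⟪W v, W w⟫_ℂ = ⟪v, w⟫_ℂ)
    (h : ∀ x y a b, W ∘L TensorProduct.mapL (S.M.op x a) (S.N.op y b) =
      σ (POVMTensor.gen x y a b) ∘L W) (t : POVMTensor X Y A B) :
    S.state.toPos t = ⟪W S.ψ, σ t (W S.ψ)⟫_ℂ := by
  have := intertwines_of_gen S.rep σ W (fun x y a b => by rw [rep_gen, h]) t
  rw [state_apply, ← hW, ← ContinuousLinearMap.comp_apply, this]; rfl

end QuantumModel

/-! ### Compressions and full-rank models -/

theorem mapL_isometry_apply {E E' F F' : Type*} [NormedAddCommGroup E] [InnerProductSpace ℂ E]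
    [NormedAddCommGroup F] [InnerProductSpace ℂ F] [NormedAddCommGroup E']
    [InnerProductSpace ℂ E'] [NormedAddCommGroup F'] [InnerProductSpace ℂ F']
    (V : E →ₗᵢ[ℂ] E') (W : F →ₗᵢ[ℂ] F') (v : E ⊗[ℂ] F) :
    TensorProduct.mapL V.toContinuousLinearMap W.toContinuousLinearMap v =
      TensorProduct.map V.toLinearMap W.toLinearMap v :=
  TensorProduct.mapL_apply _ _ _

/-- The compression `V† M V` of a family of POVMs along an isometry `V`. -/
def POVMFamily.compress {X A : Type*} [Fintype A] (M : POVMFamily X A) (H' : Hilb)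
    (V : H' →ₗᵢ[ℂ] M.H) : POVMFamily X A where
  H := H'
  op x a := V.toContinuousLinearMap.adjoint ∘L M.op x a ∘L V.toContinuousLinearMap
  isPositive x a := (M.isPositive x a).adjoint_conj _
  sum_eq_one x := by
    rw [← isometry_adjoint_comp_self V]
    have h := congrArg (fun T : M.H →L[ℂ] M.H =>
      V.toContinuousLinearMap.adjoint ∘L T ∘L V.toContinuousLinearMap) (M.sum_eq_one x)
    refine Eq.trans ?_ h
    ext v
    simp

namespace QuantumModel

variable {X Y A B : Type*} [Fintype A] [Fintype B]

/-- No non-zero local operator annihilates the vector state. -/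
def FullRank (S : QuantumModel X Y A B) : Prop :=
  (∀ T : S.M.H →L[ℂ] S.M.H, T.rTensor S.N.H S.ψ = 0 → T = 0) ∧
    ∀ T : S.N.H →L[ℂ] S.N.H, T.lTensor S.M.H S.ψ = 0 → T = 0

/-- `S'` is obtained from `S` by compressing the measurements to subspaces that support the
vector state. -/
def IsCompression (S' S : QuantumModel X Y A B) : Prop :=
  ∃ (V : S'.M.H →ₗᵢ[ℂ] S.M.H) (W : S'.N.H →ₗᵢ[ℂ] S.N.H),
    (∀ x a, S'.M.op x a =
      V.toContinuousLinearMap.adjoint ∘L S.M.op x a ∘L V.toContinuousLinearMap) ∧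
    (∀ y b, S'.N.op y b =
      W.toContinuousLinearMap.adjoint ∘L S.N.op y b ∘L W.toContinuousLinearMap) ∧
    TensorProduct.map V.toLinearMap W.toLinearMap S'.ψ = S.ψ

theorem IsCompression.refl (S : QuantumModel X Y A B) : S.IsCompression S := by
  refine ⟨.id, .id, fun x a => ?_, fun y b => ?_, ?_⟩
  · refine ContinuousLinearMap.ext fun v => ext_inner_left ℂ fun w => ?_
    simp [ContinuousLinearMap.adjoint_inner_right]
  · refine ContinuousLinearMap.ext fun v => ext_inner_left ℂ fun w => ?_
    simp [ContinuousLinearMap.adjoint_inner_right]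
  · simp

theorem IsCompression.trans {S₁ S₂ S₃ : QuantumModel X Y A B} (h : S₁.IsCompression S₂)
    (h' : S₂.IsCompression S₃) : S₁.IsCompression S₃ := by
  obtain ⟨V, W, hV, hW, hψ⟩ := h
  obtain ⟨V', W', hV', hW', hψ'⟩ := h'
  refine ⟨V'.comp V, W'.comp W, fun x a => ?_, fun y b => ?_, ?_⟩
  · rw [hV, hV']
    refine ContinuousLinearMap.ext fun v => ext_inner_left ℂ fun w => ?_
    simp [ContinuousLinearMap.adjoint_inner_right]
  · rw [hW, hW']
    refine ContinuousLinearMap.ext fun v => ext_inner_left ℂ fun w => ?_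
    simp [ContinuousLinearMap.adjoint_inner_right]
  · rw [← hψ', ← hψ]
    exact LinearMap.congr_fun (TensorProduct.map_comp _ _ _ _) _

theorem IsCompression.isModelFor {S' S : QuantumModel X Y A B} (h : S'.IsCompression S)
    {p : X → Y → A → B → ℝ} (hS : S.IsModelFor p) : S'.IsModelFor p := by
  obtain ⟨V, W, hV, hW, hψ⟩ := h
  intro x y a b
  rw [← hS x y a b, vec, vec, hV, hW, TensorProduct.mapL_comp, TensorProduct.mapL_comp,
    ← TensorProduct.adjoint_mapL, ContinuousLinearMap.comp_apply,
    ContinuousLinearMap.adjoint_inner_right, ContinuousLinearMap.comp_apply, ← hψ,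
    mapL_isometry_apply]

theorem ψ_ne_zero (S : QuantumModel X Y A B) : S.ψ ≠ 0 := fun h => by
  have := S.norm_ψ
  simp [h] at this

/-- The compression of a model along isometries. -/
def compress (S : QuantumModel X Y A B) (H K : Hilb) [FiniteDimensional ℂ H]
    [FiniteDimensional ℂ K] (V : H →ₗᵢ[ℂ] S.M.H) (W : K →ₗᵢ[ℂ] S.N.H) (φ : H ⊗[ℂ] K)
    (hφ : TensorProduct.map V.toLinearMap W.toLinearMap φ = S.ψ) : QuantumModel X Y A B where
  M := S.M.compress H V
  N := S.N.compress K W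
  finite_left := ‹_›
  finite_right := ‹_›
  ψ := φ
  norm_ψ := by
    rw [← S.norm_ψ, ← hφ]
    exact (TensorProduct.norm_map V W φ).symm

theorem compress_isCompression (S : QuantumModel X Y A B) (H K : Hilb) [FiniteDimensional ℂ H]
    [FiniteDimensional ℂ K] (V : H →ₗᵢ[ℂ] S.M.H) (W : K →ₗᵢ[ℂ] S.N.H) (φ : H ⊗[ℂ] K)
    (hφ : TensorProduct.map V.toLinearMap W.toLinearMap φ = S.ψ) :
    (S.compress H K V W φ hφ).IsCompression S :=
  ⟨V, W, fun _ _ => rfl, fun _ _ => rfl, hφ⟩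

/-- The sum of the dimensions of the Hilbert spaces of a model. -/
def dim (S : QuantumModel X Y A B) : ℕ := Module.finrank ℂ S.M.H + Module.finrank ℂ S.N.H

/-- By flatness the kernel of `T ⊗ 1` is `ker T ⊗ H_B`, so `ψ` already lives over `ker T`, a proper
subspace since `T ≠ 0`. -/
theorem exists_isCompression_dim_lt_of_left (S : QuantumModel X Y A B)
    (T : S.M.H →L[ℂ] S.M.H) (hT : T.rTensor S.N.H S.ψ = 0) (hT0 : T ≠ 0) :
    ∃ S' : QuantumModel X Y A B, S'.IsCompression S ∧ S'.dim < S.dim := by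
  obtain ⟨φ, hφ⟩ := (Module.Flat.rTensor_exact S.N.H
    (LinearMap.exact_subtype_ker_map T.toLinearMap) S.ψ).1 (by simpa using hT)
  -- A `Hilb` has to be non-zero; a zero kernel would force `ψ = 0`.
  have hnt : Nontrivial (LinearMap.ker T.toLinearMap) := by
    by_contra h
    rw [not_nontrivial_iff_subsingleton] at h
    have : φ = 0 := Subsingleton.elim _ _
    exact S.ψ_ne_zero (by rw [← hφ, this, map_zero])
  refine ⟨S.compress ⟨LinearMap.ker T.toLinearMap⟩ S.N.H (Submodule.subtypeₗᵢ _) .id φ hφ,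
    compress_isCompression _ _ _ _ _ _ _, ?_⟩
  have : LinearMap.ker T.toLinearMap < ⊤ := lt_top_iff_ne_top.2 fun h => hT0 <| by
    ext v
    exact LinearMap.mem_ker.1 (h ▸ Submodule.mem_top : v ∈ LinearMap.ker T.toLinearMap)
  exact Nat.add_lt_add_right (Submodule.finrank_lt this.ne) _

theorem exists_isCompression_dim_lt_of_right (S : QuantumModel X Y A B)
    (T : S.N.H →L[ℂ] S.N.H) (hT : T.lTensor S.M.H S.ψ = 0) (hT0 : T ≠ 0) :
    ∃ S' : QuantumModel X Y A B, S'.IsCompression S ∧ S'.dim < S.dim := by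
  obtain ⟨φ, hφ⟩ := (Module.Flat.lTensor_exact S.M.H
    (LinearMap.exact_subtype_ker_map T.toLinearMap) S.ψ).1 (by simpa using hT)
  have hnt : Nontrivial (LinearMap.ker T.toLinearMap) := by
    by_contra h
    rw [not_nontrivial_iff_subsingleton] at h
    have : φ = 0 := Subsingleton.elim _ _
    exact S.ψ_ne_zero (by rw [← hφ, this, map_zero])
  refine ⟨S.compress S.M.H ⟨LinearMap.ker T.toLinearMap⟩ .id (Submodule.subtypeₗᵢ _) φ hφ,
    compress_isCompression _ _ _ _ _ _ _, ?_⟩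
  have : LinearMap.ker T.toLinearMap < ⊤ := lt_top_iff_ne_top.2 fun h => hT0 <| by
    ext v
    exact LinearMap.mem_ker.1 (h ▸ Submodule.mem_top : v ∈ LinearMap.ker T.toLinearMap)
  exact Nat.add_lt_add_left (Submodule.finrank_lt this.ne) _

theorem exists_isCompression_dim_lt {S : QuantumModel X Y A B} (hS : ¬S.FullRank) :
    ∃ S' : QuantumModel X Y A B, S'.IsCompression S ∧ S'.dim < S.dim := by
  rw [FullRank, not_and_or] at hS
  push Not at hS
  obtain ⟨T, hT, hT0⟩ | ⟨T, hT, hT0⟩ := hS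
  · exact S.exists_isCompression_dim_lt_of_left T hT hT0
  · exact S.exists_isCompression_dim_lt_of_right T hT hT0

theorem exists_fullRank_isCompression (S : QuantumModel X Y A B) :
    ∃ S' : QuantumModel X Y A B, S'.IsCompression S ∧ S'.FullRank := by
  induction h : S.dim using Nat.strong_induction_on generalizing S with
  | _ n ih =>
    by_cases hS : S.FullRank
    · exact ⟨S, .refl S, hS⟩
    · obtain ⟨S₁, h₁, hlt⟩ := exists_isCompression_dim_lt hS
      obtain ⟨S₂, h₂, hS₂⟩ := ih _ (h ▸ hlt) S₁ rfl
      exact ⟨S₂, h₂.trans h₁, hS₂⟩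

/-- Full rank concerns endomorphisms only; for maps into another space it is applied to `(P - Q)†(P
- Q)`. -/
theorem FullRank.left_ext {S : QuantumModel X Y A B} (hS : S.FullRank) {E : Type*}
    [NormedAddCommGroup E] [InnerProductSpace ℂ E] [CompleteSpace E] {P Q : S.M.H →L[ℂ] E}
    (h : P.rTensor S.N.H S.ψ = Q.rTensor S.N.H S.ψ) : P = Q := by
  rw [← sub_eq_zero]
  refine eq_zero_of_adjoint_comp_self (hS.1 _ ?_)
  rw [ContinuousLinearMap.rTensor_comp, ContinuousLinearMap.comp_apply,
    ContinuousLinearMap.rTensor_sub, sub_apply, h, sub_self, map_zero]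

theorem FullRank.right_ext {S : QuantumModel X Y A B} (hS : S.FullRank) {E : Type*}
    [NormedAddCommGroup E] [InnerProductSpace ℂ E] [CompleteSpace E] {P Q : S.N.H →L[ℂ] E}
    (h : P.lTensor S.M.H S.ψ = Q.lTensor S.M.H S.ψ) : P = Q := by
  rw [← sub_eq_zero]
  refine eq_zero_of_adjoint_comp_self (hS.2 _ ?_)
  rw [ContinuousLinearMap.lTensor_comp, ContinuousLinearMap.comp_apply,
    ContinuousLinearMap.lTensor_sub, sub_apply, h, sub_self, map_zero]

end QuantumModel

/-- If the compression `V† M V` of a positive operator is a projection and `M ≤ 1`, then `V`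
intertwines `V† M V` and `M`. -/
theorem comp_eq_comp_of_compression_projection {E F : Type*} [NormedAddCommGroup E]
    [InnerProductSpace ℂ E] [CompleteSpace E] [NormedAddCommGroup F] [InnerProductSpace ℂ F]
    [CompleteSpace F] (V : E →ₗᵢ[ℂ] F) {M : F →L[ℂ] F} (hM : M.IsPositive)
    (hM1 : (1 - M).IsPositive) {P : E →L[ℂ] E}
    (hP : P = V.toContinuousLinearMap.adjoint ∘L M ∘L V.toContinuousLinearMap)
    (hPP : IsIdempotentElem P) :
    V.toContinuousLinearMap ∘L P = M ∘L V.toContinuousLinearMap := by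
  have hVP : ∀ v w : E, ⟪V v, M (V w)⟫_ℂ = ⟪v, P w⟫_ℂ := fun v w => by
    rw [hP]; simp [ContinuousLinearMap.adjoint_inner_right]
  have hPPv : ∀ v, P (P v) = P v := fun v => congrArg (fun T : E →L[ℂ] E => T v) hPP
  -- `P` kills `v - P v`, so the quadratic form of `M` vanishes at `V (v - P v)`, and positivity of
  -- `M` makes `M` vanish there.
  have hsub : ∀ v, M (V v) = M (V (P v)) := fun v => by
    have : M (V (v - P v)) = 0 := apply_eq_zero_of_inner_eq_zero hM (by
      rw [hVP, map_sub, hPPv, sub_self, inner_zero_right])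
    rwa [map_sub, map_sub, sub_eq_zero] at this
  -- On the range of `P` the quadratic form of `1 - M` vanishes, and `1 - M` is positive as well.
  have hone : ∀ v, M (V (P v)) = V (P v) := fun v => by
    have : (1 - M) (V (P v)) = 0 := apply_eq_zero_of_inner_eq_zero hM1 (by
      rw [sub_apply, one_apply_eq_self, inner_sub_right, hVP, hPPv, V.inner_map_map, sub_self])
    rw [sub_apply, one_apply_eq_self, sub_eq_zero] at this
    exact this.symm
  ext v
  exact ((hsub v).trans (hone v)).symm

theorem POVMFamily.isPositive_one_sub {X A : Type*} [Fintype A] (M : POVMFamily X A) (x : X)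
    (a : A) : (1 - M.op x a).IsPositive := by
  classical
  rw [← M.sum_eq_one x, ← Finset.add_sum_erase _ _ (Finset.mem_univ a), add_sub_cancel_left]
  exact ContinuousLinearMap.isPositive_sum _ fun b _ => M.isPositive x b

namespace QuantumModel

variable {X Y A B : Type*} [Fintype A] [Fintype B]

/-- A projective compression defines the same state. -/
theorem IsCompression.state_eq [Nonempty X] [Nonempty Y] {S' S : QuantumModel X Y A B}
    (h : S'.IsCompression S) (hS' : S'.IsProjective) : S'.state = S.state := by
  obtain ⟨V, W, hV, hW, hψ⟩ := h
  have hVM : ∀ x a, V.toContinuousLinearMap ∘L S'.M.op x a =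
      S.M.op x a ∘L V.toContinuousLinearMap := fun x a =>
    comp_eq_comp_of_compression_projection V (S.M.isPositive x a) (S.M.isPositive_one_sub x a)
      (hV x a) (hS'.1 x a).isIdempotentElem
  have hWN : ∀ y b, W.toContinuousLinearMap ∘L S'.N.op y b =
      S.N.op y b ∘L W.toContinuousLinearMap := fun y b =>
    comp_eq_comp_of_compression_projection W (S.N.isPositive y b) (S.N.isPositive_one_sub y b)
      (hW y b) (hS'.2 y b).isIdempotentElem
  ext t
  rw [state_eq_of_intertwines S' S.rep
    (TensorProduct.mapL V.toContinuousLinearMap W.toContinuousLinearMap)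
    (fun v w => by
      rw [mapL_isometry_apply, mapL_isometry_apply, TensorProduct.inner_map_map])
    (fun x y a b => ?_) t, state_apply]
  · rw [mapL_isometry_apply, hψ]
  · rw [rep_gen, ← TensorProduct.mapL_comp, ← TensorProduct.mapL_comp, hVM, hWN]

end QuantumModel

/-! ### Full-rank models of synchronous and of extreme binary correlations -/

/-- `M - M² = M(1 - M)M + (1 - M)M(1 - M)`, a sum of two conjugates of positive operators. -/
theorem isPositive_sub_mul_self {E : Type*} [NormedAddCommGroup E] [InnerProductSpace ℂ E]
    [CompleteSpace E] {M : E →L[ℂ] E} (hM : M.IsPositive) (hM1 : (1 - M).IsPositive) :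
    (M - M * M).IsPositive := by
  have h1 := hM1.adjoint_conj M
  have h2 := hM.adjoint_conj (1 - M)
  have e1 : M.adjoint = M := hM.isSelfAdjoint
  have e2 : (1 - M).adjoint = 1 - M := hM1.isSelfAdjoint
  rw [e1, ← ContinuousLinearMap.mul_def, ← ContinuousLinearMap.mul_def] at h1
  rw [e2, ← ContinuousLinearMap.mul_def, ← ContinuousLinearMap.mul_def] at h2
  convert h1.add h2 using 1
  noncomm_ring

section Tensor

variable {E F : Type*} [NormedAddCommGroup E] [InnerProductSpace ℂ E]
  [NormedAddCommGroup F] [InnerProductSpace ℂ F]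

theorem rTensor_lTensor_apply (S : E →L[ℂ] E) (T : F →L[ℂ] F) (v : E ⊗[ℂ] F) :
    S.rTensor F (T.lTensor E v) = TensorProduct.mapL S T v :=
  congrArg (fun R : E ⊗[ℂ] F →L[ℂ] E ⊗[ℂ] F => R v)
    (ContinuousLinearMap.rTensor_comp_lTensor S T)

theorem lTensor_rTensor_apply (S : E →L[ℂ] E) (T : F →L[ℂ] F) (v : E ⊗[ℂ] F) :
    T.lTensor E (S.rTensor F v) = TensorProduct.mapL S T v :=
  congrArg (fun R : E ⊗[ℂ] F →L[ℂ] E ⊗[ℂ] F => R v)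
    (ContinuousLinearMap.lTensor_comp_rTensor T S)

theorem tensor_inner_add_right (u v w : E ⊗[ℂ] F) : ⟪u, v + w⟫_ℂ = ⟪u, v⟫_ℂ + ⟪u, w⟫_ℂ :=
  inner_add_right (E := E ⊗[ℂ] F) u v w

end Tensor

namespace POVMFamily

variable {X A : Type*} [Fintype A]

theorem isProjective_of_idempotent (M : POVMFamily X A)
    (h : ∀ x a, M.op x a * M.op x a = M.op x a) : M.IsProjective :=
  fun x a => ⟨h x a, (M.isPositive x a).isSelfAdjoint⟩

/-- Expanding `1` gives `M_a = ∑_b M_a M_b = M_a²`. -/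
theorem isProjective_of_mul_eq_zero (M : POVMFamily X A)
    (h : ∀ x a b, a ≠ b → M.op x a * M.op x b = 0) : M.IsProjective :=
  M.isProjective_of_idempotent fun x a => by
    conv_rhs => rw [← mul_one (M.op x a), ← M.sum_eq_one x, Finset.mul_sum]
    exact (Finset.sum_eq_single a (fun b _ hb => h x a b hb.symm) (by simp)).symm

theorem sum_lTensor (N : POVMFamily X A) (E : Type*) [NormedAddCommGroup E]
    [InnerProductSpace ℂ E] (x : X) (v : E ⊗[ℂ] N.H) :
    ∑ a, (N.op x a).lTensor E v = v := by
  have h := map_sum (AddMonoidHom.mk' (fun T : N.H →L[ℂ] N.H => T.lTensor E)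
    (ContinuousLinearMap.lTensor_add E)) (fun a => N.op x a) Finset.univ
  rw [N.sum_eq_one] at h
  have h' := congrArg (fun T : E ⊗[ℂ] N.H →L[ℂ] E ⊗[ℂ] N.H => T v) h
  simpa using h'.symm

theorem sum_rTensor (M : POVMFamily X A) (F : Type*) [NormedAddCommGroup F]
    [InnerProductSpace ℂ F] (x : X) (v : M.H ⊗[ℂ] F) :
    ∑ a, (M.op x a).rTensor F v = v := by
  have h := map_sum (AddMonoidHom.mk' (fun T : M.H →L[ℂ] M.H => T.rTensor F)
    (ContinuousLinearMap.rTensor_add F)) (fun a => M.op x a) Finset.univ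
  rw [M.sum_eq_one] at h
  have h' := congrArg (fun T : M.H ⊗[ℂ] F →L[ℂ] M.H ⊗[ℂ] F => T v) h
  simpa using h'.symm

/-- A two-outcome POVM `{M, 1 - M}` is the average of the POVMs `{M², 1 - M²}` and
`{1 - (1 - M)², (1 - M)²}`. -/
theorem exists_average_of_card_eq_two (M : POVMFamily X A) (hA : Fintype.card A = 2) :
    ∃ P Q : X → A → M.H →L[ℂ] M.H,
      ((∀ x a, (P x a).IsPositive) ∧ ∀ x, ∑ a, P x a = 1) ∧
      ((∀ x a, (Q x a).IsPositive) ∧ ∀ x, ∑ a, Q x a = 1) ∧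
      (∀ x a, P x a + Q x a = M.op x a + M.op x a) ∧
      ∀ x a, P x a = M.op x a * M.op x a ∨ Q x a = M.op x a * M.op x a := by
  classical
  obtain ⟨c, d, hcd, huniv⟩ := Finset.card_eq_two.1 (Finset.card_univ.trans hA)
  have hsq : ∀ x a, (M.op x a * M.op x a).IsPositive := fun x a => by
    have h := ContinuousLinearMap.isPositive_adjoint_comp_self (M.op x a)
    have e : (M.op x a).adjoint = M.op x a := (M.isPositive x a).isSelfAdjoint
    rwa [e] at h
  have hsum : ∀ x, M.op x d = 1 - M.op x c := fun x => by
    rw [← M.sum_eq_one x, huniv, Finset.sum_pair hcd, add_sub_cancel_left]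
  -- `R e` has `2M - M² = 1 - (1 - M)²` at the outcome `e` and `M²` at the other one. Exactly one of
  -- `R c`, `R d` therefore takes the value `M²` by definition at each given outcome.
  let R : A → X → A → M.H →L[ℂ] M.H := fun e x a =>
    if a = e then M.op x a + (M.op x a - M.op x a * M.op x a) else M.op x a * M.op x a
  have hpos : ∀ e x a, (R e x a).IsPositive := fun e x a => by
    by_cases h : a = e
    · simp only [R, if_pos h]
      exact (M.isPositive x a).add
        (isPositive_sub_mul_self (M.isPositive x a) (M.isPositive_one_sub x a))
    · simp only [R, if_neg h]
      exact hsq x a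
  refine ⟨R c, R d, ⟨hpos c, fun x => ?_⟩, ⟨hpos d, fun x => ?_⟩, fun x a => ?_, fun x a => ?_⟩
  · rw [huniv, Finset.sum_pair hcd]
    simp only [R, if_pos, if_neg hcd.symm, hsum]
    noncomm_ring
  · rw [huniv, Finset.sum_pair hcd]
    simp only [R, if_pos, if_neg hcd, hsum]
    noncomm_ring
  · have ha : a = c ∨ a = d := by simpa [huniv] using Finset.mem_univ a
    rcases ha with rfl | rfl
    · simp only [R, if_pos, if_neg hcd]; abel
    · simp only [R, if_pos, if_neg hcd.symm]; abel
  · have ha : a = c ∨ a = d := by simpa [huniv] using Finset.mem_univ a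
    rcases ha with rfl | rfl
    · exact Or.inr (by simp only [R, if_neg hcd])
    · exact Or.inl (by simp only [R, if_neg hcd.symm])

end POVMFamily

namespace QuantumModel

variable {X Y A B : Type*} [Fintype A] [Fintype B]

/-- The correlation of a model. -/
def corr (S : QuantumModel X Y A B) : X → Y → A → B → ℝ :=
  fun x y a b => (⟪S.ψ, S.vec x y a b⟫_ℂ).re

theorem vec_isPositive (S : QuantumModel X Y A B) (x : X) (y : Y) (a : A) (b : B) :
    (TensorProduct.mapL (S.M.op x a) (S.N.op y b)).IsPositive :=
  isPositive_mapL (S.M.isPositive x a) (S.N.isPositive y b)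

theorem isModelFor_corr (S : QuantumModel X Y A B) : S.IsModelFor S.corr := fun x y a b =>
  (Complex.eq_re_of_ofReal_le (r := 0)
    ((S.vec_isPositive x y a b).inner_nonneg_right S.ψ))

theorem isModelFor_iff_eq_corr {S : QuantumModel X Y A B} {p : X → Y → A → B → ℝ} :
    S.IsModelFor p ↔ S.corr = p := by
  refine ⟨fun h => ?_, fun h => h ▸ S.isModelFor_corr⟩
  ext x y a b
  have := S.isModelFor_corr x y a b
  rw [h x y a b] at this
  exact_mod_cast this.symm

theorem isModelFor_of_extreme {p : X → Y → A → B → ℝ}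
    (hext : p ∈ Set.extremePoints ℝ (Cq X Y A B)) (S₁ S₂ : QuantumModel X Y A B) {c : ℝ}
    (hc0 : 0 < c) (hc1 : c < 1)
    (h : ∀ x y a b, (p x y a b : ℂ) =
      c * ⟪S₁.ψ, S₁.vec x y a b⟫_ℂ + (1 - c) * ⟪S₂.ψ, S₂.vec x y a b⟫_ℂ) :
    S₁.IsModelFor p := by
  rw [isModelFor_iff_eq_corr]
  refine hext.2 ⟨S₁, S₁.isModelFor_corr⟩ ⟨S₂, S₂.isModelFor_corr⟩
    ⟨c, 1 - c, hc0, sub_pos.2 hc1, by ring, ?_⟩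
  ext x y a b
  have := h x y a b
  rw [S₁.isModelFor_corr, S₂.isModelFor_corr] at this
  simp only [Pi.add_apply, Pi.smul_apply, smul_eq_mul]
  exact_mod_cast this.symm

/-- Zero probabilities give `(M_a ⊗ N_b)ψ = 0` for `a ≠ b`, whence `(M_a ⊗ 1)ψ = (M_a ⊗ N_a)ψ = (1 ⊗
N_a)ψ`. Then `(M_a M_b ⊗ 1)ψ = (M_a ⊗ N_b)ψ = 0`, and full rank yields `M_a M_b = 0`. Extremality
plays no role here. -/
theorem FullRank.isProjective_of_synchronous {S : QuantumModel X Y A B} (hS : S.FullRank)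
    {p : X → Y → A → B → ℝ} (hm : S.IsModelFor p) (hp : IsSynchronous p) : S.IsProjective := by
  obtain ⟨eX, eA, h⟩ := hp
  have h0 : ∀ x a b, a ≠ b →
      TensorProduct.mapL (S.M.op x a) (S.N.op (eX x) (eA b)) S.ψ = 0 := fun x a b hab =>
    apply_eq_zero_of_inner_eq_zero (S.vec_isPositive _ _ _ _)
      ((hm x (eX x) a (eA b)).trans (by rw [h x a b hab, Complex.ofReal_zero]))
  have hM : ∀ x a, (S.M.op x a).rTensor S.N.H S.ψ =
      TensorProduct.mapL (S.M.op x a) (S.N.op (eX x) (eA a)) S.ψ := fun x a => by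
    conv_lhs => rw [← S.N.sum_lTensor S.M.H (eX x) S.ψ, map_sum]
    simp only [rTensor_lTensor_apply]
    refine Finset.sum_eq_single (eA a) (fun b _ hb => ?_) (by simp)
    obtain ⟨b, rfl⟩ := eA.surjective b
    exact h0 x a b fun hab => hb (by rw [hab])
  have hN : ∀ x a, (S.N.op (eX x) (eA a)).lTensor S.M.H S.ψ =
      TensorProduct.mapL (S.M.op x a) (S.N.op (eX x) (eA a)) S.ψ := fun x a => by
    conv_lhs => rw [← S.M.sum_rTensor S.N.H x S.ψ, map_sum]
    simp only [lTensor_rTensor_apply]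
    exact Finset.sum_eq_single a (fun b _ hb => h0 x b a hb) (by simp)
  refine ⟨S.M.isProjective_of_mul_eq_zero fun x a b hab => hS.1 _ ?_,
    S.N.isProjective_of_mul_eq_zero fun y a b hab => hS.2 _ ?_⟩
  · rw [ContinuousLinearMap.rTensor_mul, mul_apply_eq_comp, hM, ← hN, rTensor_lTensor_apply,
      h0 x a b hab]
  · obtain ⟨x, rfl⟩ := eX.surjective y
    obtain ⟨a, rfl⟩ := eA.surjective a
    obtain ⟨b, rfl⟩ := eA.surjective b
    rw [ContinuousLinearMap.lTensor_mul, mul_apply_eq_comp, hN, ← hM, lTensor_rTensor_apply,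
      h0 x b a fun hba => hab (by rw [hba])]

/-- Replace Alice's measurements. -/
def replaceLeft (S : QuantumModel X Y A B) (P : X → A → S.M.H →L[ℂ] S.M.H)
    (hP : (∀ x a, (P x a).IsPositive) ∧ ∀ x, ∑ a, P x a = 1) : QuantumModel X Y A B where
  M := ⟨S.M.H, P, hP.1, hP.2⟩
  N := S.N
  finite_left := S.finite_left
  finite_right := S.finite_right
  ψ := S.ψ
  norm_ψ := S.norm_ψ

/-- Replace Bob's measurements. -/
def replaceRight (S : QuantumModel X Y A B) (P : Y → B → S.N.H →L[ℂ] S.N.H)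
    (hP : (∀ y b, (P y b).IsPositive) ∧ ∀ y, ∑ b, P y b = 1) : QuantumModel X Y A B where
  M := S.M
  N := ⟨S.N.H, P, hP.1, hP.2⟩
  finite_left := S.finite_left
  finite_right := S.finite_right
  ψ := S.ψ
  norm_ψ := S.norm_ψ

/-- Replacing Alice's POVMs by either half of the average gives a model whose correlation must be
`p`, by extremality. One of the halves has `M²` in place of `M`, so `M - M² ≥ 0` has zero
expectation in `ψ`; hence it annihilates `ψ`, and full rank makes it zero. -/
theorem FullRank.left_isProjective_of_extreme [Nonempty Y] {S : QuantumModel X Y A B}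
    (hS : S.FullRank) {p : X → Y → A → B → ℝ} (hm : S.IsModelFor p)
    (hext : p ∈ Set.extremePoints ℝ (Cq X Y A B)) (hA : Fintype.card A = 2) :
    S.M.IsProjective := by
  obtain ⟨P, Q, hP, hQ, havg, hor⟩ := S.M.exists_average_of_card_eq_two hA
  have h2 : ∀ x y a b, (p x y a b : ℂ) + p x y a b =
      ⟪S.ψ, TensorProduct.mapL (P x a) (S.N.op y b) S.ψ⟫_ℂ +
        ⟪S.ψ, TensorProduct.mapL (Q x a) (S.N.op y b) S.ψ⟫_ℂ := fun x y a b => by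
    rw [← hm x y a b, vec]
    rw [← tensor_inner_add_right, ← add_apply, ← TensorProduct.mapL_add_left, ← havg,
      TensorProduct.mapL_add_left, add_apply, tensor_inner_add_right]
  have hPm : (S.replaceLeft P hP).IsModelFor p :=
    isModelFor_of_extreme hext _ (S.replaceLeft Q hQ) (c := 1 / 2) (by norm_num) (by norm_num)
      fun x y a b => by
        have := h2 x y a b
        change _ = _ * ⟪S.ψ, TensorProduct.mapL (P x a) (S.N.op y b) S.ψ⟫_ℂ +
          _ * ⟪S.ψ, TensorProduct.mapL (Q x a) (S.N.op y b) S.ψ⟫_ℂ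
        push_cast
        linear_combination this / 2
  have hQm : ∀ x y a b, ⟪S.ψ, TensorProduct.mapL (Q x a) (S.N.op y b) S.ψ⟫_ℂ = p x y a b :=
    fun x y a b => by
      have h3 : ⟪S.ψ, TensorProduct.mapL (P x a) (S.N.op y b) S.ψ⟫_ℂ = p x y a b := hPm x y a b
      have := h2 x y a b
      linear_combination -this - h3
  have hsq : ∀ x y a b, ⟪S.ψ, TensorProduct.mapL (S.M.op x a * S.M.op x a) (S.N.op y b) S.ψ⟫_ℂ =
      p x y a b := fun x y a b => by
    rcases hor x a with h | h
    · rw [← h]; exact hPm x y a b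
    · rw [← h]; exact hQm x y a b
  refine S.M.isProjective_of_idempotent fun x a => ?_
  have hpos := isPositive_sub_mul_self (S.M.isPositive x a) (S.M.isPositive_one_sub x a)
  refine (sub_eq_zero.1 (hS.1 _ (apply_eq_zero_of_inner_eq_zero ?_ ?_))).symm
  · rw [ContinuousLinearMap.rTensor_eq_mapL]
    exact isPositive_mapL hpos ContinuousLinearMap.isPositive_id
  · obtain ⟨y⟩ := ‹Nonempty Y›
    -- Correlations only see `M ⊗ N_b`, so the local expectation is obtained by summing over Bob's
    -- outcomes for one fixed question.
    have hexp : ∀ v : S.M.H ⊗[ℂ] S.N.H, (S.M.op x a - S.M.op x a * S.M.op x a).rTensor S.N.H v =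
        ∑ b, TensorProduct.mapL (S.M.op x a - S.M.op x a * S.M.op x a) (S.N.op y b) v :=
      fun v => by
        conv_lhs => rw [← S.N.sum_lTensor S.M.H y v, map_sum]
        simp only [rTensor_lTensor_apply]
    rw [hexp, inner_sum]
    refine Finset.sum_eq_zero fun b _ => ?_
    have hadd := TensorProduct.mapL_add_left (S.M.op x a - S.M.op x a * S.M.op x a)
      (S.M.op x a * S.M.op x a) (S.N.op y b)
    rw [sub_add_cancel] at hadd
    have h4 := hm x y a b
    rw [vec, hadd, add_apply, inner_add_right, hsq] at h4
    simpa using h4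

/-- The argument of `FullRank.left_isProjective_of_extreme` with the two parties exchanged. -/
theorem FullRank.right_isProjective_of_extreme [Nonempty X] {S : QuantumModel X Y A B}
    (hS : S.FullRank) {p : X → Y → A → B → ℝ} (hm : S.IsModelFor p)
    (hext : p ∈ Set.extremePoints ℝ (Cq X Y A B)) (hB : Fintype.card B = 2) :
    S.N.IsProjective := by
  obtain ⟨P, Q, hP, hQ, havg, hor⟩ := S.N.exists_average_of_card_eq_two hB
  have h2 : ∀ x y a b, (p x y a b : ℂ) + p x y a b =
      ⟪S.ψ, TensorProduct.mapL (S.M.op x a) (P y b) S.ψ⟫_ℂ +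
        ⟪S.ψ, TensorProduct.mapL (S.M.op x a) (Q y b) S.ψ⟫_ℂ := fun x y a b => by
    rw [← hm x y a b, vec]
    rw [← tensor_inner_add_right, ← add_apply, ← TensorProduct.mapL_add_right, ← havg,
      TensorProduct.mapL_add_right, add_apply, tensor_inner_add_right]
  have hPm : (S.replaceRight P hP).IsModelFor p :=
    isModelFor_of_extreme hext _ (S.replaceRight Q hQ) (c := 1 / 2) (by norm_num) (by norm_num)
      fun x y a b => by
        have := h2 x y a b
        change _ = _ * ⟪S.ψ, TensorProduct.mapL (S.M.op x a) (P y b) S.ψ⟫_ℂ +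
          _ * ⟪S.ψ, TensorProduct.mapL (S.M.op x a) (Q y b) S.ψ⟫_ℂ
        push_cast
        linear_combination this / 2
  have hQm : ∀ x y a b, ⟪S.ψ, TensorProduct.mapL (S.M.op x a) (Q y b) S.ψ⟫_ℂ = p x y a b :=
    fun x y a b => by
      have h3 : ⟪S.ψ, TensorProduct.mapL (S.M.op x a) (P y b) S.ψ⟫_ℂ = p x y a b := hPm x y a b
      have := h2 x y a b
      linear_combination -this - h3
  have hsq : ∀ x y a b, ⟪S.ψ, TensorProduct.mapL (S.M.op x a) (S.N.op y b * S.N.op y b) S.ψ⟫_ℂ =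
      p x y a b := fun x y a b => by
    rcases hor y b with h | h
    · rw [← h]; exact hPm x y a b
    · rw [← h]; exact hQm x y a b
  refine S.N.isProjective_of_idempotent fun y b => ?_
  have hpos := isPositive_sub_mul_self (S.N.isPositive y b) (S.N.isPositive_one_sub y b)
  refine (sub_eq_zero.1 (hS.2 _ (apply_eq_zero_of_inner_eq_zero ?_ ?_))).symm
  · rw [ContinuousLinearMap.lTensor_eq_mapL]
    exact isPositive_mapL ContinuousLinearMap.isPositive_id hpos
  · obtain ⟨x⟩ := ‹Nonempty X›
    have hexp : ∀ v : S.M.H ⊗[ℂ] S.N.H, (S.N.op y b - S.N.op y b * S.N.op y b).lTensor S.M.H v =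
        ∑ a, TensorProduct.mapL (S.M.op x a) (S.N.op y b - S.N.op y b * S.N.op y b) v :=
      fun v => by
        conv_lhs => rw [← S.M.sum_rTensor S.N.H x v, map_sum]
        simp only [lTensor_rTensor_apply]
    rw [hexp, inner_sum]
    refine Finset.sum_eq_zero fun a _ => ?_
    have hadd := TensorProduct.mapL_add_right (S.M.op x a)
      (S.N.op y b - S.N.op y b * S.N.op y b) (S.N.op y b * S.N.op y b)
    rw [sub_add_cancel] at hadd
    have h4 := hm x y a b
    rw [vec, hadd, add_apply, inner_add_right, hsq] at h4
    simpa using h4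

theorem FullRank.isProjective [Nonempty X] [Nonempty Y] {S : QuantumModel X Y A B}
    (hS : S.FullRank) {p : X → Y → A → B → ℝ} (hm : S.IsModelFor p)
    (hp : IsSynchronous p ∨ (Fintype.card A = 2 ∧ Fintype.card B = 2))
    (hext : p ∈ Set.extremePoints ℝ (Cq X Y A B)) : S.IsProjective := by
  rcases hp with hp | ⟨hA, hB⟩
  · exact hS.isProjective_of_synchronous hm hp
  · exact ⟨hS.left_isProjective_of_extreme hm hext hA, hS.right_isProjective_of_extreme hm hext hB⟩

end QuantumModel

/-! ### From commuting measurements to tensor products -/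

section Commuting

variable {K : Type*} [NormedAddCommGroup K] [InnerProductSpace ℂ K] [FiniteDimensional ℂ K]

variable (K) in
/-- The unnormalised maximally entangled vector `∑ᵣ eᵣ ⊗ eᵣ`. -/
def entangled : K ⊗[ℂ] K := ∑ r, stdOrthonormalBasis ℂ K r ⊗ₜ[ℂ] stdOrthonormalBasis ℂ K r

/-- The inner product of `v ⊗ e_r` with `(T ⊗ 1)∑ e_s ⊗ e_s` is the matrix coefficient `⟨v, T e_r⟩`.
-/
theorem rTensor_entangled_injective {T : K →L[ℂ] K} (h : T.rTensor K (entangled K) = 0) :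
    T = 0 := by
  refine ContinuousLinearMap.coe_injective
    ((stdOrthonormalBasis ℂ K).toBasis.ext fun r => ext_inner_left ℂ fun v => ?_)
  have h1 : ⟪v ⊗ₜ[ℂ] stdOrthonormalBasis ℂ K r, T.rTensor K (entangled K)⟫_ℂ = 0 := by
    rw [h, inner_zero_right]
  rw [entangled, map_sum, inner_sum] at h1
  simpa [orthonormal_iff_ite.1 (stdOrthonormalBasis ℂ K).orthonormal] using h1

/-- The commutant of a family of operators. -/
def commutant {J : Type*} (N : J → K →L[ℂ] K) : Submodule ℂ (K →L[ℂ] K) where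
  carrier := {T | ∀ j, T * N j = N j * T}
  add_mem' hS hT j := by rw [add_mul, mul_add, hS j, hT j]
  zero_mem' j := by rw [zero_mul, mul_zero]
  smul_mem' c T hT j := by rw [smul_mul_assoc, mul_smul_comm, hT j]

omit [FiniteDimensional ℂ K] in
theorem mul_mem_commutant {J : Type*} {N : J → K →L[ℂ] K} {S T : K →L[ℂ] K}
    (hS : S ∈ commutant N) (hT : T ∈ commutant N) : S * T ∈ commutant N := fun j => by
  rw [mul_assoc, hT j, ← mul_assoc, hS j, mul_assoc]

theorem star_mem_commutant {J : Type*} {N : J → K →L[ℂ] K} (hN : ∀ j, star (N j) = N j)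
    {T : K →L[ℂ] K} (hT : T ∈ commutant N) : star T ∈ commutant N := fun j => by
  have := congrArg star (hT j)
  rw [star_mul, star_mul, hN] at this
  exact this.symm

/-- Commuting families of self-adjoint operators `M` and `N` on `K` are jointly intertwined with
`(M ⊗ 1) ⊗ 1` and `1 ⊗ N`. -/
theorem exists_injective_intertwiner {I J : Type*} (M : I → K →L[ℂ] K) (N : J → K →L[ℂ] K)
    (hM : ∀ i, star (M i) = M i) (hN : ∀ j, star (N j) = N j)
    (hMN : ∀ i j, M i * N j = N j * M i) :
    ∃ W : K →L[ℂ] (K ⊗[ℂ] K) ⊗[ℂ] K, Function.Injective W ∧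
      (∀ i, W ∘L M i = ((M i).rTensor K).rTensor K ∘L W) ∧
      ∀ j, W ∘L N j = (N j).lTensor (K ⊗[ℂ] K) ∘L W := by
  -- `τ` vectorises operators: the inner product of `K ⊗ K` becomes the Hilbert–Schmidt one, and
  -- left multiplication by `S` becomes `S ⊗ 1`.
  let τ : (K →L[ℂ] K) →ₗ[ℂ] K ⊗[ℂ] K :=
    { toFun := fun T => T.rTensor K (entangled K)
      map_add' := fun S T => by simp
      map_smul' := fun c T => by simp }
  have hτ0 : ∀ T, τ T = 0 → T = 0 := fun T => rTensor_entangled_injective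
  have hτmul : ∀ S T, τ (S * T) = S.rTensor K (τ T) := fun S T => by
    change (S * T).rTensor K _ = S.rTensor K (T.rTensor K _)
    rw [ContinuousLinearMap.rTensor_mul]; rfl
  -- The preimages `p i` of `b i` form a Hilbert–Schmidt orthonormal basis of the commutant of `N`.
  let b := stdOrthonormalBasis ℂ ((commutant N).map τ)
  have hb : ∀ i, ∃ p ∈ commutant N, τ p = b i := fun i => (b i).2
  choose p hp hpb using hb
  have hexp : ∀ T ∈ commutant N, T = ∑ i, ⟪(b i : K ⊗[ℂ] K), τ T⟫_ℂ • p i := fun T hT => by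
    rw [← sub_eq_zero]
    refine hτ0 _ ?_
    rw [map_sub, map_sum, sub_eq_zero]
    have h1 := b.sum_repr ⟨τ T, ⟨T, hT, rfl⟩⟩
    have h2 := congrArg (Submodule.subtype _) h1
    rw [map_sum] at h2
    simp only [map_smul, hpb]
    refine Eq.trans h2.symm (Finset.sum_congr rfl fun i _ => ?_)
    rw [map_smul, b.repr_apply_apply]
    rfl
  -- `W h = ∑ b_i ⊗ p_i† h`. Each `p_i†` commutes with `N`, so `N` acts on the last factor; `M` lies
  -- in the commutant, so it only mixes the `p_i` and its action moves to the first factor.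
  -- Injectivity holds because `1` is a combination of the `p_i`.
  let W : K →L[ℂ] (K ⊗[ℂ] K) ⊗[ℂ] K :=
    ∑ i, TensorProduct.mkL ℂ (K ⊗[ℂ] K) K (b i) ∘L star (p i)
  have hW : ∀ h, W h = ∑ i, (b i : K ⊗[ℂ] K) ⊗ₜ[ℂ] (star (p i) h) := fun h => by
    simp [W]
  refine ⟨W, (injective_iff_map_eq_zero _).2 fun h h0 => ?_, fun i => ?_, fun j => ?_⟩
  · have hk : ∀ k, star (p k) h = 0 := fun k => by
      have h1 : TensorProduct.lid ℂ K
          ((innerSL ℂ (b k : K ⊗[ℂ] K)).toLinearMap.rTensor K (W h)) = 0 := by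
        rw [h0, map_zero, map_zero]
      have h2 : ∀ i, ⟪(b k : K ⊗[ℂ] K), (b i : K ⊗[ℂ] K)⟫_ℂ = if k = i then 1 else 0 :=
        fun i => orthonormal_iff_ite.1 b.orthonormal k i
      rw [hW, map_sum, map_sum] at h1
      simpa [h2] using h1
    have hone : (1 : K →L[ℂ] K) ∈ commutant N := fun j => by rw [one_mul, mul_one]
    have h1 := congrArg star (hexp 1 hone)
    rw [star_one, star_sum] at h1
    have h2 := congrArg (fun T : K →L[ℂ] K => T h) h1
    simpa [star_smul, hk, sum_apply] using h2
  · have hMi : M i ∈ commutant N := hMN i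
    ext h
    rw [ContinuousLinearMap.comp_apply, ContinuousLinearMap.comp_apply, hW, hW, map_sum]
    have h1 : ∀ k, (M i).rTensor K (b k) =
        ∑ l, ⟪(b l : K ⊗[ℂ] K), (M i).rTensor K (b k)⟫_ℂ • (b l : K ⊗[ℂ] K) := fun k => by
      have := congrArg τ (hexp _ (mul_mem_commutant hMi (hp k)))
      rwa [hτmul, hpb, map_sum, Finset.sum_congr rfl fun l _ => by rw [map_smul, hpb]] at this
    -- This is the adjoint of the expansion of `M_i p_l`; as `M_i` is self-adjoint, its matrix in
    -- the basis `b` is Hermitian, so the coefficients match those of `h1` with the indices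
    -- exchanged.
    have h2 : ∀ l, star (p l) * M i =
        ∑ k, ⟪(b l : K ⊗[ℂ] K), (M i).rTensor K (b k)⟫_ℂ • star (p k) := fun l => by
      have := congrArg star (hexp _ (mul_mem_commutant hMi (hp l)))
      rw [star_mul, hM, star_sum] at this
      rw [this]
      refine Finset.sum_congr rfl fun k _ => ?_
      rw [star_smul, hτmul, hpb]
      congr 1
      have hadj : ((M i).rTensor K).adjoint = (M i).rTensor K := by
        rw [ContinuousLinearMap.adjoint_rTensor, ← ContinuousLinearMap.star_eq_adjoint, hM]
      rw [← ContinuousLinearMap.adjoint_inner_left, hadj]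
      exact inner_conj_symm _ _
    have h3 : ∀ l, star (p l) (M i h) =
        ∑ k, ⟪(b l : K ⊗[ℂ] K), (M i).rTensor K (b k)⟫_ℂ • star (p k) h := fun l => by
      have := congrArg (fun T : K →L[ℂ] K => T h) (h2 l)
      simpa [sum_apply] using this
    simp only [ContinuousLinearMap.rTensor_tmul]
    rw [Finset.sum_congr rfl fun l _ => by rw [h3 l, TensorProduct.tmul_sum],
      Finset.sum_comm]
    refine Finset.sum_congr rfl fun k _ => ?_
    conv_rhs => rw [h1 k, TensorProduct.sum_tmul]
    exact Finset.sum_congr rfl fun l _ => by rw [TensorProduct.tmul_smul, TensorProduct.smul_tmul']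
  · ext h
    rw [ContinuousLinearMap.comp_apply, ContinuousLinearMap.comp_apply, hW, hW, map_sum]
    refine Finset.sum_congr rfl fun k _ => ?_
    rw [ContinuousLinearMap.lTensor_tmul]
    congr 1
    exact congrArg (fun T : K →L[ℂ] K => T h) (star_mem_commutant hN (hp k) j)

/-- The polar decomposition of an injective operator. -/
theorem exists_isometry_of_injective {E : Type*} [NormedAddCommGroup E] [InnerProductSpace ℂ E]
    [CompleteSpace E] (W : K →L[ℂ] E) (hW : Function.Injective W) :
    ∃ R : K →L[ℂ] K, (∀ v w, ⟪W (R v), W (R w)⟫_ℂ = ⟪v, w⟫_ℂ) ∧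
      ∀ T : K →L[ℂ] K, Commute (W.adjoint ∘L W) T → Commute R T := by
  set Z := W.adjoint ∘L W with hZ
  have hZ0 : 0 ≤ Z := (ContinuousLinearMap.nonneg_iff_isPositive _).2
    (ContinuousLinearMap.isPositive_adjoint_comp_self W)
  set Q := CFC.sqrt Z with hQ
  have hQQ : Q * Q = Z := CFC.sqrt_mul_sqrt_self Z hZ0
  have hQs : star Q = Q := (IsSelfAdjoint.of_nonneg (CFC.sqrt_nonneg Z)).star_eq
  have hQi : Function.Injective Q := (injective_iff_map_eq_zero _).2 fun v hv => by
    have h1 : Z v = 0 := by rw [← hQQ, mul_apply_eq_comp, hv, map_zero]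
    have h2 : ⟪W v, W v⟫_ℂ = 0 := by
      rw [← ContinuousLinearMap.adjoint_inner_right, ← ContinuousLinearMap.comp_apply, ← hZ, h1,
        inner_zero_right]
    exact (injective_iff_map_eq_zero _).1 hW _ (inner_self_eq_zero.1 h2)
  -- `R = Q⁻¹` with `Q = √(W†W)`, so `W R` is the isometric part of `W`. Whatever commutes with
  -- `W†W` commutes with `Q` by functional calculus, hence with its inverse.
  let e := LinearEquiv.ofInjectiveEndo Q.toLinearMap hQi
  let R : K →L[ℂ] K := e.symm.toLinearMap.toContinuousLinearMap
  have hQR : ∀ v, Q (R v) = v := fun v => e.apply_symm_apply v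
  have hRQ : ∀ v, R (Q v) = v := fun v => e.symm_apply_apply v
  refine ⟨R, fun v w => ?_, fun T hT => ?_⟩
  · rw [← ContinuousLinearMap.adjoint_inner_right, ← ContinuousLinearMap.comp_apply, ← hZ, ← hQQ,
      mul_apply_eq_comp, hQR]
    conv_lhs => rw [← hQs, ContinuousLinearMap.star_eq_adjoint]
    rw [ContinuousLinearMap.adjoint_inner_right, hQR]
  · have hc : Commute Q T := hT.cfcₙ_nnreal _
    ext v
    have h1 : Q (T (R v)) = T v := by
      have := congrArg (fun S : K →L[ℂ] K => S (R v)) hc.eq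
      rw [mul_apply_eq_comp, mul_apply_eq_comp, hQR] at this
      exact this
    rw [mul_apply_eq_comp, mul_apply_eq_comp, ← h1, hRQ]

/-- Self-adjointness of `T` and `T'` lets the relation `W T = T' W` be adjointed, so `T` commutes
with `W†W` and passes through the correcting factor `R` in `V = W R`. -/
theorem exists_isometric_intertwiner_of_injective {E : Type*} [NormedAddCommGroup E]
    [InnerProductSpace ℂ E] [CompleteSpace E] (W : K →L[ℂ] E) (hW : Function.Injective W) :
    ∃ V : K →L[ℂ] E, (∀ v w, ⟪V v, V w⟫_ℂ = ⟪v, w⟫_ℂ) ∧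
      ∀ (T : K →L[ℂ] K) (T' : E →L[ℂ] E), T.adjoint = T → T'.adjoint = T' →
        W ∘L T = T' ∘L W → V ∘L T = T' ∘L V := by
  obtain ⟨R, hR, hRc⟩ := exists_isometry_of_injective W hW
  refine ⟨W ∘L R, hR, fun T T' hT hT' h => ?_⟩
  have hc : Commute (W.adjoint ∘L W) T := by
    change (W.adjoint ∘L W) ∘L T = T ∘L (W.adjoint ∘L W)
    have h' := congrArg ContinuousLinearMap.adjoint h
    rw [ContinuousLinearMap.adjoint_comp, ContinuousLinearMap.adjoint_comp, hT, hT'] at h'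
    rw [ContinuousLinearMap.comp_assoc, h, ← ContinuousLinearMap.comp_assoc, ← h',
      ContinuousLinearMap.comp_assoc]
  have hc' : R ∘L T = T ∘L R := (hRc T hc).eq
  rw [ContinuousLinearMap.comp_assoc, hc', ← ContinuousLinearMap.comp_assoc, h,
    ContinuousLinearMap.comp_assoc]

/-- Commuting families of self-adjoint operators are jointly intertwined by an isometry with
operators acting on different tensor factors. -/
theorem exists_isometric_intertwiner {I J : Type*} (M : I → K →L[ℂ] K) (N : J → K →L[ℂ] K)
    (hM : ∀ i, star (M i) = M i) (hN : ∀ j, star (N j) = N j)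
    (hMN : ∀ i j, M i * N j = N j * M i) :
    ∃ V : K →L[ℂ] (K ⊗[ℂ] K) ⊗[ℂ] K, (∀ v w, ⟪V v, V w⟫_ℂ = ⟪v, w⟫_ℂ) ∧
      (∀ i, V ∘L M i = ((M i).rTensor K).rTensor K ∘L V) ∧
      ∀ j, V ∘L N j = (N j).lTensor (K ⊗[ℂ] K) ∘L V := by
  obtain ⟨W, hW, hWM, hWN⟩ := exists_injective_intertwiner M N hM hN hMN
  obtain ⟨V, hV, hVT⟩ := exists_isometric_intertwiner_of_injective (E := (K ⊗[ℂ] K) ⊗[ℂ] K) W hW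
  refine ⟨V, hV, fun i => hVT _ _ (hM i) ?_ (hWM i), fun j => hVT _ _ (hN j) ?_ (hWN j)⟩
  · refine (ContinuousLinearMap.adjoint_rTensor K ((M i).rTensor K)).trans ?_
    rw [ContinuousLinearMap.adjoint_rTensor, ← ContinuousLinearMap.star_eq_adjoint, hM]
  · refine (ContinuousLinearMap.adjoint_lTensor (K ⊗[ℂ] K) (N j)).trans ?_
    rw [← ContinuousLinearMap.star_eq_adjoint, hN]

end Commuting

/-! ### Finite-dimensional states are defined by quantum models -/

/-- `⟨Tv, v⟩ = ‖v‖² - ⟨(1 - T)v, v⟩`. Stated as a norm bound, positivity of the generators survives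
every representation, since `*`-homomorphisms are contractive. -/
theorem isPositive_of_norm_one_sub_le {E : Type*} [NormedAddCommGroup E] [InnerProductSpace ℂ E]
    [CompleteSpace E] {T : E →L[ℂ] E} (hT : star T = T) (h : ‖1 - T‖ ≤ 1) : T.IsPositive := by
  refine ContinuousLinearMap.isPositive_def'.2 ⟨hT, fun v => ?_⟩
  have h1 : ‖⟪(1 - T) v, v⟫_ℂ‖ ≤ ‖v‖ * ‖v‖ :=
    (norm_inner_le_norm _ _).trans (mul_le_mul_of_nonneg_right
      (by simpa using (1 - T).le_of_opNorm_le h v) (norm_nonneg _))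
  have h2 : ⟪T v, v⟫_ℂ = (‖v‖ : ℂ) ^ 2 - ⟪(1 - T) v, v⟫_ℂ := by
    rw [sub_apply, one_apply_eq_self, inner_sub_left, inner_self_eq_norm_sq_to_K]
    simp
  have h3 := (Complex.re_le_norm _).trans h1
  have h4 : (⟪T v, v⟫_ℂ).re = ‖v‖ ^ 2 - (⟪(1 - T) v, v⟫_ℂ).re := by
    rw [h2, Complex.sub_re, ← Complex.ofReal_pow, Complex.ofReal_re]
  change 0 ≤ (⟪T v, v⟫_ℂ).re
  rw [h4]
  nlinarith

section Local

variable {X Y A B : Type*} [Fintype A] [Fintype B]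

/-- The element `m^x_a ⊗ 1`. -/
def POVMTensor.left (x : X) (a : A) : POVMTensor X Y A B :=
  ⟨tensLeft _ _ (SelfTest.gen (fun M : POVMFamily X A => M) x a),
    tens_mem (gen_mem _ x a) (one_mem _)⟩

/-- The element `1 ⊗ n^y_b`. -/
def POVMTensor.right (y : Y) (b : B) : POVMTensor X Y A B :=
  ⟨tensRight _ _ (SelfTest.gen (fun N : POVMFamily Y B => N) y b),
    tens_mem (one_mem _) (gen_mem _ y b)⟩

theorem POVMTensor.left_mul_right (x : X) (y : Y) (a : A) (b : B) :
    POVMTensor.left x a * POVMTensor.right y b = POVMTensor.gen x y a b :=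
  Subtype.ext (tens_eq_left_mul_right _ _).symm

theorem POVMTensor.right_mul_left (x : X) (y : Y) (a : A) (b : B) :
    POVMTensor.right y b * POVMTensor.left x a = POVMTensor.gen x y a b :=
  Subtype.ext (tens_eq_right_mul_left _ _).symm

theorem POVMTensor.star_left (x : X) (a : A) :
    star (POVMTensor.left x a : POVMTensor X Y A B) = POVMTensor.left x a :=
  Subtype.ext ((map_star (tensLeft _ _) _).symm.trans (congrArg _ (SelfTest.star_gen _ _ _)))

theorem POVMTensor.star_right (y : Y) (b : B) :
    star (POVMTensor.right y b : POVMTensor X Y A B) = POVMTensor.right y b :=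
  Subtype.ext ((map_star (tensRight _ _) _).symm.trans (congrArg _ (SelfTest.star_gen _ _ _)))

theorem POVMTensor.sum_left (x : X) :
    ∑ a, (POVMTensor.left x a : POVMTensor X Y A B) = 1 := by
  refine Subtype.ext ?_
  rw [AddSubmonoidClass.coe_finsetSum]
  refine (map_sum (tensLeft (fun M : POVMFamily X A => M.H) (fun N : POVMFamily Y B => N.H))
    _ _).symm.trans ?_
  rw [sum_gen, map_one]; rfl

theorem POVMTensor.sum_right (y : Y) :
    ∑ b, (POVMTensor.right y b : POVMTensor X Y A B) = 1 := by
  refine Subtype.ext ?_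
  rw [AddSubmonoidClass.coe_finsetSum]
  refine (map_sum (tensRight (fun M : POVMFamily X A => M.H) (fun N : POVMFamily Y B => N.H))
    _ _).symm.trans ?_
  rw [sum_gen, map_one]; rfl

theorem POVMFamily.norm_one_sub_op_le (M : POVMFamily X A) (x : X) (a : A) :
    ‖1 - M.op x a‖ ≤ 1 := by
  refine (CStarAlgebra.norm_le_one_iff_of_nonneg _
    ((ContinuousLinearMap.nonneg_iff_isPositive _).2 (M.isPositive_one_sub x a))).2 ?_
  exact sub_le_self _ ((ContinuousLinearMap.nonneg_iff_isPositive _).2 (M.isPositive x a))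

theorem POVMTensor.norm_one_sub_left_le (x : X) (a : A) :
    ‖1 - (POVMTensor.left x a : POVMTensor X Y A B)‖ ≤ 1 := by
  refine OpProd.norm_le (T := (1 - (POVMTensor.left x a : POVMTensor X Y A B)).1)
    zero_le_one fun j => ?_
  change ‖(1 : HTensor j.1.H j.2.H →L[ℂ] HTensor j.1.H j.2.H) -
    opTensor (j.1.op x a) (1 : j.2.H →L[ℂ] j.2.H)‖ ≤ 1
  have h : (1 : HTensor j.1.H j.2.H →L[ℂ] HTensor j.1.H j.2.H) -
      opTensor (j.1.op x a) (1 : j.2.H →L[ℂ] j.2.H) = opTensor (1 - j.1.op x a) 1 := by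
    rw [sub_eq_iff_eq_add, ← opTensor_add_left, sub_add_cancel, opTensor_one]
  rw [h]
  refine (norm_opTensor_le _ _).trans ?_
  rw [norm_one, mul_one]
  exact j.1.norm_one_sub_op_le x a

theorem POVMTensor.norm_one_sub_right_le (y : Y) (b : B) :
    ‖1 - (POVMTensor.right y b : POVMTensor X Y A B)‖ ≤ 1 := by
  refine OpProd.norm_le (T := (1 - (POVMTensor.right y b : POVMTensor X Y A B)).1)
    zero_le_one fun j => ?_
  change ‖(1 : HTensor j.1.H j.2.H →L[ℂ] HTensor j.1.H j.2.H) -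
    opTensor (1 : j.1.H →L[ℂ] j.1.H) (j.2.op y b)‖ ≤ 1
  have h : (1 : HTensor j.1.H j.2.H →L[ℂ] HTensor j.1.H j.2.H) -
      opTensor (1 : j.1.H →L[ℂ] j.1.H) (j.2.op y b) = opTensor 1 (1 - j.2.op y b) := by
    rw [sub_eq_iff_eq_add, ← opTensor_add_right, sub_add_cancel, opTensor_one]
  rw [h]
  refine (norm_opTensor_le _ _).trans ?_
  rw [norm_one, one_mul]
  exact j.2.norm_one_sub_op_le y b

section Rep

variable {K : Type} [NormedAddCommGroup K] [InnerProductSpace ℂ K] [CompleteSpace K] [Nontrivial K]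

/-- Alice's measurements in a representation. -/
def leftFamily (π : POVMTensor X Y A B →⋆ₐ[ℂ] (K →L[ℂ] K)) : POVMFamily X A where
  H := ⟨K⟩
  op x a := π (POVMTensor.left x a)
  isPositive x a := isPositive_of_norm_one_sub_le
    (by rw [← map_star, POVMTensor.star_left])
    (by rw [← map_one π, ← map_sub]
        exact (NonUnitalStarAlgHom.norm_apply_le π _).trans (POVMTensor.norm_one_sub_left_le x a))
  sum_eq_one x := (map_sum π _ _).symm.trans (by rw [POVMTensor.sum_left, map_one])

/-- Bob's measurements in a representation. -/
def rightFamily (π : POVMTensor X Y A B →⋆ₐ[ℂ] (K →L[ℂ] K)) : POVMFamily Y B where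
  H := ⟨K⟩
  op y b := π (POVMTensor.right y b)
  isPositive y b := isPositive_of_norm_one_sub_le
    (by rw [← map_star, POVMTensor.star_right])
    (by rw [← map_one π, ← map_sub]
        exact (NonUnitalStarAlgHom.norm_apply_le π _).trans (POVMTensor.norm_one_sub_right_le y b))
  sum_eq_one y := (map_sum π _ _).symm.trans (by rw [POVMTensor.sum_right, map_one])

end Rep

/-- The measurements `M ⊗ 1`. -/
def POVMFamily.rTensor (M : POVMFamily X A) [FiniteDimensional ℂ M.H] (K : Type)
    [NormedAddCommGroup K] [InnerProductSpace ℂ K] [FiniteDimensional ℂ K] [Nontrivial K] :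
    POVMFamily X A where
  H := ⟨M.H ⊗[ℂ] K⟩
  op x a := (M.op x a).rTensor K
  isPositive x a := by
    have : CompleteSpace K := FiniteDimensional.complete ℂ K
    rw [ContinuousLinearMap.rTensor_eq_mapL]
    exact isPositive_mapL (M.isPositive x a) ContinuousLinearMap.isPositive_id
  sum_eq_one x := ContinuousLinearMap.ext fun v => by
    refine Eq.trans ?_ (M.sum_rTensor K x v)
    exact sum_apply _ _ _

theorem QuantumModel.state_eq_ofRep [Nonempty X] [Nonempty Y] {K : Type*} [NormedAddCommGroup K]
    [InnerProductSpace ℂ K] [CompleteSpace K] (S : QuantumModel X Y A B)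
    (π : POVMTensor X Y A B →⋆ₐ[ℂ] (K →L[ℂ] K)) (V : K →L[ℂ] S.M.H ⊗[ℂ] S.N.H)
    (hV : ∀ v w, ⟪V v, V w⟫_ℂ = ⟪v, w⟫_ℂ) (Ω : K) (hΩ : ‖Ω‖ = 1) (hψ : V Ω = S.ψ)
    (h : ∀ x y a b, V ∘L π (POVMTensor.gen x y a b) =
      TensorProduct.mapL (S.M.op x a) (S.N.op y b) ∘L V) : S.state = .ofRep π Ω hΩ := by
  refine AbstractState.ext fun t => ?_
  have ht := intertwines_of_gen π S.rep V (fun x y a b => by rw [rep_gen, h]) t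
  rw [state_apply, AbstractState.ofRep_apply, ← hV, ← hψ, ← ContinuousLinearMap.comp_apply,
    ← ContinuousLinearMap.comp_apply, ht]

theorem exists_model_of_intertwiner [Nonempty X] [Nonempty Y] {K : Type*} [NormedAddCommGroup K]
    [InnerProductSpace ℂ K] [CompleteSpace K] (π : POVMTensor X Y A B →⋆ₐ[ℂ] (K →L[ℂ] K))
    (M : POVMFamily X A) (N : POVMFamily Y B) [FiniteDimensional ℂ M.H] [FiniteDimensional ℂ N.H]
    (V : K →L[ℂ] M.H ⊗[ℂ] N.H) (hV : ∀ v w, ⟪V v, V w⟫_ℂ = ⟪v, w⟫_ℂ) (Ω : K) (hΩ : ‖Ω‖ = 1)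
    (h : ∀ x y a b, V ∘L π (POVMTensor.gen x y a b) =
      TensorProduct.mapL (M.op x a) (N.op y b) ∘L V) :
    ∃ S : QuantumModel X Y A B, S.state = .ofRep π Ω hΩ := by
  have hVΩ : ‖V Ω‖ = 1 := by
    rw [← hΩ, ← sq_eq_sq₀ (norm_nonneg _) (norm_nonneg _)]
    have h1 := congrArg Complex.re (hV Ω Ω)
    exact (inner_self_eq_norm_sq (𝕜 := ℂ) (V Ω)).symm.trans
      (h1.trans (inner_self_eq_norm_sq (𝕜 := ℂ) Ω))
  let S : QuantumModel X Y A B := ⟨M, N, inferInstance, inferInstance, V Ω, hVΩ⟩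
  exact ⟨S, S.state_eq_ofRep π V hV Ω hΩ rfl h⟩

/-- The images of `m ⊗ 1` and `1 ⊗ n` commute, so they can be separated: Alice receives `K ⊗ K` with
`M ⊗ 1`, Bob receives `K`, and the vector state is the isometric image of `Ω`. -/
theorem exists_model_of_rep [Nonempty X] [Nonempty Y] {K : Type} [NormedAddCommGroup K]
    [InnerProductSpace ℂ K] [FiniteDimensional ℂ K] [CompleteSpace K]
    (π : POVMTensor X Y A B →⋆ₐ[ℂ] (K →L[ℂ] K)) (Ω : K) (hΩ : ‖Ω‖ = 1) :
    ∃ S : QuantumModel X Y A B, S.state = .ofRep π Ω hΩ := by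
  have : Nontrivial K := ⟨Ω, 0, fun h => by simp [h] at hΩ⟩
  obtain ⟨V, hV, hVM, hVN⟩ := exists_isometric_intertwiner
    (fun i : X × A => π (POVMTensor.left i.1 i.2)) (fun j : Y × B => π (POVMTensor.right j.1 j.2))
    (fun i => by rw [← map_star, POVMTensor.star_left])
    (fun j => by rw [← map_star, POVMTensor.star_right])
    (fun i j => by rw [← map_mul, ← map_mul, POVMTensor.left_mul_right,
      POVMTensor.right_mul_left])
  have h : ∀ x y a b, V ∘L π (POVMTensor.gen x y a b) =
      TensorProduct.mapL ((π (POVMTensor.left x a)).rTensor K) (π (POVMTensor.right y b)) ∘L V :=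
    fun x y a b => by
      rw [← POVMTensor.left_mul_right, map_mul, ContinuousLinearMap.mul_def,
        ← ContinuousLinearMap.comp_assoc, hVM (x, a), ContinuousLinearMap.comp_assoc, hVN (y, b),
        ← ContinuousLinearMap.comp_assoc, ContinuousLinearMap.rTensor_comp_lTensor]
  have : FiniteDimensional ℂ (leftFamily π).H := ‹FiniteDimensional ℂ K›
  have : FiniteDimensional ℂ (rightFamily π).H := ‹FiniteDimensional ℂ K›
  have : FiniteDimensional ℂ ((leftFamily π).rTensor K).H :=
    inferInstanceAs (FiniteDimensional ℂ (K ⊗[ℂ] K))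
  exact exists_model_of_intertwiner π ((leftFamily π).rTensor K) (rightFamily π) V hV Ω hΩ h

/-- Every finite-dimensional state is defined by a quantum model. -/
theorem AbstractState.IsFiniteDimensional.exists_model [Nonempty X] [Nonempty Y]
    {f : AbstractState (POVMTensor X Y A B)} (hf : f.IsFiniteDimensional) :
    ∃ S : QuantumModel X Y A B, S.state = f := by
  have : FiniteDimensional ℂ f.toPos.GNS := hf
  let e := (stdOrthonormalBasis ℂ f.toPos.GNS).repr
  -- The GNS space lives in a larger universe; a Euclidean space of the same dimension is a
  -- legitimate `Hilb`.
  let E := EuclideanSpace ℂ (Fin (Module.finrank ℂ f.toPos.GNS))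
  let π : POVMTensor X Y A B →⋆ₐ[ℂ] (E →L[ℂ] E) :=
    (e.conjStarAlgEquiv : (f.toPos.GNS →L[ℂ] f.toPos.GNS) →⋆ₐ[ℂ] (E →L[ℂ] E)).comp
      f.toPos.gnsStarAlgHom
  let ω : f.toPos.GNS := ((f.toPos.toPreGNS 1 : f.toPos.PreGNS) : f.toPos.GNS)
  have hω : ∀ t, ⟪ω, f.toPos.gnsStarAlgHom t ω⟫_ℂ = f.toPos t := fun t => by
    have h : f.toPos.gnsStarAlgHom t ω = (f.toPos.leftMulMapPreGNS t (f.toPos.toPreGNS 1) :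
      f.toPos.PreGNS) := f.toPos.gnsNonUnitalStarAlgHom_apply_coe
    rw [h, UniformSpace.Completion.inner_coe, PositiveLinearMap.preGNS_inner_def]
    simp
  have hω1 : ‖e ω‖ = 1 := by
    have h := (hω 1).trans f.map_one
    rw [_root_.map_one, one_apply_eq_self, inner_self_eq_norm_sq_to_K] at h
    have h1 : ‖ω‖ ^ 2 = 1 := RCLike.ofReal_injective (K := ℂ)
      (by rw [RCLike.ofReal_pow, RCLike.ofReal_one]; exact h)
    rw [e.norm_map]
    exact (pow_eq_one_iff_of_nonneg (norm_nonneg _) two_ne_zero).1 h1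
  obtain ⟨S, hS⟩ := exists_model_of_rep π (e ω) hω1
  refine ⟨S, hS.trans (AbstractState.ext fun t => ?_)⟩
  rw [AbstractState.ofRep_apply, ← hω]
  change ⟪e ω, e (f.toPos.gnsStarAlgHom t (e.symm (e ω)))⟫_ℂ = _
  rw [e.symm_apply_apply, e.inner_map_map]

end Local

/-! ### Local dilations of full-rank models -/

section Tensor

variable {E F G H : Type*} [NormedAddCommGroup E] [InnerProductSpace ℂ E]
  [NormedAddCommGroup F] [InnerProductSpace ℂ F] [NormedAddCommGroup G] [InnerProductSpace ℂ G]
  [NormedAddCommGroup H] [InnerProductSpace ℂ H]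

theorem tensor_inner_zero_left (v : E ⊗[ℂ] F) : ⟪(0 : E ⊗[ℂ] F), v⟫_ℂ = 0 :=
  inner_zero_left (𝕜 := ℂ) (E := E ⊗[ℂ] F) v

theorem tensor_inner_zero_right (v : E ⊗[ℂ] F) : ⟪v, (0 : E ⊗[ℂ] F)⟫_ℂ = 0 :=
  inner_zero_right (𝕜 := ℂ) (E := E ⊗[ℂ] F) v

/-- On pure tensors both sides are the same product of four inner products; the rest is additivity
in each slot. -/
theorem inner_tensorTensorTensorComm (u v : (E ⊗[ℂ] F) ⊗[ℂ] (G ⊗[ℂ] H)) :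
    ⟪TensorProduct.tensorTensorTensorComm ℂ E F G H u,
      TensorProduct.tensorTensorTensorComm ℂ E F G H v⟫_ℂ = ⟪u, v⟫_ℂ := by
  have hadd : ∀ u₁ u₂ v : (E ⊗[ℂ] F) ⊗[ℂ] (G ⊗[ℂ] H),
      ⟪u₁ + u₂, v⟫_ℂ = ⟪u₁, v⟫_ℂ + ⟪u₂, v⟫_ℂ := fun u₁ u₂ v =>
    inner_add_left (𝕜 := ℂ) (E := (E ⊗[ℂ] F) ⊗[ℂ] (G ⊗[ℂ] H)) u₁ u₂ v
  have hadd' : ∀ u₁ u₂ v : (E ⊗[ℂ] G) ⊗[ℂ] (F ⊗[ℂ] H),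
      ⟪u₁ + u₂, v⟫_ℂ = ⟪u₁, v⟫_ℂ + ⟪u₂, v⟫_ℂ := fun u₁ u₂ v =>
    inner_add_left (𝕜 := ℂ) (E := (E ⊗[ℂ] G) ⊗[ℂ] (F ⊗[ℂ] H)) u₁ u₂ v
  have pure : ∀ (e e' : E) (f f' : F) (g g' : G) (h h' : H),
      ⟪TensorProduct.tensorTensorTensorComm ℂ E F G H ((e ⊗ₜ f) ⊗ₜ (g ⊗ₜ h)),
        TensorProduct.tensorTensorTensorComm ℂ E F G H ((e' ⊗ₜ f') ⊗ₜ (g' ⊗ₜ h'))⟫_ℂ =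
      ⟪((e ⊗ₜ f) ⊗ₜ (g ⊗ₜ h) : (E ⊗[ℂ] F) ⊗[ℂ] (G ⊗[ℂ] H)), (e' ⊗ₜ f') ⊗ₜ (g' ⊗ₜ h')⟫_ℂ := by
    intros
    simp only [TensorProduct.tensorTensorTensorComm_tmul, TensorProduct.inner_tmul]
    ring
  induction u with
  | zero => simp [tensor_inner_zero_left]
  | add u₁ u₂ h₁ h₂ => rw [map_add, hadd, hadd', h₁, h₂]
  | tmul ef gh =>
  induction ef with
  | zero => simp [tensor_inner_zero_left]
  | add u₁ u₂ h₁ h₂ => rw [TensorProduct.add_tmul, map_add, hadd, hadd', h₁, h₂]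
  | tmul e f =>
  induction gh with
  | zero => simp [tensor_inner_zero_left]
  | add u₁ u₂ h₁ h₂ => rw [TensorProduct.tmul_add, map_add, hadd, hadd', h₁, h₂]
  | tmul g h =>
  induction v with
  | zero => simp [tensor_inner_zero_right]
  | add u₁ u₂ h₁ h₂ => rw [map_add, tensor_inner_add_right, tensor_inner_add_right, h₁, h₂]
  | tmul ef gh =>
  induction ef with
  | zero => simp [tensor_inner_zero_right]
  | add u₁ u₂ h₁ h₂ =>
    rw [TensorProduct.add_tmul, map_add, tensor_inner_add_right, tensor_inner_add_right, h₁, h₂]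
  | tmul e' f' =>
  induction gh with
  | zero => simp [tensor_inner_zero_right]
  | add u₁ u₂ h₁ h₂ =>
    rw [TensorProduct.tmul_add, map_add, tensor_inner_add_right, tensor_inner_add_right, h₁, h₂]
  | tmul g' h' => exact pure e e' f f' g g' h h'

theorem tensorTensorTensorComm_rTensor (S : E →ₗ[ℂ] E) (T : F →ₗ[ℂ] F)
    (u : (E ⊗[ℂ] F) ⊗[ℂ] (G ⊗[ℂ] H)) :
    TensorProduct.tensorTensorTensorComm ℂ E F G H
        ((TensorProduct.map S T).rTensor (G ⊗[ℂ] H) u) =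
      TensorProduct.map (S.rTensor G) (T.rTensor H)
        (TensorProduct.tensorTensorTensorComm ℂ E F G H u) := by
  refine LinearMap.congr_fun (f := (TensorProduct.tensorTensorTensorComm ℂ E F G H).toLinearMap ∘ₗ
    (TensorProduct.map S T).rTensor (G ⊗[ℂ] H)) (g := TensorProduct.map (S.rTensor G)
    (T.rTensor H) ∘ₗ (TensorProduct.tensorTensorTensorComm ℂ E F G H).toLinearMap) ?_ u
  ext e f g h
  simp

variable (E F) in
/-- The homomorphism `T ↦ T ⊗ 1`. -/
def ampliation [FiniteDimensional ℂ E] [FiniteDimensional ℂ F] [CompleteSpace E] [CompleteSpace F] :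
    (E →L[ℂ] E) →⋆ₐ[ℂ] (E ⊗[ℂ] F →L[ℂ] E ⊗[ℂ] F) where
  toFun T := T.rTensor F
  map_one' := ContinuousLinearMap.rTensor_one F
  map_mul' S T := ContinuousLinearMap.rTensor_mul F S T
  map_zero' := ContinuousLinearMap.rTensor_zero F
  map_add' S T := ContinuousLinearMap.rTensor_add F S T
  commutes' c := by
    rw [Algebra.algebraMap_eq_smul_one, Algebra.algebraMap_eq_smul_one,
      ContinuousLinearMap.rTensor_smul, ContinuousLinearMap.rTensor_one]
  map_star' T := (ContinuousLinearMap.adjoint_rTensor F T).symm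

theorem exists_continuousLinearMap_of_inner (T : E →ₗ[ℂ] F) (h : ∀ v w, ⟪T v, T w⟫_ℂ = ⟪v, w⟫_ℂ) :
    ∃ W : E →L[ℂ] F, ∀ v, W v = T v :=
  ⟨(T.isometryOfInner h).toContinuousLinearMap, fun _ => rfl⟩

/-- If `(I ⊗ J) ψ = ψ' ⊗ aux` up to reordering, then `I ⊗ J` followed by the reordering is an
isometry. -/
theorem exists_reordered_isometry {E' F' : Type*} [NormedAddCommGroup E'] [InnerProductSpace ℂ E']
    [NormedAddCommGroup F'] [InnerProductSpace ℂ F'] [FiniteDimensional ℂ E']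
    [FiniteDimensional ℂ F'] (I : E' →ₗᵢ[ℂ] E ⊗[ℂ] G) (J : F' →ₗᵢ[ℂ] F ⊗[ℂ] H) :
    ∃ W : E' ⊗[ℂ] F' →L[ℂ] (E ⊗[ℂ] F) ⊗[ℂ] (G ⊗[ℂ] H), (∀ v w, ⟪W v, W w⟫_ℂ = ⟪v, w⟫_ℂ) ∧
      ∀ v, TensorProduct.tensorTensorTensorComm ℂ E F G H (W v) =
        TensorProduct.map I.toLinearMap J.toLinearMap v := by
  have h : ∀ v, TensorProduct.tensorTensorTensorComm ℂ E F G H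
      (((TensorProduct.tensorTensorTensorComm ℂ E F G H).symm.toLinearMap ∘ₗ
        TensorProduct.map I.toLinearMap J.toLinearMap) v) =
      TensorProduct.map I.toLinearMap J.toLinearMap v :=
    fun v => (TensorProduct.tensorTensorTensorComm ℂ E F G H).apply_symm_apply _
  obtain ⟨W, hW⟩ := exists_continuousLinearMap_of_inner (E := E' ⊗[ℂ] F')
    (F := (E ⊗[ℂ] F) ⊗[ℂ] (G ⊗[ℂ] H)) _ fun v w => by
      rw [← inner_tensorTensorTensorComm, h, h]
      exact TensorProduct.inner_map_map I J v w
  refine ⟨W, fun v w => ?_, fun v => by rw [hW, h]⟩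
  rw [hW, hW, ← inner_tensorTensorTensorComm, h, h]
  exact TensorProduct.inner_map_map I J v w

/-- Both sides agree after applying Bob's isometry `1 ⊗ J`, which is injective and can be cancelled.
What remains involves Alice's side alone, the form to which `FullRank.left_ext` applies. -/
theorem rTensor_eq_of_dilation {E' F' : Type*} [NormedAddCommGroup E'] [InnerProductSpace ℂ E']
    [NormedAddCommGroup F'] [InnerProductSpace ℂ F'] (I : E' →ₗᵢ[ℂ] E ⊗[ℂ] G)
    (J : F' →ₗᵢ[ℂ] F ⊗[ℂ] H) {ψ : E' ⊗[ℂ] F'} {ψ' : E ⊗[ℂ] F} {aux : G ⊗[ℂ] H}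
    (hψ : TensorProduct.map I.toLinearMap J.toLinearMap ψ =
      TensorProduct.tensorTensorTensorComm ℂ E F G H (ψ' ⊗ₜ aux)) {M : E' →L[ℂ] E'}
    {M' : E →L[ℂ] E} (hM : TensorProduct.map I.toLinearMap J.toLinearMap (M.rTensor F' ψ) =
      TensorProduct.tensorTensorTensorComm ℂ E F G H (M'.rTensor F ψ' ⊗ₜ aux)) :
    (I.toContinuousLinearMap ∘L M).rTensor F' ψ =
      (M'.rTensor G ∘L I.toContinuousLinearMap).rTensor F' ψ := by
  refine (J.lTensor (E ⊗[ℂ] G)).injective ?_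
  have h2 := tensorTensorTensorComm_rTensor (G := G) (H := H) M'.toLinearMap
    (LinearMap.id : F →ₗ[ℂ] F) (ψ' ⊗ₜ aux)
  rw [← hψ] at h2
  have h3 : ∀ (P : E' →L[ℂ] E ⊗[ℂ] G), J.lTensor (E ⊗[ℂ] G) (P.rTensor F' ψ) =
      TensorProduct.map P.toLinearMap J.toLinearMap ψ := fun P => by
    rw [LinearIsometry.lTensor_apply, ContinuousLinearMap.rTensor_apply]
    exact LinearMap.congr_fun (LinearMap.lTensor_comp_rTensor _ _ _) ψ
  rw [h3, h3]
  have h4 : TensorProduct.map I.toLinearMap J.toLinearMap (M.rTensor F' ψ) =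
      TensorProduct.map (I.toContinuousLinearMap ∘L M).toLinearMap J.toLinearMap ψ :=
    LinearMap.congr_fun (LinearMap.map_comp_rTensor _ _ _ _) ψ
  have h5 : TensorProduct.map (M'.toLinearMap.rTensor G) ((LinearMap.id : F →ₗ[ℂ] F).rTensor H)
      (TensorProduct.map I.toLinearMap J.toLinearMap ψ) =
      TensorProduct.map (M'.rTensor G ∘L I.toContinuousLinearMap).toLinearMap J.toLinearMap ψ := by
    rw [LinearMap.rTensor_id]
    exact LinearMap.congr_fun (TensorProduct.map_comp _ _ _ _).symm ψ
  rw [← h4, hM, ← h5, ← h2]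
  rfl

/-- Here Alice's isometry `I ⊗ 1` is the one that is cancelled. -/
theorem lTensor_eq_of_dilation {E' F' : Type*} [NormedAddCommGroup E'] [InnerProductSpace ℂ E']
    [NormedAddCommGroup F'] [InnerProductSpace ℂ F'] (I : E' →ₗᵢ[ℂ] E ⊗[ℂ] G)
    (J : F' →ₗᵢ[ℂ] F ⊗[ℂ] H) {ψ : E' ⊗[ℂ] F'} {ψ' : E ⊗[ℂ] F} {aux : G ⊗[ℂ] H}
    (hψ : TensorProduct.map I.toLinearMap J.toLinearMap ψ =
      TensorProduct.tensorTensorTensorComm ℂ E F G H (ψ' ⊗ₜ aux)) {N : F' →L[ℂ] F'}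
    {N' : F →L[ℂ] F} (hN : TensorProduct.map I.toLinearMap J.toLinearMap (N.lTensor E' ψ) =
      TensorProduct.tensorTensorTensorComm ℂ E F G H (N'.lTensor E ψ' ⊗ₜ aux)) :
    (J.toContinuousLinearMap ∘L N).lTensor E' ψ =
      (N'.rTensor H ∘L J.toContinuousLinearMap).lTensor E' ψ := by
  refine (I.rTensor (F ⊗[ℂ] H)).injective ?_
  have h2 := tensorTensorTensorComm_rTensor (G := G) (H := H) (LinearMap.id : E →ₗ[ℂ] E)
    N'.toLinearMap (ψ' ⊗ₜ aux)
  rw [← hψ] at h2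
  have h3 : ∀ (P : F' →L[ℂ] F ⊗[ℂ] H), I.rTensor (F ⊗[ℂ] H) (P.lTensor E' ψ) =
      TensorProduct.map I.toLinearMap P.toLinearMap ψ := fun P => by
    rw [LinearIsometry.rTensor_apply, ContinuousLinearMap.lTensor_apply]
    exact LinearMap.congr_fun (LinearMap.rTensor_comp_lTensor _ _ _) ψ
  rw [h3, h3]
  have h4 : TensorProduct.map I.toLinearMap J.toLinearMap (N.lTensor E' ψ) =
      TensorProduct.map I.toLinearMap (J.toContinuousLinearMap ∘L N).toLinearMap ψ := by
    rw [ContinuousLinearMap.lTensor_apply]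
    exact LinearMap.congr_fun (LinearMap.map_comp_lTensor _ _ _ _) ψ
  have h5 : TensorProduct.map ((LinearMap.id : E →ₗ[ℂ] E).rTensor G) (N'.toLinearMap.rTensor H)
      (TensorProduct.map I.toLinearMap J.toLinearMap ψ) =
      TensorProduct.map I.toLinearMap (N'.rTensor H ∘L J.toContinuousLinearMap).toLinearMap ψ := by
    rw [LinearMap.rTensor_id]
    exact LinearMap.congr_fun (TensorProduct.map_comp _ _ _ _).symm ψ
  rw [← h4, hN, ← h5, ← h2, ContinuousLinearMap.lTensor_apply]
  rfl

theorem comp_mapL_eq_of_dilation {E' F' : Type*} [NormedAddCommGroup E'] [InnerProductSpace ℂ E']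
    [NormedAddCommGroup F'] [InnerProductSpace ℂ F'] {I : E' →ₗᵢ[ℂ] E ⊗[ℂ] G}
    {J : F' →ₗᵢ[ℂ] F ⊗[ℂ] H} {W : E' ⊗[ℂ] F' →L[ℂ] (E ⊗[ℂ] F) ⊗[ℂ] (G ⊗[ℂ] H)}
    (hW : ∀ v, TensorProduct.tensorTensorTensorComm ℂ E F G H (W v) =
      TensorProduct.map I.toLinearMap J.toLinearMap v) {M : E' →L[ℂ] E'} {N : F' →L[ℂ] F'}
    {M' : E →L[ℂ] E} {N' : F →L[ℂ] F}
    (hM : I.toContinuousLinearMap ∘L M = M'.rTensor G ∘L I.toContinuousLinearMap)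
    (hN : J.toContinuousLinearMap ∘L N = N'.rTensor H ∘L J.toContinuousLinearMap) :
    W ∘L TensorProduct.mapL M N = (TensorProduct.mapL M' N').rTensor (G ⊗[ℂ] H) ∘L W := by
  refine ContinuousLinearMap.ext fun v =>
    (TensorProduct.tensorTensorTensorComm ℂ E F G H).injective ?_
  have h2 := tensorTensorTensorComm_rTensor (G := G) (H := H) M'.toLinearMap N'.toLinearMap (W v)
  rw [ContinuousLinearMap.comp_apply, ContinuousLinearMap.comp_apply, hW,
    ContinuousLinearMap.rTensor_apply, TensorProduct.toLinearMap_mapL, h2, hW,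
    TensorProduct.mapL_apply]
  have h3 : I.toLinearMap ∘ₗ M.toLinearMap = M'.toLinearMap.rTensor G ∘ₗ I.toLinearMap :=
    congrArg ContinuousLinearMap.toLinearMap hM
  have h4 : J.toLinearMap ∘ₗ N.toLinearMap = N'.toLinearMap.rTensor H ∘ₗ J.toLinearMap :=
    congrArg ContinuousLinearMap.toLinearMap hN
  rw [← LinearMap.comp_apply, ← LinearMap.comp_apply, ← TensorProduct.map_comp,
    ← TensorProduct.map_comp, h3, h4]

end Tensor

namespace QuantumModel

variable {X Y A B : Type*} [Fintype A] [Fintype B]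

theorem sum_vec_right (S : QuantumModel X Y A B) (x : X) (y : Y) (a : A) :
    ∑ b, S.vec x y a b = (S.M.op x a).rTensor S.N.H S.ψ := by
  conv_rhs => rw [← S.N.sum_lTensor S.M.H y S.ψ, map_sum]
  simp only [rTensor_lTensor_apply]
  rfl

theorem sum_vec_left (S : QuantumModel X Y A B) (x : X) (y : Y) (b : B) :
    ∑ a, S.vec x y a b = (S.N.op y b).lTensor S.M.H S.ψ := by
  conv_rhs => rw [← S.M.sum_rTensor S.N.H x S.ψ, map_sum]
  simp only [lTensor_rTensor_apply]
  rfl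

theorem sum_sum_vec (S : QuantumModel X Y A B) (x : X) (y : Y) :
    ∑ a, ∑ b, S.vec x y a b = S.ψ := by
  simp only [sum_vec_right]
  exact S.M.sum_rTensor S.N.H x S.ψ

/-- A full-rank model defines the same state as its local dilations. -/
theorem FullRank.state_eq_of_locallyDilatesTo [Nonempty X] [Nonempty Y]
    {S S' : QuantumModel X Y A B} (hS : S.FullRank) (h : S.LocallyDilatesTo S') :
    S.state = S'.state := by
  obtain ⟨KA, KB, _, _, _, _, _, _, aux, IA, IB, haux, h⟩ := h
  have : CompleteSpace KA := FiniteDimensional.complete ℂ KA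
  have : CompleteSpace KB := FiniteDimensional.complete ℂ KB
  obtain ⟨x₀⟩ := ‹Nonempty X›
  obtain ⟨y₀⟩ := ‹Nonempty Y›
  -- Summing the dilation identities over all outcomes of one pair of questions removes the
  -- measurement operators; summing over one party's outcomes below leaves the other's.
  have hψ : TensorProduct.map IA.toLinearMap IB.toLinearMap S.ψ =
      TensorProduct.tensorTensorTensorComm ℂ S'.M.H S'.N.H KA KB (S'.ψ ⊗ₜ aux) := by
    rw [← S.sum_sum_vec x₀ y₀, ← S'.sum_sum_vec x₀ y₀]
    simp only [map_sum, TensorProduct.sum_tmul, h]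
  -- Full rank enters here: an identity on `ψ` becomes an identity of operators.
  have hM : ∀ x a, IA.toContinuousLinearMap ∘L S.M.op x a =
      (S'.M.op x a).rTensor KA ∘L IA.toContinuousLinearMap := fun x a => by
    refine hS.left_ext (E := S'.M.H ⊗[ℂ] KA) (rTensor_eq_of_dilation IA IB hψ ?_)
    rw [← S.sum_vec_right x y₀, ← S'.sum_vec_right x y₀]
    simp only [map_sum, TensorProduct.sum_tmul, h]
  have hN : ∀ y b, IB.toContinuousLinearMap ∘L S.N.op y b =
      (S'.N.op y b).rTensor KB ∘L IB.toContinuousLinearMap := fun y b => by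
    refine hS.right_ext (E := S'.N.H ⊗[ℂ] KB) (lTensor_eq_of_dilation IA IB hψ ?_)
    rw [← S.sum_vec_left x₀ y, ← S'.sum_vec_left x₀ y]
    simp only [map_sum, TensorProduct.sum_tmul, h]
  obtain ⟨W, hWi, hW⟩ := exists_reordered_isometry IA IB
  have hWψ : W S.ψ = S'.ψ ⊗ₜ aux := (TensorProduct.tensorTensorTensorComm ℂ _ _ _ _).injective
    (by rw [hW, hψ])
  ext t
  refine (state_eq_of_intertwines S ((ampliation (S'.M.H ⊗[ℂ] S'.N.H) (KA ⊗[ℂ] KB)).comp S'.rep)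
    W hWi (fun x y a b => ?_) t).trans ?_
  · refine (comp_mapL_eq_of_dilation hW (hM x a) (hN y b)).trans ?_
    rw [← rep_gen]; rfl
  · rw [hWψ]
    change ⟪S'.ψ ⊗ₜ[ℂ] aux, (S'.rep t S'.ψ) ⊗ₜ[ℂ] aux⟫_ℂ = _
    rw [TensorProduct.inner_tmul, inner_self_eq_norm_sq_to_K, haux, state_apply]
    simp

end QuantumModel

/-! ### Models with irreducible measurements -/

section Projection

variable {E : Type*} [NormedAddCommGroup E] [InnerProductSpace ℂ E] [CompleteSpace E]

/-- `T` is block diagonal for `P` and `1 - P`, so the cross terms vanish. -/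
theorem inner_apply_eq_add_of_commute {P T : E →L[ℂ] E} (hP : IsStarProjection P)
    (hPT : P * T = T * P) (v : E) :
    ⟪v, T v⟫_ℂ = ⟪P v, T (P v)⟫_ℂ + ⟪(1 - P) v, T ((1 - P) v)⟫_ℂ := by
  have hs : P.adjoint = P := hP.isSelfAdjoint
  have hcomm : ∀ w, P (T w) = T (P w) := fun w => congrArg (fun R : E →L[ℂ] E => R w) hPT
  have hid : ∀ w, P (P w) = P w := fun w =>
    congrArg (fun R : E →L[ℂ] E => R w) hP.isIdempotentElem
  have hmove : ∀ u w, ⟪P u, w⟫_ℂ = ⟪u, P w⟫_ℂ := fun u w => by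
    rw [← ContinuousLinearMap.adjoint_inner_right, hs]
  simp only [sub_apply, one_apply_eq_self, inner_sub_left, map_sub, inner_sub_right, hmove, hcomm,
    hid]
  ring

/-- The kernel projection of a non-scalar operator in the commutant of a family of self-adjoint
operators is a non-trivial projection in the commutant. -/
theorem exists_isStarProjection_of_not_scalar [FiniteDimensional ℂ E] [Nontrivial E] {ι : Type*}
    {M : ι → E →L[ℂ] E} (hM : ∀ i, star (M i) = M i) {T : E →L[ℂ] E}
    (hT : ∀ i, T * M i = M i * T) (hTs : ∀ c : ℂ, T ≠ c • 1) :
    ∃ P : E →L[ℂ] E, IsStarProjection P ∧ P ≠ 0 ∧ P ≠ 1 ∧ ∀ i, P * M i = M i * P := by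
  -- The projection is onto the eigenspace `ker (T - c)`. Since `T` need not be normal, only
  -- invariance of this subspace under the `M i` comes directly from commutation.
  obtain ⟨c, hc⟩ := Module.End.exists_eigenvalue (T : E →ₗ[ℂ] E)
  obtain ⟨v, hv, hv0⟩ := hc.exists_hasEigenvector
  have hmem : ∀ w, w ∈ Module.End.eigenspace (T : E →ₗ[ℂ] E) c ↔ T w = c • w := fun w =>
    Module.End.mem_eigenspace_iff
  set V := Module.End.eigenspace (T : E →ₗ[ℂ] E) c with hV
  have hfix : ∀ w, w ∈ V → V.starProjection w = w := fun w hw =>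
    Submodule.starProjection_eq_self_iff.2 hw
  refine ⟨V.starProjection, isStarProjection_starProjection, fun h => hv0 ?_, fun h => hTs c ?_,
    fun i => ?_⟩
  · rw [← hfix v hv, h, zero_apply]
  · ext w
    have hw : w ∈ V := by
      have := V.starProjection_apply_mem w
      rwa [h, one_apply_eq_self] at this
    rw [(hmem w).1 hw]; simp
  · have h1 : V.starProjection * (M i * V.starProjection) = M i * V.starProjection := by
      ext w
      refine hfix _ ((hmem _).2 ?_)
      have h2 : ∀ u, T (M i u) = M i (T u) := fun u => congrArg (fun R : E →L[ℂ] E => R u) (hT i)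
      change T (M i (V.starProjection w)) = c • M i (V.starProjection w)
      rw [h2, (hmem _).1 (V.starProjection_apply_mem w), map_smul]
    have hs : star V.starProjection = V.starProjection :=
      isStarProjection_starProjection.isSelfAdjoint
    have h2 := congrArg star h1
    rw [star_mul, star_mul, hM, hs, mul_assoc, h1] at h2
    exact h2.symm

end Projection

/-- The measurement operators have trivial commutant. -/
def POVMFamily.IsIrreducible {X A : Type*} [Fintype A] (M : POVMFamily X A) : Prop :=
  ∀ T : M.H →L[ℂ] M.H, (∀ x a, T * M.op x a = M.op x a * T) → ∃ c : ℂ, T = c • 1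

theorem POVMFamily.exists_isStarProjection {X A : Type*} [Fintype A] {M : POVMFamily X A}
    [FiniteDimensional ℂ M.H] (hM : ¬M.IsIrreducible) :
    ∃ P : M.H →L[ℂ] M.H, IsStarProjection P ∧ P ≠ 0 ∧ P ≠ 1 ∧
      ∀ x a, P * M.op x a = M.op x a * P := by
  rw [IsIrreducible] at hM
  push Not at hM
  obtain ⟨T, hT, hTs⟩ := hM
  obtain ⟨P, h1, h2, h3, h4⟩ := exists_isStarProjection_of_not_scalar
    (M := fun i : X × A => M.op i.1 i.2) (fun i => (M.isPositive i.1 i.2).isSelfAdjoint)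
    (fun i => hT i.1 i.2) hTs
  exact ⟨P, h1, h2, h3, fun x a => h4 (x, a)⟩

namespace QuantumModel

variable {X Y A B : Type*} [Fintype A] [Fintype B]

/-- Replace the vector state. -/
def replaceState (S : QuantumModel X Y A B) (φ : S.M.H ⊗[ℂ] S.N.H) (hφ : ‖φ‖ = 1) :
    QuantumModel X Y A B where
  M := S.M
  N := S.N
  finite_left := S.finite_left
  finite_right := S.finite_right
  ψ := φ
  norm_ψ := hφ

theorem norm_normalize {E : Type*} [NormedAddCommGroup E] [InnerProductSpace ℂ E] {v : E}
    (hv : v ≠ 0) : ‖((‖v‖⁻¹ : ℝ) : ℂ) • v‖ = 1 := by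
  rw [norm_smul, Complex.norm_real, norm_inv, norm_norm, inv_mul_cancel₀ (norm_ne_zero_iff.2 hv)]

theorem inner_normalize {E : Type*} [NormedAddCommGroup E] [InnerProductSpace ℂ E] {v : E}
    (hv : v ≠ 0) (T : E →L[ℂ] E) :
    ((‖v‖ ^ 2 : ℝ) : ℂ) * ⟪((‖v‖⁻¹ : ℝ) : ℂ) • v, T (((‖v‖⁻¹ : ℝ) : ℂ) • v)⟫_ℂ = ⟪v, T v⟫_ℂ := by
  have h : (‖v‖ : ℂ) ≠ 0 := by exact_mod_cast norm_ne_zero_iff.2 hv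
  rw [map_smul, inner_smul_left, inner_smul_right, Complex.conj_ofReal]
  push_cast
  field_simp

/-- The vector state of a model for an extreme correlation can be replaced by its projection to
an invariant subspace. -/
theorem isModelFor_replaceState_of_extreme {p : X → Y → A → B → ℝ}
    (hext : p ∈ Set.extremePoints ℝ (Cq X Y A B)) {S : QuantumModel X Y A B}
    (hm : S.IsModelFor p) {P : S.M.H ⊗[ℂ] S.N.H →L[ℂ] S.M.H ⊗[ℂ] S.N.H}
    (hP : IsStarProjection P)
    (hcomm : ∀ x y a b, P * TensorProduct.mapL (S.M.op x a) (S.N.op y b) =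
      TensorProduct.mapL (S.M.op x a) (S.N.op y b) * P)
    (h0 : P S.ψ ≠ 0) (h1 : (1 - P) S.ψ ≠ 0) :
    (S.replaceState (((‖P S.ψ‖⁻¹ : ℝ) : ℂ) • P S.ψ)
      (norm_normalize (E := S.M.H ⊗[ℂ] S.N.H) h0)).IsModelFor p := by
  have hnorm : ((‖P S.ψ‖ ^ 2 : ℝ) : ℂ) + ((‖(1 - P) S.ψ‖ ^ 2 : ℝ) : ℂ) = 1 := by
    have h := inner_apply_eq_add_of_commute (E := S.M.H ⊗[ℂ] S.N.H) hP (T := 1)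
      (by rw [mul_one, one_mul]) S.ψ
    simp only [one_apply_eq_self] at h
    have h' : ∀ v : S.M.H ⊗[ℂ] S.N.H, ⟪v, v⟫_ℂ = ((‖v‖ ^ 2 : ℝ) : ℂ) := fun v =>
      (inner_self_eq_norm_sq_to_K (𝕜 := ℂ) (E := S.M.H ⊗[ℂ] S.N.H) v).trans
        (RCLike.ofReal_pow _ _).symm
    rw [h', h', h', S.norm_ψ] at h
    rw [← h]; simp
  have hnorm' : ‖P S.ψ‖ ^ 2 + ‖(1 - P) S.ψ‖ ^ 2 = 1 := by exact_mod_cast hnorm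
  have hpos : 0 < ‖P S.ψ‖ ^ 2 := by have := norm_pos_iff.2 h0; positivity
  have hpos' : 0 < ‖(1 - P) S.ψ‖ ^ 2 := by have := norm_pos_iff.2 h1; positivity
  -- `p` is the mixture of the correlations of the two normalised components of `ψ`, with weights
  -- `‖Pψ‖²` and `‖(1 - P)ψ‖²`.
  refine isModelFor_of_extreme hext _ (S.replaceState (((‖(1 - P) S.ψ‖⁻¹ : ℝ) : ℂ) • (1 - P) S.ψ)
    (norm_normalize (E := S.M.H ⊗[ℂ] S.N.H) h1)) hpos (by linarith) fun x y a b => ?_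
  have e0 := inner_normalize (E := S.M.H ⊗[ℂ] S.N.H) h0
    (TensorProduct.mapL (S.M.op x a) (S.N.op y b))
  have e1 := inner_normalize (E := S.M.H ⊗[ℂ] S.N.H) h1
    (TensorProduct.mapL (S.M.op x a) (S.N.op y b))
  rw [← hm x y a b]
  refine (inner_apply_eq_add_of_commute (E := S.M.H ⊗[ℂ] S.N.H) hP (hcomm x y a b) S.ψ).trans ?_
  rw [← eq_sub_iff_add_eq'] at hnorm
  rw [← hnorm]
  exact congrArg₂ _ e0.symm e1.symm

/-- Every extreme correlation has a full-rank model with irreducible measurements. -/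
theorem exists_irreducible_model {p : X → Y → A → B → ℝ}
    (hext : p ∈ Set.extremePoints ℝ (Cq X Y A B)) :
    ∃ S : QuantumModel X Y A B, S.IsModelFor p ∧ S.FullRank ∧ S.M.IsIrreducible ∧
      S.N.IsIrreducible := by
  obtain ⟨S, hS, hmin⟩ := exists_minimalFor_of_wellFoundedLT
    (fun S : QuantumModel X Y A B => S.IsModelFor p) dim hext.1
  -- Every model of the minimal dimension is full rank, not only `S`; this is needed for models
  -- obtained from `S` by changing the vector.
  have hfull : ∀ S' : QuantumModel X Y A B, S'.IsModelFor p → S'.dim = S.dim → S'.FullRank :=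
    fun S' hS' hdim => by
      by_contra h
      obtain ⟨S'', hc, hlt⟩ := exists_isCompression_dim_lt h
      have := hmin (hc.isModelFor hS') (by omega)
      omega
  have hSfull := hfull S hS rfl
  refine ⟨S, hS, hSfull, ?_, ?_⟩
  · by_contra h
    obtain ⟨P, hP, hP0, hP1, hPM⟩ := POVMFamily.exists_isStarProjection h
    have hsub : (1 - P).rTensor S.N.H = 1 - P.rTensor S.N.H := by
      rw [ContinuousLinearMap.rTensor_sub, ContinuousLinearMap.rTensor_one]
    have hPP : IsStarProjection (P.rTensor S.N.H) :=
      ⟨(ContinuousLinearMap.rTensor_mul S.N.H P P).symm.trans (by rw [hP.isIdempotentElem.eq]),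
        (ContinuousLinearMap.adjoint_rTensor S.N.H P).trans (by
          rw [← ContinuousLinearMap.star_eq_adjoint, hP.isSelfAdjoint.star_eq])⟩
    have h0 : P.rTensor S.N.H S.ψ ≠ 0 := fun h => hP0 (hSfull.1 P h)
    have h1 : (1 - P.rTensor S.N.H) S.ψ ≠ 0 := fun h =>
      hP1 (sub_eq_zero.1 (hSfull.1 (1 - P) (by rw [hsub, h]))).symm
    -- Projecting `ψ` by `P ⊗ 1` gives another model of `p` on the same spaces, whose vector is
    -- annihilated by `1 - P ≠ 0`, contradicting `hfull`.
    have hm := isModelFor_replaceState_of_extreme hext hS hPP (fun x y a b => by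
      rw [ContinuousLinearMap.rTensor_eq_mapL, ContinuousLinearMap.mul_def,
        ContinuousLinearMap.mul_def, ← TensorProduct.mapL_comp, ← TensorProduct.mapL_comp]
      congr 1
      exact hPM x a) h0 h1
    refine hP1 (sub_eq_zero.1 ((hfull _ hm rfl).1 (1 - P : S.M.H →L[ℂ] S.M.H) ?_)).symm
    change (1 - P).rTensor S.N.H (((‖P.rTensor S.N.H S.ψ‖⁻¹ : ℝ) : ℂ) • P.rTensor S.N.H S.ψ) = 0
    rw [map_smul, ← mul_apply_eq_comp, ← ContinuousLinearMap.rTensor_mul, sub_mul, one_mul,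
      hP.isIdempotentElem.eq, sub_self, ContinuousLinearMap.rTensor_zero, zero_apply, smul_zero]
  · by_contra h
    obtain ⟨P, hP, hP0, hP1, hPN⟩ := POVMFamily.exists_isStarProjection h
    have hsub : (1 - P).lTensor S.M.H = 1 - P.lTensor S.M.H := by
      rw [ContinuousLinearMap.lTensor_sub, ContinuousLinearMap.lTensor_one]
    have hPP : IsStarProjection (P.lTensor S.M.H) :=
      ⟨(ContinuousLinearMap.lTensor_mul S.M.H P P).symm.trans (by rw [hP.isIdempotentElem.eq]),
        (ContinuousLinearMap.adjoint_lTensor S.M.H P).trans (by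
          rw [← ContinuousLinearMap.star_eq_adjoint, hP.isSelfAdjoint.star_eq])⟩
    have h0 : P.lTensor S.M.H S.ψ ≠ 0 := fun h => hP0 (hSfull.2 P h)
    have h1 : (1 - P.lTensor S.M.H) S.ψ ≠ 0 := fun h =>
      hP1 (sub_eq_zero.1 (hSfull.2 (1 - P) (by rw [hsub, h]))).symm
    have hm := isModelFor_replaceState_of_extreme hext hS hPP (fun x y a b => by
      rw [ContinuousLinearMap.lTensor_eq_mapL, ContinuousLinearMap.mul_def,
        ContinuousLinearMap.mul_def, ← TensorProduct.mapL_comp, ← TensorProduct.mapL_comp]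
      congr 1
      exact hPN y b) h0 h1
    refine hP1 (sub_eq_zero.1 ((hfull _ hm rfl).2 (1 - P : S.N.H →L[ℂ] S.N.H) ?_)).symm
    change (1 - P).lTensor S.M.H (((‖P.lTensor S.M.H S.ψ‖⁻¹ : ℝ) : ℂ) • P.lTensor S.M.H S.ψ) = 0
    rw [map_smul, ← mul_apply_eq_comp, ← ContinuousLinearMap.lTensor_mul, sub_mul, one_mul,
      hP.isIdempotentElem.eq, sub_self, ContinuousLinearMap.lTensor_zero, zero_apply, smul_zero]

end QuantumModel

/-! ### Intertwiners -/

/-- The linear maps that intertwine two families of endomorphisms. -/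
def intertwiners {ι E G : Type*} [AddCommGroup E] [Module ℂ E] [AddCommGroup G] [Module ℂ G]
    (M : ι → E →ₗ[ℂ] E) (N : ι → G →ₗ[ℂ] G) : Submodule ℂ (E →ₗ[ℂ] G) where
  carrier := {T | ∀ i, T ∘ₗ M i = N i ∘ₗ T}
  add_mem' hS hT i := by rw [LinearMap.add_comp, LinearMap.comp_add, hS i, hT i]
  zero_mem' i := by rw [LinearMap.zero_comp, LinearMap.comp_zero]
  smul_mem' c T hT i := by rw [LinearMap.smul_comp, LinearMap.comp_smul, hT i]

section Tensor

variable {E F G H : Type*} [AddCommGroup E] [Module ℂ E] [AddCommGroup F] [Module ℂ F]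
  [AddCommGroup G] [Module ℂ G] [AddCommGroup H] [Module ℂ H]

theorem eq_sum_coord_tmul {κ : Type*} [Fintype κ] (b : Module.Basis κ ℂ H) (w : G ⊗[ℂ] H) :
    w = ∑ r, TensorProduct.rid ℂ G ((b.coord r).lTensor G w) ⊗ₜ[ℂ] b r := by
  induction w with
  | zero => simp
  | add w₁ w₂ h₁ h₂ =>
    simp only [map_add, TensorProduct.add_tmul, Finset.sum_add_distrib]
    rw [← h₁, ← h₂]
  | tmul g h =>
    simp only [LinearMap.lTensor_tmul, TensorProduct.rid_tmul, TensorProduct.smul_tmul]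
    rw [← TensorProduct.tmul_sum]
    congr 1
    exact (b.sum_repr h).symm

/-- A joint intertwiner of tensor product actions is a sum of tensor products of intertwiners. -/
theorem exists_sum_map_of_intertwines {ι κ : Type*} [FiniteDimensional ℂ E]
    [FiniteDimensional ℂ G] [FiniteDimensional ℂ H]
    {M' : ι → E →ₗ[ℂ] E} {M : ι → G →ₗ[ℂ] G} {N' : κ → F →ₗ[ℂ] F} {N : κ → H →ₗ[ℂ] H}
    (U : E ⊗[ℂ] F →ₗ[ℂ] G ⊗[ℂ] H)
    (hM : ∀ i v, U ((M' i).rTensor F v) = (M i).rTensor H (U v))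
    (hN : ∀ j v, U ((N' j).lTensor E v) = (N j).lTensor G (U v)) :
    ∃ (n : ℕ) (T : Fin n → intertwiners M' M) (S : Fin n → intertwiners N' N),
      ∀ e f, U (e ⊗ₜ f) = ∑ i, (T i).1 e ⊗ₜ (S i).1 f := by
  let b := Module.finBasis ℂ H
  let t := Module.finBasis ℂ (intertwiners M' M)
  have hcoe : ∀ (c : Fin _ → ℂ) (e : E), (∑ i, c i • t i).1 e = ∑ i, c i • (t i).1 e :=
    fun c e => by
      rw [AddSubmonoidClass.coe_finsetSum, LinearMap.sum_apply]
      rfl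
  -- Fixing `f` and taking the `r`-th coordinate in `H` turns `U` into a map `E → G`. These slices
  -- intertwine `M'` and `M`, since the coordinate acts on the other factor.
  let L := fun r => (TensorProduct.rid ℂ G).toLinearMap ∘ₗ (b.coord r).lTensor G
  have hL : ∀ r i w, L r ((M i).rTensor H w) = M i (L r w) := fun r i w => by
    refine LinearMap.congr_fun (f := L r ∘ₗ (M i).rTensor H) (g := M i ∘ₗ L r) ?_ w
    ext g h
    simp [L]
  let slice : Fin _ → F →ₗ[ℂ] (E →ₗ[ℂ] G) := fun r =>
    ((TensorProduct.mk ℂ E F).compr₂ (L r ∘ₗ U)).flip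
  have hslice : ∀ r f e, slice r f e = L r (U (e ⊗ₜ f)) := fun r f e => rfl
  have hmem : ∀ r f, slice r f ∈ intertwiners M' M := fun r f i => by
    ext e
    rw [LinearMap.comp_apply, LinearMap.comp_apply, hslice, hslice, ← hL, ← hM]
    rfl
  let sl : Fin _ → F →ₗ[ℂ] intertwiners M' M := fun r =>
    (slice r).codRestrict (intertwiners M' M) (hmem r)
  -- `S i` gathers the coefficients of `t i` in all the slices.
  let S : Fin _ → F →ₗ[ℂ] H := fun i => ∑ r, (t.coord i ∘ₗ sl r).smulRight (b r)
  have hU : ∀ e f, U (e ⊗ₜ f) = ∑ i, (t i).1 e ⊗ₜ S i f := fun e f => by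
    have h1 : ∀ r, L r (U (e ⊗ₜ f)) = ∑ i, t.coord i (sl r f) • (t i).1 e := fun r => by
      have h2 := congrArg (fun T : intertwiners M' M => T.1 e) (t.sum_repr (sl r f))
      rw [← hslice]
      exact h2.symm.trans (hcoe _ e)
    conv_lhs => rw [eq_sum_coord_tmul b (U (e ⊗ₜ f))]
    change ∑ r, L r (U (e ⊗ₜ f)) ⊗ₜ b r = _
    simp only [h1, S, TensorProduct.sum_tmul, LinearMap.sum_apply, TensorProduct.tmul_sum]
    rw [Finset.sum_comm]
    refine Finset.sum_congr rfl fun i _ => Finset.sum_congr rfl fun r _ => ?_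
    rw [TensorProduct.smul_tmul]
    rfl
  refine ⟨_, t, fun i => ⟨S i, fun j => ?_⟩, hU⟩
  ext f
  rw [LinearMap.comp_apply, LinearMap.comp_apply, ← sub_eq_zero]
  have h0 : ∀ e, ∑ i, (t i).1 e ⊗ₜ[ℂ] (S i (N' j f) - N j (S i f)) = 0 := fun e => by
    have h1 := hN j (e ⊗ₜ f)
    rw [LinearMap.lTensor_tmul, hU, hU, map_sum] at h1
    simp only [TensorProduct.tmul_sub, Finset.sum_sub_distrib, LinearMap.lTensor_tmul] at h1 ⊢
    rw [h1, sub_self]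
  -- Pairing `h0` with a functional on `H` leaves a linear relation among the basis elements `t i`,
  -- so independence shows that each `S i` intertwines.
  refine (Module.forall_dual_apply_eq_zero_iff ℂ _).1 fun φ => ?_
  have h1 : ∑ i, φ (S i (N' j f) - N j (S i f)) • t i = 0 := by
    refine Subtype.ext (LinearMap.ext fun e => ?_)
    have h2 := congrArg (fun w => TensorProduct.rid ℂ G (φ.lTensor G w)) (h0 e)
    simp only [map_sum, LinearMap.lTensor_tmul, TensorProduct.rid_tmul, map_zero] at h2
    exact (hcoe _ e).trans h2
  exact Fintype.linearIndependent_iff.1 t.linearIndependent _ h1 i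

end Tensor

/-! ### Schur's lemma and multiplicity spaces -/

section Irreducible

theorem tensor_inner_add_left {E F : Type*} [NormedAddCommGroup E] [InnerProductSpace ℂ E]
    [NormedAddCommGroup F] [InnerProductSpace ℂ F] (u v w : E ⊗[ℂ] F) :
    ⟪u + v, w⟫_ℂ = ⟪u, w⟫_ℂ + ⟪v, w⟫_ℂ :=
  inner_add_left (E := E ⊗[ℂ] F) u v w

theorem tensor_inner_sum_left {E F κ : Type*} [NormedAddCommGroup E] [InnerProductSpace ℂ E]
    [NormedAddCommGroup F] [InnerProductSpace ℂ F] (s : Finset κ) (f : κ → E ⊗[ℂ] F)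
    (w : E ⊗[ℂ] F) : ⟪∑ i ∈ s, f i, w⟫_ℂ = ∑ i ∈ s, ⟪f i, w⟫_ℂ :=
  sum_inner (E := E ⊗[ℂ] F) s f w

theorem tensor_inner_sum_right {E F κ : Type*} [NormedAddCommGroup E] [InnerProductSpace ℂ E]
    [NormedAddCommGroup F] [InnerProductSpace ℂ F] (s : Finset κ) (f : κ → E ⊗[ℂ] F)
    (w : E ⊗[ℂ] F) : ⟪w, ∑ i ∈ s, f i⟫_ℂ = ∑ i ∈ s, ⟪w, f i⟫_ℂ :=
  inner_sum (E := E ⊗[ℂ] F) s f w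

/-- Supplies an auxiliary space: the `ε i` label the copies of an irreducible family found in `G`,
and `δ` leaves orthogonal room for the rest of `G`. -/
theorem exists_orthogonal_sum (G : Type) [NormedAddCommGroup G] [InnerProductSpace ℂ G]
    [FiniteDimensional ℂ G] (n : ℕ) :
    ∃ (K : Type) (_ : NormedAddCommGroup K) (_ : InnerProductSpace ℂ K)
      (_ : FiniteDimensional ℂ K) (ε : Fin n → K) (δ : G →ₗ[ℂ] K),
      (∀ i j, ⟪ε i, ε j⟫_ℂ = if i = j then 1 else 0) ∧ (∀ i g, ⟪ε i, δ g⟫_ℂ = 0) ∧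
        ∀ g g', ⟪δ g, δ g'⟫_ℂ = ⟪g, g'⟫_ℂ := by
  refine ⟨WithLp 2 (EuclideanSpace ℂ (Fin n) × G), inferInstance, inferInstance, inferInstance,
    fun i => WithLp.toLp 2 (EuclideanSpace.single i 1, 0),
    (WithLp.linearEquiv 2 ℂ (EuclideanSpace ℂ (Fin n) × G)).symm.toLinearMap ∘ₗ
      LinearMap.inr ℂ _ _, fun i j => ?_, fun i g => ?_, fun g g' => ?_⟩
  · have h := orthonormal_iff_ite.1 (EuclideanSpace.orthonormal_single (𝕜 := ℂ) (ι := Fin n)) i j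
    simpa [WithLp.prod_inner_apply] using h
  · simp [WithLp.prod_inner_apply]
  · simp [WithLp.prod_inner_apply]

variable {ι : Type*} {E G : Type} [NormedAddCommGroup E] [InnerProductSpace ℂ E]
  [FiniteDimensional ℂ E] [NormedAddCommGroup G] [InnerProductSpace ℂ G] [FiniteDimensional ℂ G]

/-- Schur: `S†T` commutes with the irreducible family, hence is a scalar, read off at the unit
vector `v₀`. -/
theorem adjoint_apply_of_mem_intertwiners {M' : ι → E →ₗ[ℂ] E} {M : ι → G →ₗ[ℂ] G}
    (hM' : ∀ i, (M' i).adjoint = M' i) (hM : ∀ i, (M i).adjoint = M i)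
    (hirr : ∀ S : E →ₗ[ℂ] E, (∀ i, S ∘ₗ M' i = M' i ∘ₗ S) → ∃ c : ℂ, S = c • LinearMap.id)
    {v₀ : E} (hv₀ : ‖v₀‖ = 1) {S T : E →ₗ[ℂ] G} (hS : S ∈ intertwiners M' M)
    (hT : T ∈ intertwiners M' M) (v : E) : S.adjoint (T v) = ⟪S v₀, T v₀⟫_ℂ • v := by
  have hS' : ∀ i, M' i ∘ₗ S.adjoint = S.adjoint ∘ₗ M i := fun i => by
    have := congrArg LinearMap.adjoint (hS i)
    rwa [LinearMap.adjoint_comp, LinearMap.adjoint_comp, hM', hM] at this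
  obtain ⟨c, hc⟩ := hirr (S.adjoint ∘ₗ T) fun i => by
    rw [LinearMap.comp_assoc, hT i, ← LinearMap.comp_assoc, ← hS', LinearMap.comp_assoc]
  have hcv : ∀ v, S.adjoint (T v) = c • v := fun v => LinearMap.congr_fun hc v
  rw [hcv, ← LinearMap.adjoint_inner_right, hcv, inner_smul_right, inner_self_eq_norm_sq_to_K,
    hv₀]
  simp

/-- The multiplicity space of an irreducible family of self-adjoint operators on `E` in a family
on `G`. -/
theorem exists_isometry_apply_eq_tmul [Nontrivial E] {M' : ι → E →ₗ[ℂ] E} {M : ι → G →ₗ[ℂ] G}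
    (hM' : ∀ i, (M' i).adjoint = M' i) (hM : ∀ i, (M i).adjoint = M i)
    (hirr : ∀ S : E →ₗ[ℂ] E, (∀ i, S ∘ₗ M' i = M' i ∘ₗ S) → ∃ c : ℂ, S = c • LinearMap.id) :
    ∃ (K : Type) (_ : NormedAddCommGroup K) (_ : InnerProductSpace ℂ K)
      (_ : FiniteDimensional ℂ K) (I : G →ₗᵢ[ℂ] E ⊗[ℂ] K),
      ∀ T ∈ intertwiners M' M, ∃ k, ∀ v, I (T v) = v ⊗ₜ k := by
  obtain ⟨w, hw⟩ := exists_ne (0 : E)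
  obtain ⟨v₀, hv₀⟩ : ∃ v₀ : E, ‖v₀‖ = 1 := ⟨_, QuantumModel.norm_normalize hw⟩
  have hadj : ∀ {S T : E →ₗ[ℂ] G}, S ∈ intertwiners M' M → T ∈ intertwiners M' M →
      ∀ v, S.adjoint (T v) = ⟪S v₀, T v₀⟫_ℂ • v := fun hS hT v =>
    adjoint_apply_of_mem_intertwiners hM' hM hirr hv₀ hS hT v
  have hzero : ∀ T ∈ intertwiners M' M, T v₀ = 0 → T = 0 := fun T hT h0 => by
    ext v
    rw [LinearMap.zero_apply, ← inner_self_eq_zero (𝕜 := ℂ), ← LinearMap.adjoint_inner_right,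
      hadj hT hT, h0, inner_zero_left, zero_smul, inner_zero_right]
  -- By Schur, evaluation at `v₀` is injective on intertwiners, and orthonormal values lift to
  -- intertwiners with `t_i† t_j = δ_ij`: isometries with mutually orthogonal ranges.
  let b := stdOrthonormalBasis ℂ ((intertwiners M' M).map (LinearMap.applyₗ v₀))
  have hb : ∀ i, ∃ t ∈ intertwiners M' M, t v₀ = b i := fun i => (b i).2
  choose t ht htb using hb
  have htt : ∀ i j v, (t i).adjoint (t j v) = (if i = j then (1 : ℂ) else 0) • v :=
    fun i j v => by
      rw [hadj (ht i) (ht j), htb, htb]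
      exact congrArg (· • v) (orthonormal_iff_ite.1 b.orthonormal i j)
  have hexp : ∀ T ∈ intertwiners M' M, ∃ c : Fin _ → ℂ, T = ∑ i, c i • t i := fun T hT => by
    refine ⟨fun i => b.repr ⟨T v₀, ⟨T, hT, rfl⟩⟩ i, ?_⟩
    rw [← sub_eq_zero]
    refine hzero _ (sub_mem hT (sum_mem fun i _ => Submodule.smul_mem _ _ (ht i))) ?_
    have h1 := congrArg (Submodule.subtype _) (b.sum_repr ⟨T v₀, ⟨T, hT, rfl⟩⟩)
    rw [map_sum] at h1
    rw [LinearMap.sub_apply, LinearMap.sum_apply, sub_eq_zero]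
    refine h1.symm.trans (Finset.sum_congr rfl fun i _ => ?_)
    rw [map_smul, LinearMap.smul_apply, htb]
    rfl
  obtain ⟨K, _, _, _, ε, δ, hε, hεδ, hδ⟩ := exists_orthogonal_sum G (Module.finrank ℂ
    ((intertwiners M' M).map (LinearMap.applyₗ (R := ℂ) (M₂ := G) v₀)))
  have hδε : ∀ i g, ⟪δ g, ε i⟫_ℂ = 0 := fun i g => by
    rw [← inner_conj_symm, hεδ, map_zero]
  -- The projection onto the part of `G` orthogonal to all the copies of `E`.
  let Q : G →ₗ[ℂ] G := LinearMap.id - ∑ i, t i ∘ₗ (t i).adjoint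
  have hQ : ∀ g, Q g = g - ∑ i, t i ((t i).adjoint g) := fun g => by
    simp [Q, LinearMap.sum_apply]
  have htQ : ∀ i g, (t i).adjoint (Q g) = 0 := fun i g => by
    rw [hQ, map_sub, map_sum]
    simp [htt]
  have hQt : ∀ i v, Q (t i v) = 0 := fun i v => by
    rw [hQ, Finset.sum_eq_single i (fun j _ hj => by rw [htt, if_neg hj, zero_smul, map_zero])
      (by simp), htt, if_pos rfl, one_smul, sub_self]
  have hQQ : ∀ g g', ⟪Q g, Q g'⟫_ℂ = ⟪g, g'⟫_ℂ - ∑ i, ⟪(t i).adjoint g, (t i).adjoint g'⟫_ℂ :=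
    fun g g' => by
      conv_lhs => rw [hQ g]
      rw [inner_sub_left, sum_inner]
      simp only [← LinearMap.adjoint_inner_right (t _), htQ, inner_zero_right,
        Finset.sum_const_zero, sub_zero]
      rw [hQ, inner_sub_right, inner_sum]
      simp only [LinearMap.adjoint_inner_left]
  -- The `i`-th copy of `E` goes to `E ⊗ ε_i`. The remainder only has to be embedded isometrically,
  -- so it is placed next to the fixed vector `v₀`, orthogonally to all of these.
  let J : G →ₗ[ℂ] E ⊗[ℂ] K := ∑ i, ((TensorProduct.mk ℂ E K).flip (ε i)) ∘ₗ (t i).adjoint +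
    TensorProduct.mk ℂ E K v₀ ∘ₗ δ ∘ₗ Q
  have hJ : ∀ g, J g = ∑ i, (t i).adjoint g ⊗ₜ ε i + v₀ ⊗ₜ δ (Q g) := fun g => by
    simp [J, LinearMap.sum_apply]
  have hJi : ∀ g g', ⟪J g, J g'⟫_ℂ = ⟪g, g'⟫_ℂ := fun g g' => by
    rw [hJ, hJ]
    simp only [tensor_inner_add_left, tensor_inner_add_right, tensor_inner_sum_left,
      tensor_inner_sum_right, TensorProduct.inner_tmul, hε, hεδ, hδε, hδ, hQQ,
      inner_self_eq_norm_sq_to_K v₀, hv₀]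
    simp
  refine ⟨K, inferInstance, inferInstance, inferInstance, J.isometryOfInner hJi, fun T hT => ?_⟩
  obtain ⟨c, rfl⟩ := hexp T hT
  refine ⟨∑ i, c i • ε i, fun v => ?_⟩
  change J _ = _
  rw [LinearMap.sum_apply, map_sum, TensorProduct.tmul_sum]
  refine Finset.sum_congr rfl fun j _ => ?_
  rw [LinearMap.smul_apply, map_smul, hJ, hQt, map_zero, TensorProduct.tmul_zero, add_zero,
    TensorProduct.tmul_smul]
  simp [htt, ite_smul, TensorProduct.ite_tmul]

end Irreducible

/-! ### Local dilations to irreducible models -/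

/-- Representations with vectors that define the same state are intertwined by an operator that
maps one vector to the other. -/
theorem exists_intertwiner_of_inner_eq {𝒜 E F : Type*} [Ring 𝒜] [StarRing 𝒜] [Algebra ℂ 𝒜]
    [NormedAddCommGroup E] [InnerProductSpace ℂ E]
    [FiniteDimensional ℂ E] [CompleteSpace E] [NormedAddCommGroup F] [InnerProductSpace ℂ F]
    [CompleteSpace F] (ρ : 𝒜 →⋆ₐ[ℂ] (E →L[ℂ] E)) (σ : 𝒜 →⋆ₐ[ℂ] (F →L[ℂ] F)) (v : E) (w : F)
    (h : ∀ t, ⟪v, ρ t v⟫_ℂ = ⟪w, σ t w⟫_ℂ) :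
    ∃ U : E →ₗ[ℂ] F, U v = w ∧ ∀ t u, U (ρ t u) = σ t (U u) := by
  let L : 𝒜 →ₗ[ℂ] E :=
    { toFun := fun t => ρ t v
      map_add' := fun s t => by rw [map_add, add_apply]
      map_smul' := fun c t => by rw [map_smul, smul_apply, RingHom.id_apply] }
  let L' : 𝒜 →ₗ[ℂ] F :=
    { toFun := fun t => σ t w
      map_add' := fun s t => by rw [map_add, add_apply]
      map_smul' := fun c t => by rw [map_smul, smul_apply, RingHom.id_apply] }
  -- Equality of the states at `t* t` says `‖ρ(t)v‖ = ‖σ(t)w‖`, so `ρ(t)v ↦ σ(t)w` is well defined.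
  have hker : LinearMap.ker L ≤ LinearMap.ker L' := fun t ht => by
    have ht' : ρ t v = 0 := ht
    have h1 := h (star t * t)
    rw [map_mul, map_mul, map_star, map_star, mul_apply_eq_comp, mul_apply_eq_comp, ht', map_zero,
      inner_zero_right, ContinuousLinearMap.star_eq_adjoint,
      ContinuousLinearMap.adjoint_inner_right] at h1
    exact inner_self_eq_zero.1 h1.symm
  let R := LinearMap.range L
  let U₀ : R →ₗ[ℂ] F :=
    (LinearMap.ker L).liftQ L' hker ∘ₗ L.quotKerEquivRange.symm.toLinearMap
  have hU₀ : ∀ t, U₀ ⟨ρ t v, ⟨t, rfl⟩⟩ = σ t w := fun t => by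
    have h1 : L.quotKerEquivRange.symm ⟨ρ t v, ⟨t, rfl⟩⟩ = Submodule.Quotient.mk t := by
      rw [LinearEquiv.symm_apply_eq]
      rfl
    change (LinearMap.ker L).liftQ L' hker (L.quotKerEquivRange.symm ⟨ρ t v, ⟨t, rfl⟩⟩) = _
    rw [h1]
    rfl
  have hinv : ∀ t u, u ∈ R → ρ t u ∈ R := by
    rintro t _ ⟨s, rfl⟩
    exact ⟨t * s, by change ρ (t * s) v = ρ t (ρ s v); rw [map_mul]; rfl⟩
  -- Extension by zero off the cyclic subspace still intertwines, because the complement of an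
  -- invariant subspace is invariant for a `*`-representation.
  let U : E →ₗ[ℂ] F := U₀ ∘ₗ (R.orthogonalProjectionOnto : E →L[ℂ] R).toLinearMap
  have hU : ∀ t, U (ρ t v) = σ t w := fun t => by
    rw [← hU₀]
    exact congrArg U₀ (R.orthogonalProjectionOnto_mem_subspace_eq_self ⟨ρ t v, ⟨t, rfl⟩⟩)
  have hU' : ∀ u ∈ Rᗮ, U u = 0 := fun u hu =>
    (congrArg U₀ (Submodule.orthogonalProjectionOnto_apply_of_mem_orthogonal hu)).trans
      (map_zero U₀)
  refine ⟨U, ?_, fun t u => ?_⟩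
  · have := hU 1
    rwa [map_one, map_one, one_apply_eq_self, one_apply_eq_self] at this
  · obtain ⟨a, ⟨s, rfl⟩, b, hb, rfl⟩ := R.exists_add_mem_mem_orthogonal u
    have hb' : ρ t b ∈ Rᗮ := (Submodule.mem_orthogonal _ _).2 fun c hc => by
      rw [← ContinuousLinearMap.adjoint_inner_left, ← ContinuousLinearMap.star_eq_adjoint,
        ← map_star]
      exact (Submodule.mem_orthogonal _ _).1 hb _ (hinv _ _ hc)
    rw [map_add, map_add, map_add, hU' _ hb', hU' _ hb, add_zero, add_zero]
    change U (ρ t (ρ s v)) = σ t (U (ρ s v))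
    rw [hU, ← mul_apply_eq_comp, ← map_mul, hU, map_mul, mul_apply_eq_comp]

namespace POVMFamily

variable {X A : Type*} [Fintype A]

/-- The measurement operators as linear maps. -/
def linOp (M : POVMFamily X A) (i : X × A) : M.H →ₗ[ℂ] M.H := (M.op i.1 i.2).toLinearMap

theorem adjoint_linOp (M : POVMFamily X A) [FiniteDimensional ℂ M.H] (i : X × A) :
    (M.linOp i).adjoint = M.linOp i :=
  LinearMap.ext fun v => ext_inner_right ℂ fun w => by
    rw [LinearMap.adjoint_inner_left]
    exact ((M.isPositive i.1 i.2).isSymmetric v w).symm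

theorem IsIrreducible.exists_isometry {M' : POVMFamily X A} (h : M'.IsIrreducible)
    (M : POVMFamily X A) [FiniteDimensional ℂ M'.H] [FiniteDimensional ℂ M.H] :
    ∃ (K : Type) (_ : NormedAddCommGroup K) (_ : InnerProductSpace ℂ K)
      (_ : FiniteDimensional ℂ K) (I : M.H →ₗᵢ[ℂ] M'.H ⊗[ℂ] K),
      ∀ T ∈ intertwiners M'.linOp M.linOp, ∃ k, ∀ v, I (T v) = v ⊗ₜ k := by
  refine exists_isometry_apply_eq_tmul M'.adjoint_linOp M.adjoint_linOp fun S hS => ?_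
  obtain ⟨c, hc⟩ := h S.toContinuousLinearMap fun x a =>
    ContinuousLinearMap.ext fun v => LinearMap.congr_fun (hS (x, a)) v
  exact ⟨c, LinearMap.ext fun v => congrArg (fun T : M'.H →L[ℂ] M'.H => T v) hc⟩

end POVMFamily

theorem norm_tensorTensorTensorComm_tmul {E F G H : Type*} [NormedAddCommGroup E]
    [InnerProductSpace ℂ E] [NormedAddCommGroup F] [InnerProductSpace ℂ F]
    [NormedAddCommGroup G] [InnerProductSpace ℂ G] [NormedAddCommGroup H] [InnerProductSpace ℂ H]
    (u : E ⊗[ℂ] F) (v : G ⊗[ℂ] H) :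
    ‖TensorProduct.tensorTensorTensorComm ℂ E F G H (u ⊗ₜ v)‖ = ‖u‖ * ‖v‖ := by
  have h : ∀ w : E ⊗[ℂ] F, ⟪w, w⟫_ℂ = ((‖w‖ ^ 2 : ℝ) : ℂ) := fun w =>
    (inner_self_eq_norm_sq_to_K (𝕜 := ℂ) (E := E ⊗[ℂ] F) w).trans (RCLike.ofReal_pow _ _).symm
  have h' : ∀ w : G ⊗[ℂ] H, ⟪w, w⟫_ℂ = ((‖w‖ ^ 2 : ℝ) : ℂ) := fun w =>
    (inner_self_eq_norm_sq_to_K (𝕜 := ℂ) (E := G ⊗[ℂ] H) w).trans (RCLike.ofReal_pow _ _).symm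
  have h₁ := inner_self_eq_norm_sq_to_K (𝕜 := ℂ) (E := (E ⊗[ℂ] G) ⊗[ℂ] (F ⊗[ℂ] H))
    (TensorProduct.tensorTensorTensorComm ℂ E F G H (u ⊗ₜ v))
  have h₂ := h₁.symm.trans (inner_tensorTensorTensorComm (u ⊗ₜ[ℂ] v) (u ⊗ₜ[ℂ] v))
  rw [TensorProduct.inner_tmul, h, h', ← Complex.ofReal_mul, ← mul_pow] at h₂
  rw [← sq_eq_sq₀ (norm_nonneg _) (mul_nonneg (norm_nonneg _) (norm_nonneg _))]
  exact RCLike.ofReal_injective (K := ℂ) ((RCLike.ofReal_pow _ _).trans h₂)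

/-- If `I T_i = (· ⊗ k_i)` and `J S_i = (· ⊗ l_i)`, then the auxiliary vector is `∑ k_i ⊗ l_i`, the
same for every input. -/
theorem exists_aux_of_sum_map {E F G H K L : Type*} [NormedAddCommGroup E]
    [InnerProductSpace ℂ E] [NormedAddCommGroup F] [InnerProductSpace ℂ F]
    [NormedAddCommGroup G] [InnerProductSpace ℂ G] [NormedAddCommGroup H] [InnerProductSpace ℂ H]
    [NormedAddCommGroup K] [InnerProductSpace ℂ K] [NormedAddCommGroup L] [InnerProductSpace ℂ L]
    {I : G →ₗᵢ[ℂ] E ⊗[ℂ] K} {J : H →ₗᵢ[ℂ] F ⊗[ℂ] L} {U : E ⊗[ℂ] F →ₗ[ℂ] G ⊗[ℂ] H} {n : ℕ}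
    {T : Fin n → E →ₗ[ℂ] G} {S : Fin n → F →ₗ[ℂ] H}
    (hU : ∀ e f, U (e ⊗ₜ f) = ∑ i, T i e ⊗ₜ S i f) (hT : ∀ i, ∃ k, ∀ e, I (T i e) = e ⊗ₜ k)
    (hS : ∀ i, ∃ l, ∀ f, J (S i f) = f ⊗ₜ l) :
    ∃ aux : K ⊗[ℂ] L, ∀ v, TensorProduct.map I.toLinearMap J.toLinearMap (U v) =
      TensorProduct.tensorTensorTensorComm ℂ E F K L (v ⊗ₜ aux) := by
  choose k hk using hT
  choose l hl using hS
  refine ⟨∑ i, k i ⊗ₜ l i, fun v => ?_⟩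
  refine LinearMap.congr_fun (f := TensorProduct.map I.toLinearMap J.toLinearMap ∘ₗ U)
    (g := (TensorProduct.tensorTensorTensorComm ℂ E F K L).toLinearMap ∘ₗ
      (TensorProduct.mk ℂ (E ⊗[ℂ] F) (K ⊗[ℂ] L)).flip (∑ i, k i ⊗ₜ l i)) ?_ v
  ext e f
  simp [hU, hk, hl]

namespace QuantumModel

variable {X Y A B : Type*} [Fintype A] [Fintype B]

theorem rep_left (S : QuantumModel X Y A B) (x : X) (a : A) :
    S.rep (POVMTensor.left x a) = (S.M.op x a).rTensor S.N.H :=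
  (htensorEquiv_symm_opTensor _ _ _ _).trans (ContinuousLinearMap.rTensor_eq_mapL _ _).symm

theorem rep_right (S : QuantumModel X Y A B) (y : Y) (b : B) :
    S.rep (POVMTensor.right y b) = (S.N.op y b).lTensor S.M.H :=
  (htensorEquiv_symm_opTensor _ _ _ _).trans (ContinuousLinearMap.lTensor_eq_mapL _ _).symm

/-- A model with irreducible measurements is a local dilation of every model that defines the
same state. -/
theorem locallyDilatesTo_of_state_eq {S S' : QuantumModel X Y A B} (hM : S'.M.IsIrreducible)
    (hN : S'.N.IsIrreducible) (h : S.state = S'.state) : S.LocallyDilatesTo S' := by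
  -- `U` runs from the irreducible model to `S`, opposite to the dilation: local intertwiners out of
  -- an irreducible family are what the multiplicity spaces describe.
  obtain ⟨U, hUψ, hU⟩ := exists_intertwiner_of_inner_eq (E := S'.M.H ⊗[ℂ] S'.N.H)
    (F := S.M.H ⊗[ℂ] S.N.H) S'.rep S.rep S'.ψ S.ψ fun t => by
      rw [← state_apply, ← state_apply, h]
  obtain ⟨n, T, R, hTR⟩ := exists_sum_map_of_intertwines (M' := S'.M.linOp) (M := S.M.linOp)
    (N' := S'.N.linOp) (N := S.N.linOp) U
    (fun i v => by
      have := hU (POVMTensor.left i.1 i.2) v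
      rwa [rep_left, rep_left] at this)
    (fun j v => by
      have := hU (POVMTensor.right j.1 j.2) v
      rwa [rep_right, rep_right, ContinuousLinearMap.lTensor_apply,
        ContinuousLinearMap.lTensor_apply] at this)
  obtain ⟨KA, _, _, _, I, hI⟩ := hM.exists_isometry S.M
  obtain ⟨KB, _, _, _, J, hJ⟩ := hN.exists_isometry S.N
  obtain ⟨aux, haux⟩ := exists_aux_of_sum_map hTR (fun i => hI _ (T i).2) (fun i => hJ _ (R i).2)
  refine ⟨KA, KB, inferInstance, inferInstance, inferInstance, inferInstance, inferInstance,
    inferInstance, aux, I, J, ?_, fun x y a b => ?_⟩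
  · have h1 := congrArg norm (haux S'.ψ)
    rw [hUψ, norm_tensorTensorTensorComm_tmul, S'.norm_ψ, one_mul] at h1
    rw [← h1, ← S.norm_ψ]
    exact TensorProduct.norm_map I J S.ψ
  · rw [← haux]
    congr 1
    have := hU (POVMTensor.gen x y a b) S'.ψ
    rw [rep_gen, rep_gen, hUψ] at this
    exact this.symm

end QuantumModel

/-! ### Self-tests and abstract state self-tests -/

section Equivalence

variable {X Y A B : Type*} [Fintype A] [Fintype B] [Nonempty X] [Nonempty Y]
  {p : X → Y → A → B → ℝ}

namespace QuantumModel

theorem IsModelFor.exists_fullRank {S : QuantumModel X Y A B} (hS : S.IsModelFor p)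
    (hp : IsSynchronous p ∨ (Fintype.card A = 2 ∧ Fintype.card B = 2))
    (hext : p ∈ Set.extremePoints ℝ (Cq X Y A B)) :
    ∃ S' : QuantumModel X Y A B, S'.FullRank ∧ S'.IsProjective ∧ S'.IsModelFor p ∧
      S'.state = S.state := by
  obtain ⟨S', hc, hfull⟩ := S.exists_fullRank_isCompression
  have hm := hc.isModelFor hS
  have hproj := hfull.isProjective hm hp hext
  exact ⟨S', hfull, hproj, hm, hc.state_eq hproj⟩

end QuantumModel

theorem AbstractState.exists_fullRank_model {f : AbstractState (POVMTensor X Y A B)}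
    (hf : f.IsFiniteDimensional) (hfp : f.HasCorrelation p)
    (hp : IsSynchronous p ∨ (Fintype.card A = 2 ∧ Fintype.card B = 2))
    (hext : p ∈ Set.extremePoints ℝ (Cq X Y A B)) :
    ∃ S : QuantumModel X Y A B, S.FullRank ∧ S.IsProjective ∧ S.IsModelFor p ∧ S.state = f := by
  obtain ⟨S, rfl⟩ := hf.exists_model
  exact ((S.hasCorrelation_state_iff p).1 hfp).exists_fullRank hp hext

/-- Finite-dimensional states whose correlation is synchronous or binary and extreme are
projective. -/
theorem AbstractState.isProjective_of_extreme {f : AbstractState (POVMTensor X Y A B)}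
    (hf : f.IsFiniteDimensional) (hfp : f.HasCorrelation p)
    (hp : IsSynchronous p ∨ (Fintype.card A = 2 ∧ Fintype.card B = 2))
    (hext : p ∈ Set.extremePoints ℝ (Cq X Y A B)) : f.IsProjective := by
  obtain ⟨S, -, hS, -, rfl⟩ := AbstractState.exists_fullRank_model hf hfp hp hext
  exact hS.state

/-- Every competing state comes from a model that is both full rank and projective. Being
projective, it belongs to `𝒞` and so dilates to the ideal model; being full rank, it then has the
ideal model's state. The ideal model itself needs neither property. -/
theorem IsSelfTest.isAbstractStateSelfTest {𝒞 : Set (QuantumModel X Y A B)}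
    (h𝒞 : ∀ S : QuantumModel X Y A B, S.IsProjective → S ∈ 𝒞) (h : IsSelfTest 𝒞 p)
    (hp : IsSynchronous p ∨ (Fintype.card A = 2 ∧ Fintype.card B = 2))
    (hext : p ∈ Set.extremePoints ℝ (Cq X Y A B)) :
    IsAbstractStateSelfTest {f | f.IsFiniteDimensional} p := by
  obtain ⟨S', -, hm, hS'⟩ := h
  refine ⟨S'.state, ⟨S'.state_isFiniteDimensional, (S'.hasCorrelation_state_iff p).2 hm⟩, ?_⟩
  rintro f ⟨hf, hfp⟩
  obtain ⟨S, hfull, hproj, hSm, rfl⟩ := AbstractState.exists_fullRank_model hf hfp hp hext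
  exact hfull.state_eq_of_locallyDilatesTo (hS' S (h𝒞 S hproj) hSm)

/-- The irreducible full-rank model serves as the ideal one and is projective, hence in `𝒞`. By
uniqueness all models of `p` have its state, and irreducibility converts this into local dilations.
-/
theorem IsAbstractStateSelfTest.isSelfTest {𝒞 : Set (QuantumModel X Y A B)}
    (h𝒞 : ∀ S : QuantumModel X Y A B, S.IsProjective → S ∈ 𝒞)
    (h : IsAbstractStateSelfTest {f : AbstractState (POVMTensor X Y A B) |
      f.IsFiniteDimensional} p)
    (hp : IsSynchronous p ∨ (Fintype.card A = 2 ∧ Fintype.card B = 2))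
    (hext : p ∈ Set.extremePoints ℝ (Cq X Y A B)) : IsSelfTest 𝒞 p := by
  obtain ⟨S', hm, hfull, hM, hN⟩ := QuantumModel.exists_irreducible_model hext
  refine ⟨S', h𝒞 S' (hfull.isProjective hm hp hext), hm, fun S _ hS => ?_⟩
  exact QuantumModel.locallyDilatesTo_of_state_eq hM hN (h.unique
    ⟨S.state_isFiniteDimensional, (S.hasCorrelation_state_iff p).2 hS⟩
    ⟨S'.state_isFiniteDimensional, (S'.hasCorrelation_state_iff p).2 hm⟩)

end Equivalence

end SelfTest

end

theorem theorem3p7 {X Y A B : Type*} [Finite X] [Finite Y] [Nonempty X] [Nonempty Y]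
    [Fintype A] [Fintype B] (p : X → Y → A → B → ℝ)
    (hp : SelfTest.IsSynchronous p ∨ (Fintype.card A = 2 ∧ Fintype.card B = 2))
    (hext : p ∈ Set.extremePoints ℝ (SelfTest.Cq X Y A B)) :
    List.TFAE [
      SelfTest.IsSelfTest Set.univ p,
      SelfTest.IsSelfTest {S : SelfTest.QuantumModel X Y A B | S.IsProjective} p,
      SelfTest.IsAbstractStateSelfTest {f | f.IsFiniteDimensional} p,
      SelfTest.IsAbstractStateSelfTest {f | f.IsFiniteDimensional ∧ f.IsProjective} p] := by
  tfae_have 1 → 3 := fun h => h.isAbstractStateSelfTest (fun _ _ => trivial) hp hext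
  tfae_have 2 → 3 := fun h => h.isAbstractStateSelfTest (fun _ hS => hS) hp hext
  tfae_have 3 → 1 := fun h => h.isSelfTest (fun _ _ => trivial) hp hext
  tfae_have 3 → 2 := fun h => h.isSelfTest (fun _ hS => hS) hp hext
  -- The two sets of candidate states coincide, since every finite-dimensional state with
  -- correlation `p` is automatically projective.
  tfae_have 3 ↔ 4 := by
    refine existsUnique_congr fun f => ⟨fun ⟨hf, hfp⟩ => ⟨⟨hf, ?_⟩, hfp⟩, fun h => ⟨h.1.1, h.2⟩⟩
    exact SelfTest.AbstractState.isProjective_of_extreme hf hfp hp hext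
  tfae_finish
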